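/- Let $\mu,\sigma,\delta>0$ and $0<p<1$, and put $q=\frac{p}{1-p}$, $G=\sqrt{2\delta(1-p)\sigma^2/p}$, $A=\frac{\delta}{p}+\frac{(1-p)\sigma^2}{2}$, $\pi=\frac{\mu}{(1-p)\sigma^2}$. Assume $\mu<G$ and $\pi\ge 1$. Let $$P(x,z)=-2q\delta z^2+2p(\mu x+1)z-(1-p)^2\sigma^2x^2,$$ $$Q(x,z)=-P(x,z)+\bigl(p\sigma^2-2\delta(1+q)\bigr)xz+2\bigl(\mu-(1-p)\sigma^2\bigr)x^2+2x,\qquad L=P/Q .$$ Let $T_u(x,0)$ and $T_d(x,0)$ be the largest and the smallest root $z$ of $P(x,z)=0$ (for those $x>0$ for which there is a root). Put $x_P=\frac1{A-\mu}$, $z_P=\frac{x_P}{q}$ (the point $(x_P,z_P)$, called the singular point $P$, is the only point with $x>0$ and $P=Q=0$), $x_N=\frac{2\mu}{G^2-\mu^2}$ and $x_E=\frac1{G-\mu}$ (the first coordinates of the highest and of the right-most point of the curve $\{P=0,\ x>0\}$). A continuous solution on an interval $D\subseteq(0,\infty)$ is a continuous function $g:D\to\mathbb R$ such that, at every interior point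 $x\ne x_P$ of $D$, $L(x,g(x))$ is defined, $g$ is differentiable and $g'(x)=L(x,g(x))$. It is inner if $T_d(x,0)\le g(x)\le T_u(x,0)$ on $D$, and maximal inner if it is inner and has no extension to an inner continuous solution on a strictly larger interval. We say that $g$ satisfies (HJB) at $x$ if $$\inf_{\Sigma,\theta\in\mathbb R}\Bigl(\tfrac12\Sigma^2\tfrac{x}{g'(x)}-\bigl(\theta\sigma-\mu-\Sigma(\tfrac12\Sigma+\sigma-\theta(1+q))\bigr)x-(1+q)\bigl(\delta-\tfrac12q\theta^2\bigr)g(x)+1\Bigr)=0 .$$ For every $\alpha\in(0,x_N)$ with $\alpha\neq x_P$ there is a maximal inner solution $g$ on some interval containing $\alpha$ with $g(\alpha)=T_u(\alpha,0)$. Choose any such solution for each such $\alpha$ and call it $g_\alpha$. The domain of $g_\alpha$ is then a compact interval $[\alpha,\beta_\alpha]$ with $\alpha<\beta_\alpha\le x_E$, and the following hold. 1. If $\pi>1$, then $0<x_P<x_N$ and: a) for $\alpha\in(x_P,x_N)$, $g_\alpha$ is $C^\infty$ on $[\alpha,\beta_\alpha]$ and its graph does not contain the singular point; b) the limits $\beta_{x_P}=\lim_{\alpha\searrow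 x_P}\beta_\alpha\in(x_P,x_E]$, $g_{x_P}(x)=\lim_{\alpha\searrow x_P}g_\alpha(x)$ for $x\in(x_P,\beta_{x_P})$, and $g_{x_P}(\beta_{x_P})=\lim_{\alpha\searrow x_P}g_\alpha(\beta_\alpha)$ exist and, with $g_{x_P}(x_P)=z_P$, define a continuous solution on $[x_P,\beta_{x_P}]$, which satisfies (HJB) on $(x_P,\beta_{x_P})$; c) for $\alpha\in(0,x_P)$, $g_\alpha$ is $C^2$ on $[\alpha,\beta_\alpha]$, $\alpha<x_P<\beta_\alpha$, $g_\alpha(x_P)=z_P$, $g_\alpha'(x_P)=\frac{\partial}{\partial x}T_u(x_P,0)$, and $g_\alpha''(x_P)=\kappa$, where $$\kappa=-\frac{(1-p)^2\sigma^2\,(2\delta-2p\mu+p(1-p)\sigma^2)^2\,(2\delta+2(1-p)\mu+(p-2)(1-p)\sigma^2)}{p\,(2\delta-p(1-p)\sigma^2)^3}.$$ 2. If $\pi=1$, then $x_N=x_P$ and, for every $\alpha\in(0,x_N)$, $(\beta_\alpha,g_\alpha(\beta_\alpha))=(x_P,z_P)$, $g_\alpha$ is $C^2$ on $[\alpha,\beta_\alpha]$,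 and its (one-sided) second derivative at $x_P$ is $\kappa$. In both cases $g_\alpha'(x)/x$ is integrable on $(\alpha,\beta_\alpha)$ for every $\alpha\in(0,x_N)$ (including $\alpha=x_P$ if $\pi>1$), and the function $G(\alpha)=\int_\alpha^{\beta_\alpha}\frac{g_\alpha'(x)}{x}\,dx$ is continuous on $(0,x_N)$, with $\lim_{\alpha\searrow0}G(\alpha)=+\infty$ and $\lim_{\alpha\nearrow x_N}G(\alpha)=0$. Consequently, for all $\underline\lambda\in(0,1)$ and $\overline\lambda>0$ there is $\alpha\in(0,x_N)$ such that $g_\alpha$ solves the free-boundary problem on $[\alpha,\beta_\alpha]$: $g_\alpha\in C^2[\alpha,\beta_\alpha]$, $g_\alpha'>0$ and (HJB) holds on $(\alpha,\beta_\alpha)$, $g_\alpha'(\beta_\alpha-)=0$, $g_\alpha'(\alpha+)=0$ unless $(\alpha,g_\alpha(\alpha))$ is the singular point, and $$\int_\alpha^{\beta_\alpha}\frac{g_\alpha'(x)}{x}\,dx=\log\frac{1+\overline\lambda}{1-\underline\lambda}.$$ -/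

import Mathlib

open Set Filter Topology

namespace ShadowODE

/-- The constants of the model: rate of return `μ`, volatility `σ`, power `p` of the utility
`c ↦ c ^ p / p`, impatience rate `δ`. All formulas below are those of the case `0 < p < 1`
(in particular `sgn p = 1`). -/
structure Params where
  μ : ℝ
  σ : ℝ
  p : ℝ
  δ : ℝ

noncomputable section

namespace Params

/-- `q = p / (1 - p)`. -/
def q (c : Params) : ℝ := c.p / (1 - c.p)

/-- `G = √(2 δ (1 - p) σ² / p)`. -/
def geo (c : Params) : ℝ := Real.sqrt (2 * c.δ * (1 - c.p) * c.σ ^ 2 / c.p)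

/-- `A = δ / p + (1 - p) σ² / 2`. -/
def ari (c : Params) : ℝ := c.δ / c.p + (1 - c.p) * c.σ ^ 2 / 2

/-- The Merton proportion `π = μ / ((1 - p) σ²)`. -/
def merton (c : Params) : ℝ := c.μ / ((1 - c.p) * c.σ ^ 2)

/-- The numerator `P(x, z)` of the right-hand side of the equation. -/
def polyP (c : Params) (x z : ℝ) : ℝ :=
  -2 * c.q * c.δ * z ^ 2 + 2 * c.p * (c.μ * x + 1) * z - (1 - c.p) ^ 2 * c.σ ^ 2 * x ^ 2

/-- The denominator `Q(x, z)`; here `δ (1 + q)` is the constant `δ̂`. -/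
def polyQ (c : Params) (x z : ℝ) : ℝ :=
  -c.polyP x z + (c.p * c.σ ^ 2 - 2 * (c.δ * (1 + c.q))) * x * z
    + 2 * (c.μ - (1 - c.p) * c.σ ^ 2) * x ^ 2 + 2 * x

/-- `L = P / Q`; only meaningful where `Q ≠ 0`. -/
def L (c : Params) (x z : ℝ) : ℝ := c.polyP x z / c.polyQ x z

/-- The set of `x > 0` over which the level curve `L = k`, i.e. `P = k Q`, has a point. -/
def levelDomain (c : Params) (k : ℝ) : Set ℝ :=
  {x | 0 < x ∧ ∃ z, c.polyP x z = k * c.polyQ x z}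

/-- `T_u(x, k)`: the largest `z` with `P(x, z) = k Q(x, z)` (for `x ∈ levelDomain k`). -/
def upperGraph (c : Params) (x k : ℝ) : ℝ := sSup {z | c.polyP x z = k * c.polyQ x z}

/-- `T_d(x, k)`: the smallest `z` with `P(x, z) = k Q(x, z)` (for `x ∈ levelDomain k`). -/
def lowerGraph (c : Params) (x k : ℝ) : ℝ := sInf {z | c.polyP x z = k * c.polyQ x z}

/-- The curve `𝕋 = {P = 0}` in the open right half-plane. -/
def curveT (c : Params) : Set (ℝ × ℝ) := {w | 0 < w.1 ∧ c.polyP w.1 w.2 = 0}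

/-- First coordinate of the singular point (for `μ < A`); see `singular_iff`. -/
def xP (c : Params) : ℝ := 1 / (c.ari - c.μ)

/-- Second coordinate of the singular point. -/
def zP (c : Params) : ℝ := c.xP / c.q

/-- First coordinate of the highest point of `𝕋` (for `μ < G`); see `north_highest`. -/
def xN (c : Params) : ℝ := 2 * c.μ / (c.geo ^ 2 - c.μ ^ 2)

/-- First coordinate of the right-most point of `𝕋` (for `μ < G`); see `east_rightmost`. -/
def xE (c : Params) : ℝ := 1 / (c.geo - c.μ)

/-- A continuous solution `g : D → ℝ` of `g' = L(·, g)` on an interval `D ⊆ (0, ∞)`: the equation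
is required at the interior points of `D` other than `x_P`. Requiring `L` to be defined
at such a point of the graph is the condition `Q ≠ 0`. Only the values of `g` on `D` matter. -/
structure IsContinuousSolution (c : Params) (D : Set ℝ) (g : ℝ → ℝ) : Prop where
  interval : D.OrdConnected
  pos : D ⊆ Ioi 0
  continuous : ContinuousOn g D
  equation : ∀ x ∈ interior D, x ≠ c.xP →
    c.polyQ x (g x) ≠ 0 ∧ HasDerivAt g (c.L x (g x)) x

/-- A continuous solution that stays between the lower and the upper graph of `𝕋`. -/
structure IsInnerSolution (c : Params) (D : Set ℝ) (g : ℝ → ℝ) : Prop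
    extends IsContinuousSolution c D g where
  inside : ∀ x ∈ D, x ∈ c.levelDomain 0 ∧ c.lowerGraph x 0 ≤ g x ∧ g x ≤ c.upperGraph x 0

/-- A maximal inner solution: an inner solution without an inner extension to a strictly larger
interval. -/
structure IsMaximalInnerSolution (c : Params) (D : Set ℝ) (g : ℝ → ℝ) : Prop
    extends IsInnerSolution c D g where
  maximal : ∀ (D' : Set ℝ) (g' : ℝ → ℝ),
    IsInnerSolution c D' g' → D ⊆ D' → EqOn g' g D → D' = D

/-- A maximal inner solution started at the point `(α, T_u(α, 0))`. -/
structure IsMaximalInnerSolutionFrom (c : Params) (α : ℝ) (D : Set ℝ) (g : ℝ → ℝ) : Prop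
    extends IsMaximalInnerSolution c D g where
  mem : α ∈ D
  initial : g α = c.upperGraph α 0

/-- `α_q(Σ, θ)`. -/
def alphaQ (c : Params) (S θ : ℝ) : ℝ :=
  θ * c.σ - c.μ - S * (S / 2 + c.σ - θ * (1 + c.q))

/-- `β(θ)`. -/
def betaFn (c : Params) (θ : ℝ) : ℝ := (1 + c.q) * (c.δ - c.q * θ ^ 2 / 2)

/-- The equation
`inf_{Σ, θ} (½ Σ² x / g'(x) - α_q(Σ, θ) x - β(θ) g(x) + 1) = 0` at the point `x`. -/
def HJBAt (c : Params) (g : ℝ → ℝ) (x : ℝ) : Prop :=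
  IsGLB (range fun w : ℝ × ℝ =>
    w.1 ^ 2 / 2 * (x / deriv g x) - c.alphaQ w.1 w.2 * x - c.betaFn w.2 * g x + 1) 0

/-- `(a, b, g)` solves the free-boundary problem with the level `ℓ` in the integral condition:
`g ∈ C²[a, b]`, `g' > 0` and the equation hold on `(a, b)`, `g'(a+) = g'(b-) = 0`, and
`∫_a^b g'(x) / x dx = ℓ`. The condition at `a` is waived if `(a, g(a))` is the singular point. -/
structure SolvesFreeBoundary (c : Params) (a b : ℝ) (g : ℝ → ℝ) (l : ℝ) : Prop where
  pos : 0 < a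
  lt : a < b
  smooth : ContDiffOn ℝ 2 g (Icc a b)
  increasing : ∀ x ∈ Ioo a b, 0 < deriv g x
  equation : ∀ x ∈ Ioo a b, c.HJBAt g x
  left : (a, g a) = (c.xP, c.zP) ∨ Tendsto (deriv g) (𝓝[>] a) (𝓝 0)
  right : Tendsto (deriv g) (𝓝[<] b) (𝓝 0)
  integrable : IntervalIntegrable (fun x => deriv g x / x) MeasureTheory.volume a b
  integral : ∫ x in a..b, deriv g x / x = l

/-- The value of the second derivative at the singular point. -/
def secondDerivP (c : Params) : ℝ :=
  -((1 - c.p) ^ 2 * c.σ ^ 2 * (2 * c.δ - 2 * c.p * c.μ + c.p * (1 - c.p) * c.σ ^ 2) ^ 2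
      * (2 * c.δ + 2 * (1 - c.p) * c.μ + (c.p - 2) * (1 - c.p) * c.σ ^ 2))
    / (c.p * (2 * c.δ - c.p * (1 - c.p) * c.σ ^ 2) ^ 3)

/-! The explicit points above are the ones they are meant to be. -/

theorem geo_sq (c : Params) (hδ : 0 < c.δ) (hp0 : 0 < c.p) (hp1 : c.p < 1) :
    c.geo ^ 2 = 2 * c.δ * (1 - c.p) * c.σ ^ 2 / c.p := by
  have h1 : 0 < 1 - c.p := by linarith
  exact Real.sq_sqrt (by positivity)

/-- `P` is the unique singular point. -/
theorem singular_iff (c : Params) (hσ : 0 < c.σ) (hp0 : 0 < c.p)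
    (hp1 : c.p < 1) (hA : c.μ < c.ari) (x z : ℝ) :
    (0 < x ∧ c.polyP x z = 0 ∧ c.polyQ x z = 0) ↔ (x = c.xP ∧ z = c.zP) := by
  have h1 : 0 < 1 - c.p := by linarith
  have hq : 0 < c.q := div_pos hp0 h1
  have hA' : 0 < c.ari - c.μ := by linarith
  have key : c.q * z * (c.polyP x z + c.polyQ x z) - (1 + c.q) * x * c.polyP x z
      = c.σ ^ 2 * x * (1 - c.p) * (c.q * z - x) ^ 2 := by
    simp only [polyQ, polyP, q]; field_simp; ring
  have onP : c.polyP x (x / c.q) = 2 * (1 - c.p) * x * (1 - (c.ari - c.μ) * x) := by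
    simp only [polyP, q, ari]; field_simp; ring
  have onQ : c.polyQ x (x / c.q) = c.q * (c.polyP x (x / c.q)) := by
    simp only [polyQ, polyP, q]; field_simp; ring
  constructor
  · rintro ⟨hx, hP, hQ⟩
    rw [hP, hQ] at key
    have h2 : (c.q * z - x) ^ 2 = 0 := by
      have : 0 < c.σ ^ 2 * x * (1 - c.p) := by positivity
      have h3 : c.σ ^ 2 * x * (1 - c.p) * (c.q * z - x) ^ 2 = 0 := by rw [← key]; ring
      exact (mul_eq_zero.1 h3).resolve_left this.ne'
    have hz : z = x / c.q := by
      rw [eq_div_iff hq.ne']; linarith [pow_eq_zero_iff (two_ne_zero) |>.1 h2]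
    rw [hz, onP] at hP
    have h4 : 1 - (c.ari - c.μ) * x = 0 :=
      (mul_eq_zero.1 hP).resolve_left (by positivity)
    have hxP : x = c.xP := by
      rw [xP, eq_div_iff hA'.ne']; linarith
    exact ⟨hxP, by rw [hz, zP, hxP]⟩
  · rintro ⟨rfl, rfl⟩
    have h0 : c.polyP c.xP c.zP = 0 := by
      rw [zP, onP, xP]; field_simp; ring
    refine ⟨by rw [xP]; positivity, h0, ?_⟩
    have := onQ
    rw [← zP, h0] at this
    simpa using this

/-- `x_N` is the first coordinate of the (unique) highest point of `𝕋`. -/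
theorem north_highest (c : Params) (hμ : 0 < c.μ) (hσ : 0 < c.σ) (hδ : 0 < c.δ) (hp0 : 0 < c.p)
    (hp1 : c.p < 1) (hG : c.μ < c.geo) :
    ∃ z, (c.xN, z) ∈ c.curveT ∧ ∀ w ∈ c.curveT, w.2 ≤ z ∧ (w.2 = z → w.1 = c.xN) := by
  have h1 : 0 < 1 - c.p := by linarith
  have hG2 := c.geo_sq hδ hp0 hp1
  have hD : 0 < c.geo ^ 2 - c.μ ^ 2 := by nlinarith
  have hx : 0 < c.xN := by rw [xN]; positivity
  have hD2 : c.xN * (c.geo ^ 2 - c.μ ^ 2) = 2 * c.μ := by rw [xN]; field_simp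
  -- sum-of-squares form of `P`
  have sos : ∀ x z, (1 - c.p) * c.σ ^ 2 * c.polyP x z
      = -((1 - c.p) ^ 2 * c.σ ^ 2 * x - c.p * c.μ * z) ^ 2 / (1 - c.p)
        - c.p ^ 2 / (1 - c.p) * (c.geo ^ 2 - c.μ ^ 2) * z ^ 2
        + 2 * c.p * (1 - c.p) * c.σ ^ 2 * z := by
    intro x z
    rw [hG2]; simp only [polyP, q]; field_simp; ring
  have hz0 : 0 < (1 - c.p) ^ 2 * c.σ ^ 2 * c.xN / (c.p * c.μ) := by positivity
  have hzN : c.p ^ 2 / (1 - c.p) * (c.geo ^ 2 - c.μ ^ 2)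
      * ((1 - c.p) ^ 2 * c.σ ^ 2 * c.xN / (c.p * c.μ)) = 2 * c.p * (1 - c.p) * c.σ ^ 2 := by
    have : c.p ^ 2 / (1 - c.p) * (c.geo ^ 2 - c.μ ^ 2)
      * ((1 - c.p) ^ 2 * c.σ ^ 2 * c.xN / (c.p * c.μ))
      = c.p * (1 - c.p) * c.σ ^ 2 / c.μ * (c.xN * (c.geo ^ 2 - c.μ ^ 2)) := by
      field_simp
    rw [this, hD2]; field_simp
  refine ⟨(1 - c.p) ^ 2 * c.σ ^ 2 * c.xN / (c.p * c.μ), ⟨hx, ?_⟩, ?_⟩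
  · have h := sos c.xN ((1 - c.p) ^ 2 * c.σ ^ 2 * c.xN / (c.p * c.μ))
    have e : (1 - c.p) ^ 2 * c.σ ^ 2 * c.xN
        - c.p * c.μ * ((1 - c.p) ^ 2 * c.σ ^ 2 * c.xN / (c.p * c.μ)) = 0 := by field_simp; ring
    rw [e, ← hzN] at h
    have h' : (1 - c.p) * c.σ ^ 2
        * c.polyP c.xN ((1 - c.p) ^ 2 * c.σ ^ 2 * c.xN / (c.p * c.μ)) = 0 := by rw [h]; ring
    exact (mul_eq_zero.1 h').resolve_left (by positivity)
  · rintro ⟨x, z⟩ ⟨hx', hP⟩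
    simp only at hx' hP ⊢
    have h := sos x z
    rw [hP, mul_zero, ← hzN] at h
    set K := c.p ^ 2 / (1 - c.p) * (c.geo ^ 2 - c.μ ^ 2) with hK
    set Z := (1 - c.p) ^ 2 * c.σ ^ 2 * c.xN / (c.p * c.μ) with hZ
    have hK0 : 0 < K := by positivity
    have hs : 0 ≤ ((1 - c.p) ^ 2 * c.σ ^ 2 * x - c.p * c.μ * z) ^ 2 / (1 - c.p) := by positivity
    have h2 : K * (z * (Z - z))
        = ((1 - c.p) ^ 2 * c.σ ^ 2 * x - c.p * c.μ * z) ^ 2 / (1 - c.p) := by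
      rw [neg_div] at h; linarith
    constructor
    · by_contra hlt
      push Not at hlt
      have : K * (z * (Z - z)) < 0 :=
        mul_neg_of_pos_of_neg hK0 (mul_neg_of_pos_of_neg (hz0.trans hlt) (by linarith))
      linarith
    · rintro rfl
      rw [sub_self, mul_zero, mul_zero, eq_comm, div_eq_zero_iff, or_iff_left h1.ne',
        sq_eq_zero_iff] at h2
      have e : c.p * c.μ * Z = (1 - c.p) ^ 2 * c.σ ^ 2 * c.xN := by rw [hZ]; field_simp
      rw [e] at h2
      have h3 : (1 - c.p) ^ 2 * c.σ ^ 2 * (x - c.xN) = 0 := by linarith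
      have := (mul_eq_zero.1 h3).resolve_left (by positivity)
      linarith

/-- `x_E` is the first coordinate of a right-most point of `𝕋`. -/
theorem east_rightmost (c : Params) (hμ : 0 < c.μ) (hδ : 0 < c.δ) (hp0 : 0 < c.p)
    (hp1 : c.p < 1) (hG : c.μ < c.geo) :
    IsGreatest (Prod.fst '' c.curveT) c.xE := by
  have h1 : 0 < 1 - c.p := by linarith
  have hG2 := c.geo_sq hδ hp0 hp1
  have hD : 0 < c.geo - c.μ := by linarith
  have hx : 0 < c.xE := by rw [xE]; positivity
  have hxE : c.xE * (c.geo - c.μ) = 1 := by rw [xE]; field_simp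
  have sq : ∀ x z, -(8 * c.δ * c.p / (1 - c.p)) * c.polyP x z
      = (4 * c.δ * c.p / (1 - c.p) * z - 2 * c.p * (c.μ * x + 1)) ^ 2
        - 4 * c.p ^ 2 * ((c.μ * x + 1) ^ 2 - c.geo ^ 2 * x ^ 2) := by
    intro x z
    rw [hG2]; simp only [polyP, q]; field_simp; ring
  constructor
  · refine ⟨(c.xE, 2 * c.p * (c.μ * c.xE + 1) / (4 * c.δ * c.p / (1 - c.p))), ⟨hx, ?_⟩, rfl⟩
    have h := sq c.xE (2 * c.p * (c.μ * c.xE + 1) / (4 * c.δ * c.p / (1 - c.p)))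
    have e : c.μ * c.xE + 1 = c.geo * c.xE := by linarith
    rw [mul_div_cancel₀ _ (by positivity), e, mul_pow] at h
    have h' : -(8 * c.δ * c.p / (1 - c.p))
      * c.polyP c.xE (2 * c.p * (c.geo * c.xE) / (4 * c.δ * c.p / (1 - c.p))) = 0 := by
      rw [h]; ring
    simp only
    rw [e]
    exact (mul_eq_zero.1 h').resolve_left (neg_ne_zero.2 (by positivity))
  · rintro _ ⟨⟨x, z⟩, ⟨hx', hP⟩, rfl⟩
    simp only at hx' hP ⊢
    have h := sq x z
    rw [hP, mul_zero] at h
    have h2 : (c.geo * x) ^ 2 ≤ (c.μ * x + 1) ^ 2 := by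
      have : 0 < c.p ^ 2 := by positivity
      nlinarith [sq_nonneg (4 * c.δ * c.p / (1 - c.p) * z - 2 * c.p * (c.μ * x + 1))]
    have h3 : c.geo * x ≤ c.μ * x + 1 :=
      le_of_sq_le_sq h2 (by positivity)
    rw [xE, le_div_iff₀ hD]; linarith

end Params

end

end ShadowODE

/-! The substitution `w = q z` turns the equation into `w' = p P / Q`, with `P` and `Q` depending on
the four constants of `Reduced`, and moves the singular point onto the diagonal, to `(xP, xP)`. Two
polynomial identities carry the sign analysis on the region `0 ≤ P`: `Reduced.key` controls the sign
of `Q`, and `Reduced.key_ray` compares the slope of a solution with that of the ray through the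
origin by means of a quadratic form `J`.

Right of `xP` the region lies under the diagonal. There `Q > 0` and solutions are flatter than rays,
so `h x / x` decreases strictly. Along a solution `P` satisfies a linear equation with source `2 (μ
h - a x)`, which therefore changes sign at most once, from positive to negative. Hence a solution
started on the rising part of the upper branch enters the region, leaves it once, through the right
part of the boundary, and cannot be continued inside it. The slope field is clamped to the region,
so that it vanishes outside; the clamped solutions live on a fixed interval up to `xE`, are constant
before the start and after the exit, and depend continuously on the start by Grönwall.

Left of `xP`, `Q` need not be positive on the whole region, but it is on the strip `0 ≤ P`, `0 ≤ J`.
Along the lower edge `J = 0` solutions have the slope of the ray while the edge itself falls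
relative to rays, so the strip is a funnel. It closes at the singular point, and every solution from
the left runs into it. If `a < μ`, all of them continue along the single solution `singSol`, the
limit of the right-hand family; uniqueness holds because near the singular point the slope decreases
in `w`. If `a = μ`, the singular point is the highest point of the region and a nondecreasing
solution has to stop there.

For the regularity at the singular point, the slope `k` along a solution satisfies `ρ k' = -Psi(w /
x, k)` with `ρ → 0`. `Psi(1, ·)` has a simple zero at the slope `m` of the upper branch and a double
zero at `1`, so levels near `m` are barriers and `k → m`. One more differentiation gives a singular
linear equation for `k'`, whose formal limit is `curv`.

(HJB) is the infimum of a quadratic polynomial in `(Σ, θ)`; it is positive definite along the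
solutions, and `P = g' Q` says that its minimum is zero. Integration by parts writes the integral
over a fixed interval in terms of the values of the solution, so it is continuous in `α`. Its limits
at the two ends of `(0, xN)` and the intermediate value theorem give the free-boundary problem. -/

namespace ShadowODE

/-! ### Algebra of the reduced equation: the curve `P = 0`, its special points, the sign of `Q`. -/

/-- The constants of the equation after the substitution `w = q z`, with the standing
inequalities between them. -/
structure Reduced where
  μ : ℝ
  a : ℝ
  e : ℝ
  p : ℝ
  a_pos : 0 < a
  a_le : a ≤ μ
  disc_lt : μ ^ 2 < 2 * e * a
  p_pos : 0 < p
  p_lt : p < 1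

noncomputable section

namespace Reduced

variable (n : Reduced)

theorem μ_pos : 0 < n.μ := n.a_pos.trans_le n.a_le

theorem e_pos : 0 < n.e := by
  have h := n.disc_lt
  have := n.a_pos
  by_contra hn
  push Not at hn
  nlinarith [sq_nonneg n.μ]

theorem a_lt : n.a < 2 * n.e := by
  have h := n.disc_lt
  have h1 := n.a_pos
  have h2 := n.a_le
  by_contra hn
  push Not at hn
  nlinarith

theorem μ_lt : n.μ < 2 * n.e := by
  have h := n.disc_lt
  have h1 := n.μ_pos
  have h2 := n.a_le
  have := n.e_pos
  by_contra hn
  push Not at hn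
  nlinarith

/-- By AM-GM, `(2e + a)² ≥ 8 e a > 4 μ²`. This makes the denominator of `xP` positive. -/
theorem two_mul_μ_lt : 2 * n.μ < 2 * n.e + n.a := by
  have h := n.disc_lt
  have h1 := n.a_pos
  have := n.e_pos
  by_contra hn
  push Not at hn
  nlinarith [sq_nonneg (2 * n.e - n.a)]

theorem gap_pos : 0 < 2 * n.e * n.a - n.μ ^ 2 := by linarith [n.disc_lt]

/-- The rescaled numerator. -/
def P (x w : ℝ) : ℝ := 2 * w + 2 * n.μ * x * w - 2 * n.e * w ^ 2 - n.a * x ^ 2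

/-- The denominator in the rescaled variables. -/
def Q (x w : ℝ) : ℝ :=
  x * (2 + 2 * (n.μ - n.a) * x - (2 * n.e - n.a) * w) - (1 - n.p) * n.P x w

/-- The rescaled slope. -/
def slope (x w : ℝ) : ℝ := n.p * n.P x w / n.Q x w

/-- The quadratic form whose sign compares the slope with the slope of the ray through the
origin. -/
def J (x w : ℝ) : ℝ := n.a * x * (w - x) - (1 - n.p) * n.P x w

/-- Common first and second coordinate of the singular point. -/
def xP : ℝ := 2 / (2 * n.e + n.a - 2 * n.μ)

def xN : ℝ := 2 * n.μ / (2 * n.e * n.a - n.μ ^ 2)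

/-- The height of the highest point. -/
def wN : ℝ := 2 * n.a / (2 * n.e * n.a - n.μ ^ 2)

def xE : ℝ := 1 / (Real.sqrt (2 * n.e * n.a) - n.μ)

/-- The slope of the upper branch at the singular point. -/
def m : ℝ := 2 * (n.μ - n.a) / (2 * n.e - n.a)

def disc (x : ℝ) : ℝ := (1 + n.μ * x) ^ 2 - 2 * n.e * n.a * x ^ 2

def top (x : ℝ) : ℝ := (1 + n.μ * x + Real.sqrt (n.disc x)) / (2 * n.e)

def bot (x : ℝ) : ℝ := (1 + n.μ * x - Real.sqrt (n.disc x)) / (2 * n.e)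

variable {n}

/-- Read as `w Q = a x (w - x)² + P (x - (1 - p) w)`, this is the source of all lower bounds for
`Q`. It also shows why a common zero of `P` and `Q` with `x > 0` lies on the diagonal. -/
theorem key (x w : ℝ) :
    w * (n.Q x w + (1 - n.p) * n.P x w) = x * n.P x w + n.a * x * (w - x) ^ 2 := by
  simp only [Q, P]; ring

/-- Divided by `x Q`: the slope lies below `w / x` exactly when `(w - x) J > 0`, for positive `x`
and `Q`. -/
theorem key_ray (x w : ℝ) : w * n.Q x w - n.p * x * n.P x w = (w - x) * n.J x w := by
  simp only [Q, P, J]; ring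

/-- Completing the square in `w`: the source of the two branches and of `xE`. -/
theorem two_e_mul_P (x w : ℝ) :
    2 * n.e * n.P x w = n.disc x - (2 * n.e * w - 1 - n.μ * x) ^ 2 := by
  simp only [P, disc]; ring

/-- Completing the square in `x`: the source of the highest point and of the right-hand boundary. -/
theorem a_mul_P (x w : ℝ) :
    n.a * n.P x w = -(n.a * x - n.μ * w) ^ 2
      + w * (2 * n.a - (2 * n.e * n.a - n.μ ^ 2) * w) := by
  simp only [P]; ring

theorem pos_of_P_nonneg {x w : ℝ} (hx : 0 < x) (h : 0 ≤ n.P x w) : 0 < w := by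
  have h1 := n.a_pos
  have h2 := n.e_pos
  have h3 := n.μ_pos
  by_contra hw
  push Not at hw
  have : 0 < n.a * x ^ 2 := by positivity
  have h4 : n.μ * x * w ≤ 0 := mul_nonpos_of_nonneg_of_nonpos (by positivity) hw
  simp only [P] at h
  nlinarith [mul_nonneg h2.le (sq_nonneg w)]

theorem disc_nonneg_of_P_nonneg {x w : ℝ} (h : 0 ≤ n.P x w) : 0 ≤ n.disc x := by
  have h1 := n.two_e_mul_P x w
  have h2 : 0 ≤ 2 * n.e * n.P x w := mul_nonneg (by linarith [n.e_pos]) h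
  nlinarith [sq_nonneg (2 * n.e * w - 1 - n.μ * x)]

theorem P_nonneg_iff {x w : ℝ} (h : 0 ≤ n.disc x) :
    0 ≤ n.P x w ↔ n.bot x ≤ w ∧ w ≤ n.top x := by
  have he := n.e_pos
  have h1 := n.two_e_mul_P x w
  have h2 : 0 ≤ n.P x w ↔ (2 * n.e * w - 1 - n.μ * x) ^ 2 ≤ n.disc x := by
    constructor
    · intro h3
      have : 0 ≤ 2 * n.e * n.P x w := by positivity
      linarith
    · intro h3
      have : 0 ≤ 2 * n.e * n.P x w := by linarith
      exact nonneg_of_mul_nonneg_right this (by positivity)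
  rw [h2, ← Real.sqrt_le_sqrt_iff h, Real.sqrt_sq_eq_abs, abs_le, bot, top, div_le_iff₀ (by positivity),
    le_div_iff₀ (by positivity)]
  constructor
  · rintro ⟨h3, h4⟩; constructor <;> linarith
  · rintro ⟨h3, h4⟩; constructor <;> linarith

theorem P_pos_iff {x w : ℝ} :
    0 < n.P x w ↔ n.bot x < w ∧ w < n.top x := by
  have he := n.e_pos
  have h1 := n.two_e_mul_P x w
  have h2 : 0 < n.P x w ↔ (2 * n.e * w - 1 - n.μ * x) ^ 2 < n.disc x := by
    constructor
    · intro h3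
      have : 0 < 2 * n.e * n.P x w := by positivity
      linarith
    · intro h3
      have : 0 < 2 * n.e * n.P x w := by linarith
      exact pos_of_mul_pos_right this (by positivity)
  rw [h2, ← Real.sqrt_lt_sqrt_iff (sq_nonneg _), Real.sqrt_sq_eq_abs, abs_lt, bot, top,
    div_lt_iff₀ (by positivity), lt_div_iff₀ (by positivity)]
  constructor
  · rintro ⟨h3, h4⟩; constructor <;> linarith
  · rintro ⟨h3, h4⟩; constructor <;> linarith

theorem bot_le_top (x : ℝ) : n.bot x ≤ n.top x := by
  have he := n.e_pos
  rw [bot, top]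
  gcongr
  linarith [Real.sqrt_nonneg (n.disc x)]

theorem P_top {x : ℝ} (h : 0 ≤ n.disc x) : n.P x (n.top x) = 0 := by
  have he := n.e_pos
  have h1 := n.two_e_mul_P x (n.top x)
  have h2 : 2 * n.e * n.top x - 1 - n.μ * x = Real.sqrt (n.disc x) := by
    rw [top]; field_simp; ring
  rw [h2, Real.sq_sqrt h, sub_self] at h1
  exact (mul_eq_zero.1 h1).resolve_left (by positivity)

theorem P_bot {x : ℝ} (h : 0 ≤ n.disc x) : n.P x (n.bot x) = 0 := by
  have he := n.e_pos
  have h1 := n.two_e_mul_P x (n.bot x)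
  have h2 : 2 * n.e * n.bot x - 1 - n.μ * x = -Real.sqrt (n.disc x) := by
    rw [bot]; field_simp; ring
  rw [h2, neg_sq, Real.sq_sqrt h, sub_self] at h1
  exact (mul_eq_zero.1 h1).resolve_left (by positivity)

theorem continuous_disc : Continuous n.disc := by unfold disc; fun_prop

theorem continuous_top : Continuous n.top := by
  unfold top; exact (by have := n.continuous_disc; fun_prop)

theorem continuous_bot : Continuous n.bot := by
  unfold bot; exact (by have := n.continuous_disc; fun_prop)

theorem continuous_P : Continuous fun u : ℝ × ℝ => n.P u.1 u.2 := by unfold P; fun_prop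

theorem continuous_Q : Continuous fun u : ℝ × ℝ => n.Q u.1 u.2 := by
  have := n.continuous_P
  unfold Q; fun_prop

theorem μ_lt_sqrt : n.μ < Real.sqrt (2 * n.e * n.a) :=
  Real.lt_sqrt_of_sq_lt n.disc_lt

theorem disc_eq (x : ℝ) : n.disc x =
    (1 + n.μ * x - Real.sqrt (2 * n.e * n.a) * x)
      * (1 + n.μ * x + Real.sqrt (2 * n.e * n.a) * x) := by
  have h : Real.sqrt (2 * n.e * n.a) ^ 2 = 2 * n.e * n.a :=
    Real.sq_sqrt (by nlinarith [n.disc_lt, sq_nonneg n.μ])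
  rw [disc]; linear_combination x ^ 2 * h

theorem xE_pos : 0 < n.xE := by
  have := n.μ_lt_sqrt
  rw [xE]; exact div_pos one_pos (by linarith)

theorem disc_nonneg_iff {x : ℝ} (hx : 0 < x) : 0 ≤ n.disc x ↔ x ≤ n.xE := by
  have h := n.μ_lt_sqrt
  have hμ := n.μ_pos
  have h2 : 0 < 1 + n.μ * x + Real.sqrt (2 * n.e * n.a) * x := by positivity
  rw [disc_eq, mul_nonneg_iff_of_pos_right h2, xE, le_div_iff₀ (by linarith)]
  constructor <;> intro h3 <;> linarith

theorem disc_pos_iff {x : ℝ} (hx : 0 < x) : 0 < n.disc x ↔ x < n.xE := by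
  have h := n.μ_lt_sqrt
  have hμ := n.μ_pos
  have h2 : 0 < 1 + n.μ * x + Real.sqrt (2 * n.e * n.a) * x := by positivity
  rw [disc_eq, mul_pos_iff_of_pos_right h2, xE, lt_div_iff₀ (by linarith)]
  constructor <;> intro h3 <;> linarith

theorem le_xE {x w : ℝ} (hx : 0 < x) (h : 0 ≤ n.P x w) : x ≤ n.xE :=
  (disc_nonneg_iff hx).1 (disc_nonneg_of_P_nonneg h)

theorem xP_pos : 0 < n.xP := by
  have := n.two_mul_μ_lt
  rw [xP]; exact div_pos two_pos (by linarith)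

theorem xP_mul : n.xP * (2 * n.e + n.a - 2 * n.μ) = 2 := by
  have := n.two_mul_μ_lt
  rw [xP]; exact div_mul_cancel₀ _ (by linarith)

theorem P_xP : n.P n.xP n.xP = 0 := by
  have := n.xP_mul
  rw [P]; linear_combination (-n.xP) * this

theorem Q_xP : n.Q n.xP n.xP = 0 := by
  have := n.xP_mul
  rw [Q, P_xP]; linear_combination (-n.xP) * this

/-- The sign of the root, fixed by `a < 2e`, is what places the singular point on the upper branch
and not on the lower one. -/
theorem sqrt_disc_xP : Real.sqrt (n.disc n.xP) = n.xP * (2 * n.e - n.a) / 2 := by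
  have h := n.xP_mul
  have h1 := n.xP_pos
  have h2 := n.a_lt
  have h3 := n.two_e_mul_P n.xP n.xP
  rw [P_xP] at h3
  have h4 : 2 * n.e * n.xP - 1 - n.μ * n.xP = n.xP * (2 * n.e - n.a) / 2 := by
    linear_combination (1 / 2) * h
  rw [h4] at h3
  have h5 : n.disc n.xP = (n.xP * (2 * n.e - n.a) / 2) ^ 2 := by linarith
  rw [h5, Real.sqrt_sq]
  have : 0 < 2 * n.e - n.a := by linarith
  positivity

theorem top_xP : n.top n.xP = n.xP := by
  have h := n.xP_mul
  have he := n.e_pos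
  rw [top, sqrt_disc_xP, div_eq_iff (by positivity)]
  linear_combination (-1 / 2) * h

theorem xP_lt_xE : n.xP < n.xE := by
  rw [← disc_pos_iff n.xP_pos]
  have h1 := n.sqrt_disc_xP
  have h2 := n.a_lt
  have h3 := n.xP_pos
  by_contra hn
  push Not at hn
  rw [Real.sqrt_eq_zero_of_nonpos hn] at h1
  have : 0 < n.xP * (2 * n.e - n.a) := mul_pos h3 (by linarith)
  linarith

theorem xN_pos : 0 < n.xN := by
  have := n.gap_pos
  have := n.μ_pos
  rw [xN]; positivity

theorem xN_mul : n.xN * (2 * n.e * n.a - n.μ ^ 2) = 2 * n.μ := by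
  rw [xN]; exact div_mul_cancel₀ _ n.gap_pos.ne'

theorem wN_mul : n.wN * (2 * n.e * n.a - n.μ ^ 2) = 2 * n.a := by
  rw [wN]; exact div_mul_cancel₀ _ n.gap_pos.ne'

theorem wN_pos : 0 < n.wN := by
  have := n.gap_pos
  have := n.a_pos
  rw [wN]; positivity

theorem μ_mul_wN : n.μ * n.wN = n.a * n.xN := by
  have := n.gap_pos
  rw [wN, xN]; field_simp

theorem P_N : n.P n.xN n.wN = 0 := by
  have h := n.a_mul_P n.xN n.wN
  have h1 := n.wN_mul
  have h2 := n.μ_mul_wN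
  have h3 : n.a * n.P n.xN n.wN = 0 := by
    rw [h]; linear_combination (-n.wN) * h1 - (n.μ * n.wN - n.a * n.xN) * h2
  exact (mul_eq_zero.1 h3).resolve_left n.a_pos.ne'

theorem le_wN {x w : ℝ} (hx : 0 < x) (h : 0 ≤ n.P x w) : w ≤ n.wN := by
  have h1 := n.a_mul_P x w
  have hw := pos_of_P_nonneg hx h
  have h2 : 0 ≤ n.a * n.P x w := mul_nonneg n.a_pos.le h
  have h3 : 0 ≤ w * (2 * n.a - (2 * n.e * n.a - n.μ ^ 2) * w) := by
    nlinarith [sq_nonneg (n.a * x - n.μ * w)]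
  have h4 := nonneg_of_mul_nonneg_right h3 hw
  rw [wN, le_div_iff₀ n.gap_pos]; linarith

/-- At height `wN` only the negative square in `a_mul_P` remains. This will stop solutions at the
singular point when `a = μ`. -/
theorem eq_xN {x : ℝ} (h : 0 ≤ n.P x n.wN) : x = n.xN := by
  have h1 := n.a_mul_P x n.wN
  have h2 : 0 ≤ n.a * n.P x n.wN := mul_nonneg n.a_pos.le h
  have h3 := n.wN_mul
  have h4 : (n.a * x - n.μ * n.wN) ^ 2 = 0 := by
    have e : n.wN * (2 * n.a - (2 * n.e * n.a - n.μ ^ 2) * n.wN) = 0 := by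
      linear_combination (-n.wN) * h3
    nlinarith [sq_nonneg (n.a * x - n.μ * n.wN)]
  have h5 : n.a * x - n.μ * n.wN = 0 := by simpa using h4
  have := n.μ_mul_wN
  exact mul_left_cancel₀ n.a_pos.ne' (by linarith)

theorem disc_xN : n.disc n.xN = 1 := by
  have h := n.two_e_mul_P n.xN n.wN
  have h1 := n.wN_mul
  have h2 := n.xN_mul
  rw [P_N] at h
  have h3 : 2 * n.e * n.wN - 1 - n.μ * n.xN = 1 := by
    have : (2 * n.e * n.wN - 1 - n.μ * n.xN) * (2 * n.e * n.a - n.μ ^ 2)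
        = 1 * (2 * n.e * n.a - n.μ ^ 2) := by
      linear_combination 2 * n.e * h1 - n.μ * h2
    exact mul_right_cancel₀ n.gap_pos.ne' this
  rw [h3] at h
  linarith

theorem top_xN : n.top n.xN = n.wN := by
  have he := n.e_pos
  have h1 := n.wN_mul
  have h2 := n.xN_mul
  have h3 : (2 * n.e * n.wN - 1 - n.μ * n.xN) * (2 * n.e * n.a - n.μ ^ 2)
      = 1 * (2 * n.e * n.a - n.μ ^ 2) := by
    linear_combination 2 * n.e * h1 - n.μ * h2
  have h4 := mul_right_cancel₀ n.gap_pos.ne' h3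
  rw [top, disc_xN, Real.sqrt_one, div_eq_iff (by positivity)]
  linarith

theorem xN_lt_xE : n.xN < n.xE := by
  rw [← disc_pos_iff n.xN_pos, disc_xN]
  exact one_pos

/-- The order of the singular and the highest point is decided by the sign of `μ - a`, since `μ <
2e`: this separates the two cases of the theorem. -/
theorem xN_sub_xP : (n.xN - n.xP) * ((2 * n.e * n.a - n.μ ^ 2) * (2 * n.e + n.a - 2 * n.μ))
    = 2 * (n.μ - n.a) * (2 * n.e - n.μ) := by
  linear_combination (2 * n.e + n.a - 2 * n.μ) * n.xN_mul
    - (2 * n.e * n.a - n.μ ^ 2) * n.xP_mul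

theorem xP_lt_xN (h : n.a < n.μ) : n.xP < n.xN := by
  have h1 := n.xN_sub_xP
  have h2 := n.gap_pos
  have h3 := n.two_mul_μ_lt
  have h4 := n.μ_lt
  have h5 : 0 < (n.xN - n.xP) * ((2 * n.e * n.a - n.μ ^ 2) * (2 * n.e + n.a - 2 * n.μ)) := by
    rw [h1]; exact mul_pos (by linarith) (by linarith)
  have := pos_of_mul_pos_left h5 (mul_pos h2 (by linarith)).le
  linarith

theorem xN_eq_xP (h : n.a = n.μ) : n.xN = n.xP := by
  have h1 := n.xN_sub_xP
  have h2 := n.gap_pos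
  have h3 := n.two_mul_μ_lt
  rw [h, sub_self, mul_zero, zero_mul] at h1
  rw [← h] at h1 h3 h2
  have := (mul_eq_zero.1 h1).resolve_right (mul_pos h2 (by linarith)).ne'
  linarith

theorem xP_le_xN : n.xP ≤ n.xN := by
  rcases n.a_le.eq_or_lt with h | h
  · exact (xN_eq_xP h).ge
  · exact (xP_lt_xN h).le

/-- Left of the highest point, the upper branch is increasing. -/
theorem top_gt {x : ℝ} (hx : x < n.xN) : n.a * x < n.μ * n.top x := by
  have he := n.e_pos
  have hμ := n.μ_pos
  have h1 := n.xN_mul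
  have h2 := n.gap_pos
  have h3 : 2 * n.e * n.top x = 1 + n.μ * x + Real.sqrt (n.disc x) := by
    rw [top]; field_simp
  have h4 := Real.sqrt_nonneg (n.disc x)
  by_contra hn
  push Not at hn
  have h5 : x * (2 * n.e * n.a - n.μ ^ 2) < 2 * n.μ := by
    rw [← h1]; exact mul_lt_mul_of_pos_right hx h2
  have h6 : 2 * n.e * (n.μ * n.top x) ≤ 2 * n.e * (n.a * x) := by gcongr
  have h7 : n.μ * (2 * n.e * n.top x) = n.μ * (1 + n.μ * x) + n.μ * Real.sqrt (n.disc x) := by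
    rw [h3]; ring
  -- `μ √disc ≤ (2ea - μ²) x - μ`
  have h8 : n.μ * Real.sqrt (n.disc x) ≤ (2 * n.e * n.a - n.μ ^ 2) * x - n.μ := by linarith
  rcases le_or_gt 0 (n.disc x) with hd | hd
  · have h9 : (n.μ * Real.sqrt (n.disc x)) ^ 2 ≤ ((2 * n.e * n.a - n.μ ^ 2) * x - n.μ) ^ 2 := by
      have : 0 ≤ n.μ * Real.sqrt (n.disc x) := by positivity
      gcongr
    rw [mul_pow, Real.sq_sqrt hd, disc] at h9
    have h10 : 0 ≤ n.μ * Real.sqrt (n.disc x) := by positivity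
    have hxp : 0 < x := by
      by_contra hx0
      push Not at hx0
      nlinarith
    have h11 : 0 < (2 * n.e * n.a) * x * (2 * n.μ - x * (2 * n.e * n.a - n.μ ^ 2)) := by
      have : 0 < 2 * n.e * n.a := by linarith [sq_nonneg n.μ]
      have : 0 < 2 * n.μ - x * (2 * n.e * n.a - n.μ ^ 2) := by linarith
      positivity
    nlinarith
  · have h10 : 0 ≤ n.μ * Real.sqrt (n.disc x) := by positivity
    have hxp : 0 < x := by
      by_contra hx0
      push Not at hx0
      nlinarith
    have := (disc_pos_iff hxp).2 (hx.trans n.xN_lt_xE)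
    linarith

theorem hasDerivAt_top {x : ℝ} (hx : 0 < n.disc x) :
    HasDerivAt n.top ((n.μ * n.top x - n.a * x) / Real.sqrt (n.disc x)) x := by
  have he := n.e_pos
  have hs : 0 < Real.sqrt (n.disc x) := Real.sqrt_pos.2 hx
  have h0 : HasDerivAt (fun t => 1 + n.μ * t) n.μ x := by
    simpa using ((hasDerivAt_id x).const_mul n.μ).const_add 1
  have h1 : HasDerivAt n.disc (2 * n.μ * (1 + n.μ * x) - 4 * n.e * n.a * x) x := by
    have h := (h0.fun_pow 2).fun_sub ((hasDerivAt_pow 2 x).const_mul (2 * n.e * n.a))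
    refine h.congr_deriv ?_
    simp; ring
  have h2 : HasDerivAt n.top _ x := (h0.fun_add (h1.sqrt hx.ne')).div_const (2 * n.e)
  refine h2.congr_deriv ?_
  rw [top]; field_simp; ring

theorem strictMonoOn_top : StrictMonoOn n.top (Icc 0 n.xN) := by
  refine strictMonoOn_of_deriv_pos (convex_Icc _ _) n.continuous_top.continuousOn ?_
  intro x hx
  rw [interior_Icc] at hx
  have hd : 0 < n.disc x := (disc_pos_iff hx.1).2 (hx.2.trans n.xN_lt_xE)
  rw [(hasDerivAt_top hd).deriv]
  exact div_pos (by linarith [top_gt hx.2]) (Real.sqrt_pos.2 hd)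

theorem m_lt_one : n.m < 1 := by
  have := n.a_lt
  have := n.two_mul_μ_lt
  rw [m, div_lt_one (by linarith)]; linarith

theorem m_nonneg : 0 ≤ n.m := by
  have := n.a_lt
  have := n.a_le
  rw [m]; exact div_nonneg (by linarith) (by linarith)

theorem m_pos (h : n.a < n.μ) : 0 < n.m := by
  have := n.a_lt
  rw [m]; exact div_pos (by linarith) (by linarith)

theorem m_mul : n.m * (2 * n.e - n.a) = 2 * (n.μ - n.a) := by
  have := n.a_lt
  rw [m]; exact div_mul_cancel₀ _ (by linarith)

theorem hasDerivAt_top_xP : HasDerivAt n.top n.m n.xP := by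
  have h := hasDerivAt_top ((disc_pos_iff n.xP_pos).2 n.xP_lt_xE)
  convert h using 1
  have h1 := n.xP_pos
  have h2 := n.a_lt
  rw [top_xP, sqrt_disc_xP, m]
  have : 2 * n.e - n.a ≠ 0 := by linarith
  field_simp

/-- Right of the singular point the region `0 ≤ P` lies below the ray. -/
theorem lt_of_xP_lt {x w : ℝ} (hx : n.xP < x) (h : 0 ≤ n.P x w) : w < x := by
  have h0 := n.xP_pos
  have h1 := n.xP_mul
  have h2 := n.two_mul_μ_lt
  have h3 := n.a_lt
  have he := n.e_pos
  by_contra hn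
  push Not at hn
  have hx0 : 0 < x := h0.trans hx
  have h4 : 2 < x * (2 * n.e + n.a - 2 * n.μ) := by
    have := mul_lt_mul_of_pos_right hx (show 0 < 2 * n.e + n.a - 2 * n.μ by linarith)
    linarith
  have e : n.P x w = x * (2 - x * (2 * n.e + n.a - 2 * n.μ))
      + (w - x) * (2 + 2 * n.μ * x - 4 * n.e * x) - 2 * n.e * (w - x) ^ 2 := by
    rw [P]; ring
  have h5 : 2 + 2 * n.μ * x - 4 * n.e * x < 0 := by nlinarith
  have h6 : (w - x) * (2 + 2 * n.μ * x - 4 * n.e * x) ≤ 0 :=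
    mul_nonpos_of_nonneg_of_nonpos (by linarith) h5.le
  nlinarith [mul_nonneg he.le (sq_nonneg (w - x)), mul_pos hx0 (sub_pos.2 h4)]

/-- Below the diagonal `x - (1 - p) w` is nonnegative and the square in `key` is positive. -/
theorem Q_pos_of_lt {x w : ℝ} (hx : 0 < x) (h : 0 ≤ n.P x w) (hw : w < x) : 0 < n.Q x w := by
  have hw0 := pos_of_P_nonneg hx h
  have h1 := n.key x w
  have h2 := n.p_pos
  have h3 := n.p_lt
  have h4 : 0 < n.a * x * (w - x) ^ 2 := by
    have := n.a_pos
    have : 0 < (w - x) ^ 2 := by rw [← neg_sq]; exact pow_pos (by linarith) 2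
    positivity
  have h5 : 0 < w * n.Q x w := by
    have : w * n.Q x w = n.a * x * (w - x) ^ 2 + n.P x w * (x - (1 - n.p) * w) := by
      linear_combination h1
    rw [this]
    have : 0 ≤ x - (1 - n.p) * w := by nlinarith
    positivity
  exact pos_of_mul_pos_right h5 hw0.le

theorem Q_pos_of_xP_lt {x w : ℝ} (hx : n.xP < x) (h : 0 ≤ n.P x w) : 0 < n.Q x w :=
  Q_pos_of_lt (n.xP_pos.trans hx) h (lt_of_xP_lt hx h)

theorem P_diag (x : ℝ) : n.P x x = x * (2 - x * (2 * n.e + n.a - 2 * n.μ)) := by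
  rw [P]; ring

theorem P_diag_pos {x : ℝ} (hx : 0 < x) (h : x < n.xP) : 0 < n.P x x := by
  have h1 := n.xP_mul
  have h2 := n.two_mul_μ_lt
  have h4 : x * (2 * n.e + n.a - 2 * n.μ) < 2 := by
    have := mul_lt_mul_of_pos_right h (show 0 < 2 * n.e + n.a - 2 * n.μ by linarith)
    linarith
  rw [P_diag]; exact mul_pos hx (by linarith)

/-- `0 ≤ J` gives `a x (w - x) ≥ (1 - p) P ≥ 0`, and equality is excluded because `P` is positive on
the diagonal left of `xP`. -/
theorem lt_of_lt_xP {x w : ℝ} (hx : 0 < x) (h : x < n.xP) (hP : 0 ≤ n.P x w)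
    (hJ : 0 ≤ n.J x w) : x < w := by
  have h1 := n.p_lt
  have h2 := n.a_pos
  have h3 : 0 ≤ n.a * x * (w - x) := by
    rw [J] at hJ; nlinarith
  have h4 : 0 ≤ w - x := nonneg_of_mul_nonneg_right h3 (by positivity)
  rcases h4.eq_or_lt with h5 | h5
  · have : w = x := by linarith
    subst this
    have := P_diag_pos hx h
    rw [J] at hJ
    nlinarith
  · linarith

/-- The only dangerous term in `key` is `P (x - (1 - p) w)` when its second factor is negative. Then
`0 ≤ J` bounds `(1 - p) P` by `a x (w - x)`, and the terms combine to `p a x² (w - x) > 0`. -/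
theorem Q_pos_of_lt_xP {x w : ℝ} (hx : 0 < x) (h : x < n.xP) (hP : 0 ≤ n.P x w)
    (hJ : 0 ≤ n.J x w) : 0 < n.Q x w := by
  have hV := lt_of_lt_xP hx h hP hJ
  have hw0 := pos_of_P_nonneg hx hP
  have h1 := n.key x w
  have hp := n.p_pos
  have hp1 := n.p_lt
  have ha := n.a_pos
  have h4 : 0 < w - x := by linarith
  have e : w * n.Q x w = n.a * x * (w - x) ^ 2 + n.P x w * (x - (1 - n.p) * w) := by
    linear_combination h1
  refine pos_of_mul_pos_right ?_ hw0.le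
  rw [e]
  rcases le_or_gt 0 (x - (1 - n.p) * w) with h5 | h5
  · positivity
  · have h6 : (1 - n.p) * n.P x w ≤ n.a * x * (w - x) := by rw [J] at hJ; linarith
    have h7 : (1 - n.p) * (n.a * x * (w - x) ^ 2 + n.P x w * (x - (1 - n.p) * w))
        ≥ n.p * n.a * x ^ 2 * (w - x) := by
      have : (1 - n.p) * n.P x w * (x - (1 - n.p) * w)
        ≥ n.a * x * (w - x) * (x - (1 - n.p) * w) :=
        mul_le_mul_of_nonpos_right h6 h5.le
      nlinarith
    have h8 : 0 < n.p * n.a * x ^ 2 * (w - x) := by positivity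
    exact pos_of_mul_pos_right (h8.trans_le h7) (by linarith)

theorem lt_top_of_lt_xP {x : ℝ} (hx : 0 < x) (h : x < n.xP) : x < n.top x :=
  (P_pos_iff.1 (P_diag_pos hx h)).2

/-- On the upper branch left of the singular point, `0 < J`. -/
theorem J_top_pos {x : ℝ} (hx : 0 < x) (h : x < n.xP) : 0 < n.J x (n.top x) := by
  have h1 := lt_top_of_lt_xP hx h
  have h2 := P_top ((disc_nonneg_iff hx).2 (h.trans n.xP_lt_xE).le)
  have := n.a_pos
  rw [J, h2, mul_zero, sub_zero]
  have : 0 < n.top x - x := by linarith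
  positivity

end Reduced
end
end ShadowODE

/-! ### Calculus: linear differential equations, crossing arguments, singular linear equations. -/

namespace ShadowODE

section Calculus

theorem exists_integrating_factor {c : ℝ → ℝ} {a b : ℝ} (hab : a ≤ b)
    (hc : ContinuousOn c (Icc a b)) :
    ∃ E : ℝ → ℝ, Continuous E ∧ (∀ x, 0 < E x) ∧
      ∀ x ∈ Ioo a b, HasDerivAt E (-(c x * E x)) x := by
  -- The coefficient is extended constantly beyond the interval, so that its primitive is
  -- differentiable everywhere and `E` is continuous up to the end points.
  set c' : ℝ → ℝ := IccExtend hab ((Icc a b).domRestrict c) with hc'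
  have hcc : Continuous c' := (continuousOn_iff_continuous_domRestrict.1 hc).Icc_extend'
  have hd : ∀ x, HasDerivAt (fun x => Real.exp (-∫ t in a..x, c' t))
      (-(c' x * Real.exp (-∫ t in a..x, c' t))) x := by
    intro x
    have h := ((hcc.integral_hasStrictDerivAt a x).hasDerivAt.neg).exp
    refine h.congr_deriv ?_
    simp only [Pi.neg_apply]
    ring
  refine ⟨_, continuous_iff_continuousAt.2 fun x => (hd x).continuousAt,
    fun x => Real.exp_pos _, fun x hx => ?_⟩
  have := hd x
  rwa [show c' x = c x from by
    rw [hc', IccExtend_of_mem hab _ (Ioo_subset_Icc_self hx)]; rfl] at this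

variable {f f' c r : ℝ → ℝ} {a b : ℝ}

/-- Positivity for a linear differential inequality. -/
theorem pos_of_linear_ode (hab : a < b) (hf : ContinuousOn f (Icc a b))
    (hc : ContinuousOn c (Icc a b))
    (hd : ∀ x ∈ Ioo a b, HasDerivAt f (c x * f x + r x) x) (hr : ∀ x ∈ Ioo a b, 0 < r x)
    (ha : 0 ≤ f a) : 0 < f b := by
  obtain ⟨E, hE, hE0, hEd⟩ := exists_integrating_factor hab.le hc
  have hm : StrictMonoOn (fun x => f x * E x) (Icc a b) := by
    refine strictMonoOn_of_deriv_pos (convex_Icc _ _) (hf.mul hE.continuousOn) fun x hx => ?_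
    rw [interior_Icc] at hx
    rw [((hd x hx).fun_mul (hEd x hx)).deriv]
    have := mul_pos (hr x hx) (hE0 x)
    nlinarith
  have h := hm (left_mem_Icc.2 hab.le) (right_mem_Icc.2 hab.le) hab
  exact pos_of_mul_pos_left ((mul_nonneg ha (hE0 a).le).trans_lt h) (hE0 b).le

/-- Used with `c = 0` as a constancy criterion, and with a divided difference for `c` as uniqueness
for the nonlinear equation. -/
theorem eq_zero_of_linear_ode (hab : a ≤ b) (hf : ContinuousOn f (Icc a b))
    (hc : ContinuousOn c (Icc a b))
    (hd : ∀ x ∈ Ioo a b, HasDerivAt f (c x * f x) x) (ha : f a = 0) : f b = 0 := by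
  obtain ⟨E, hE, hE0, hEd⟩ := exists_integrating_factor hab hc
  have hde : ∀ x ∈ Ioo a b, HasDerivAt (fun x => f x * E x) 0 x := fun x hx =>
    ((hd x hx).fun_mul (hEd x hx)).congr_deriv (by ring)
  have h1 : MonotoneOn (fun x => f x * E x) (Icc a b) :=
    monotoneOn_of_deriv_nonneg (convex_Icc _ _) (hf.mul hE.continuousOn)
      (fun x hx => (hde x (by rwa [interior_Icc] at hx)).differentiableAt.differentiableWithinAt)
      fun x hx => (hde x (by rwa [interior_Icc] at hx)).deriv.ge
  have h2 : AntitoneOn (fun x => f x * E x) (Icc a b) :=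
    antitoneOn_of_deriv_nonpos (convex_Icc _ _) (hf.mul hE.continuousOn)
      (fun x hx => (hde x (by rwa [interior_Icc] at hx)).differentiableAt.differentiableWithinAt)
      fun x hx => (hde x (by rwa [interior_Icc] at hx)).deriv.le
  have h3 := h1 (left_mem_Icc.2 hab) (right_mem_Icc.2 hab) hab
  have h4 := h2 (left_mem_Icc.2 hab) (right_mem_Icc.2 hab) hab
  simp only [ha, zero_mul] at h3 h4
  exact (mul_eq_zero.1 (le_antisymm h4 h3)).resolve_right (hE0 b).ne'

/-- The last zero before a negative value. -/
theorem exists_last_zero (hab : a ≤ b) (hf : ContinuousOn f (Icc a b)) (ha : 0 ≤ f a)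
    (hb : f b < 0) : ∃ s ∈ Ico a b, f s = 0 ∧ ∀ x ∈ Ioc s b, f x < 0 := by
  set S := Icc a b ∩ f ⁻¹' (Ici 0) with hS
  have hcl : IsClosed S := hf.preimage_isClosed_of_isClosed isClosed_Icc isClosed_Ici
  have hcomp : IsCompact S := isCompact_Icc.of_isClosed_subset hcl inter_subset_left
  obtain ⟨s, hs, hmax⟩ := hcomp.exists_isGreatest ⟨a, ⟨left_mem_Icc.2 hab, ha⟩⟩
  have hneg : ∀ x ∈ Ioc s b, f x < 0 := by
    intro x hx
    by_contra hn
    push Not at hn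
    exact absurd (hmax ⟨⟨hs.1.1.trans hx.1.le, hx.2⟩, hn⟩) (not_le.2 hx.1)
  have hsb : s < b := by
    refine lt_of_le_of_ne hs.1.2 ?_
    rintro rfl
    exact absurd hs.2 (not_le.2 hb)
  refine ⟨s, ⟨hs.1.1, hsb⟩, ?_, hneg⟩
  have h0 : 0 ∈ f '' Icc s b :=
    intermediate_value_Icc' hsb.le (hf.mono (Icc_subset_Icc_left hs.1.1)) ⟨hb.le, hs.2⟩
  obtain ⟨y, hy, hy0⟩ := h0
  rcases hy.1.eq_or_lt with h | h
  · rw [h, hy0]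
  · have := hneg y ⟨h, hy.2⟩
    linarith

/-- The first zero after a negative value. -/
theorem exists_first_zero (hab : a ≤ b) (hf : ContinuousOn f (Icc a b)) (ha : f a < 0)
    (hb : 0 ≤ f b) : ∃ s ∈ Ioc a b, f s = 0 ∧ ∀ x ∈ Ico a s, f x < 0 := by
  have h := exists_last_zero (f := fun x => f (-x)) (a := -b) (b := -a) (by linarith)
    (hf.comp continuous_neg.continuousOn fun x hx => ⟨by linarith [hx.2], by linarith [hx.1]⟩)
    (by simpa using hb) (by simpa using ha)
  obtain ⟨s, hs, h0, hneg⟩ := h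
  refine ⟨-s, ⟨by linarith [hs.2], by linarith [hs.1]⟩, h0, fun x hx => ?_⟩
  have := hneg (-x) ⟨by linarith [hx.2], by linarith [hx.1]⟩
  simpa using this

theorem neg_right_of_hasDerivAt {d x : ℝ} (h : HasDerivAt f d x) (hd : d < 0) (h0 : f x = 0) :
    ∀ᶠ y in 𝓝[>] x, f y < 0 := by
  have h1 := (hasDerivAt_iff_tendsto_slope.1 h).eventually (gt_mem_nhds hd)
  have h2 : ∀ᶠ y in 𝓝[>] x, slope f x y < 0 :=
    h1.filter_mono (nhdsWithin_mono _ fun y hy => (ne_of_gt hy : y ≠ x))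
  filter_upwards [h2, self_mem_nhdsWithin] with y hy hxy
  rw [slope_def_field, h0, sub_zero, div_lt_iff₀ (sub_pos.2 hxy), zero_mul] at hy
  exact hy

theorem pos_left_of_hasDerivAt {d x : ℝ} (h : HasDerivAt f d x) (hd : d < 0) (h0 : f x = 0) :
    ∀ᶠ y in 𝓝[<] x, 0 < f y := by
  have h1 := (hasDerivAt_iff_tendsto_slope.1 h).eventually (gt_mem_nhds hd)
  have h2 : ∀ᶠ y in 𝓝[<] x, slope f x y < 0 :=
    h1.filter_mono (nhdsWithin_mono _ fun y hy => (ne_of_lt hy : y ≠ x))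
  filter_upwards [h2, self_mem_nhdsWithin] with y hy hxy
  rw [slope_def_field, h0, sub_zero, div_lt_iff_of_neg (sub_neg.2 hxy), zero_mul] at hy
  exact hy

/-- A function that can cross zero only downwards stays negative once it is nonpositive. -/
theorem neg_of_crossing (hd : ∀ x ∈ Ioo a b, HasDerivAt f (f' x) x)
    (hc : ∀ x ∈ Ioo a b, f x = 0 → f' x < 0) {x y : ℝ} (hx : x ∈ Ioo a b) (hy : y ∈ Ioo a b)
    (hxy : x < y) (h : f x ≤ 0) : f y < 0 := by
  by_contra hn
  push Not at hn
  have hcont : ContinuousOn f (Icc x y) := fun t ht =>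
    (hd t ⟨hx.1.trans_le ht.1, ht.2.trans_lt hy.2⟩).continuousAt.continuousWithinAt
  obtain ⟨z, hz, hzn⟩ : ∃ z ∈ Ico x y, f z < 0 := by
    rcases h.lt_or_eq with h | h
    · exact ⟨x, ⟨le_rfl, hxy⟩, h⟩
    · have h1 := neg_right_of_hasDerivAt (hd x hx) (hc x hx h) h
      obtain ⟨z, hz1, hz2⟩ := (h1.and (Ioo_mem_nhdsGT hxy)).exists
      exact ⟨z, ⟨hz2.1.le, hz2.2⟩, hz1⟩
  obtain ⟨s, hs, hs0, hsn⟩ := exists_first_zero hz.2.le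
    (hcont.mono (Icc_subset_Icc_left hz.1)) hzn hn
  have hs' : s ∈ Ioo a b := ⟨hx.1.trans_le (hz.1.trans hs.1.le), hs.2.trans_lt hy.2⟩
  have h1 := pos_left_of_hasDerivAt (hd s hs') (hc s hs' hs0) hs0
  obtain ⟨t, ht1, ht2⟩ := (h1.and (Ioo_mem_nhdsLT hs.1)).exists
  exact lt_asymm ht1 (hsn t ⟨ht2.1.le, ht2.2⟩)

/-- If the derivative off a point extends continuously to the point, the extension is the
derivative there. -/
theorem hasDerivWithinAt_Icc_of_continuous {x : ℝ} (hx : x ∈ Icc a b)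
    (hf : ContinuousOn f (Icc a b)) (hd : ∀ y ∈ Ioo a b, y ≠ x → HasDerivAt f (f' y) y)
    (hf' : ContinuousWithinAt f' (Icc a b) x) : HasDerivWithinAt f (f' x) (Icc a b) x := by
  have hl : HasDerivWithinAt f (f' x) (Icc a x) x := by
    rcases hx.1.eq_or_lt with h | h
    · rw [← h, Icc_self]; exact HasFDerivWithinAt.of_subsingleton subsingleton_singleton
    · have hder : ∀ y ∈ Ioo a x, HasDerivAt f (f' y) y := fun y hy =>
        hd y ⟨hy.1, hy.2.trans_le hx.2⟩ hy.2.ne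
      refine (hasDerivWithinAt_Iic_of_tendsto_deriv (s := Ioo a x)
        (fun y hy => (hder y hy).differentiableAt.differentiableWithinAt)
        ((hf x hx).mono fun y hy => ⟨hy.1.le, hy.2.le.trans hx.2⟩) (Ioo_mem_nhdsLT h) ?_).mono
        fun y hy => hy.2
      have h1 : Tendsto f' (𝓝[<] x) (𝓝 (f' x)) := by
        refine hf'.mono_left ?_
        rw [← nhdsWithin_Ioo_eq_nhdsLT h]
        exact nhdsWithin_mono _ fun y hy => ⟨hy.1.le, hy.2.le.trans hx.2⟩
      refine h1.congr' ?_
      filter_upwards [Ioo_mem_nhdsLT h] with y hy using (hder y hy).deriv.symm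
  have hr : HasDerivWithinAt f (f' x) (Icc x b) x := by
    rcases hx.2.eq_or_lt with h | h
    · rw [h, Icc_self]; exact HasFDerivWithinAt.of_subsingleton subsingleton_singleton
    · have hder : ∀ y ∈ Ioo x b, HasDerivAt f (f' y) y := fun y hy =>
        hd y ⟨hx.1.trans_lt hy.1, hy.2⟩ hy.1.ne'
      refine (hasDerivWithinAt_Ici_of_tendsto_deriv (s := Ioo x b)
        (fun y hy => (hder y hy).differentiableAt.differentiableWithinAt)
        ((hf x hx).mono fun y hy => ⟨hx.1.trans hy.1.le, hy.2.le⟩) (Ioo_mem_nhdsGT h) ?_).mono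
        fun y hy => hy.1
      have h1 : Tendsto f' (𝓝[>] x) (𝓝 (f' x)) := by
        refine hf'.mono_left ?_
        rw [← nhdsWithin_Ioo_eq_nhdsGT h]
        exact nhdsWithin_mono _ fun y hy => ⟨hx.1.trans hy.1.le, hy.2.le⟩
      refine h1.congr' ?_
      filter_upwards [Ioo_mem_nhdsGT h] with y hy using (hder y hy).deriv.symm
  have := hl.union hr
  rwa [Icc_union_Icc_eq_Icc hx.1 hx.2] at this

theorem contDiffOn_two_of_hasDerivWithinAt {g k j : ℝ → ℝ} (hab : a < b)
    (hg : ∀ x ∈ Icc a b, HasDerivWithinAt g (k x) (Icc a b) x)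
    (hk : ∀ x ∈ Icc a b, HasDerivWithinAt k (j x) (Icc a b) x)
    (hj : ContinuousOn j (Icc a b)) : ContDiffOn ℝ 2 g (Icc a b) := by
  have hu := uniqueDiffOn_Icc hab
  have h1 : ContDiffOn ℝ 1 k (Icc a b) := by
    rw [show (1 : WithTop ℕ∞) = 0 + 1 by norm_num, contDiffOn_succ_iff_derivWithin hu]
    refine ⟨fun x hx => (hk x hx).differentiableWithinAt, by simp, ?_⟩
    rw [contDiffOn_zero]
    exact hj.congr fun x hx => (hk x hx).derivWithin (hu x hx)
  rw [show (2 : WithTop ℕ∞) = 1 + 1 by norm_num, contDiffOn_succ_iff_derivWithin hu]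
  refine ⟨fun x hx => (hg x hx).differentiableWithinAt, by simp, ?_⟩
  exact h1.congr fun x hx => (hg x hx).derivWithin (hu x hx)

/-- A singular linear equation `ρ j' = -A j + B` with `ρ → 0`, approached against the flow:
the only solution with `ρ j → 0` has the formal limit. -/
theorem tendsto_of_singular_linear_right {ρ ρ' j j' A B : ℝ → ℝ} {A₀ B₀ : ℝ} (hab : a < b)
    (hρ : ∀ x ∈ Ioo a b, 0 < ρ x) (hρd : ∀ x ∈ Ioo a b, HasDerivAt ρ (ρ' x) x)
    (hj : ∀ x ∈ Ioo a b, HasDerivAt j (j' x) x)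
    (heq : ∀ x ∈ Ioo a b, ρ x * j' x = -A x * j x + B x)
    (hA₀ : 0 < A₀) (hA : Tendsto A (𝓝[>] a) (𝓝 A₀)) (hB : Tendsto B (𝓝[>] a) (𝓝 B₀))
    (hρ0 : Tendsto ρ (𝓝[>] a) (𝓝 0)) (hρ'0 : Tendsto ρ' (𝓝[>] a) (𝓝 0))
    (hj0 : Tendsto (fun x => ρ x * j x) (𝓝[>] a) (𝓝 0)) :
    Tendsto j (𝓝[>] a) (𝓝 (B₀ / A₀)) := by
  -- the upper bound, for `j` or `-j`
  have main : ∀ (j j' B : ℝ → ℝ) (B₀ : ℝ), (∀ x ∈ Ioo a b, HasDerivAt j (j' x) x) →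
      (∀ x ∈ Ioo a b, ρ x * j' x = -A x * j x + B x) → Tendsto B (𝓝[>] a) (𝓝 B₀) →
      Tendsto (fun x => ρ x * j x) (𝓝[>] a) (𝓝 0) → ∀ ε > 0,
      ∀ᶠ x in 𝓝[>] a, j x < B₀ / A₀ + ε := by
    intro j j' B B₀ hj heq hB hj0 ε hε
    set h := B₀ / A₀ with hh
    have hAh : Tendsto (fun x => (ρ' x - A x) * ε + (B x - A x * h)) (𝓝[>] a)
        (𝓝 ((0 - A₀) * ε + (B₀ - A₀ * h))) :=
      ((hρ'0.sub hA).mul_const ε).add (hB.sub (hA.mul_const h))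
    have hneg : (0 - A₀) * ε + (B₀ - A₀ * h) < 0 := by
      rw [hh, mul_div_cancel₀ _ hA₀.ne']
      nlinarith [mul_pos hA₀ hε]
    have hBh : Tendsto (fun x => -A x * (h + ε) + B x) (𝓝[>] a)
        (𝓝 (-A₀ * (h + ε) + B₀)) := (hA.neg.mul_const _).add hB
    have hneg2 : -A₀ * (h + ε) + B₀ < 0 := by
      have : A₀ * h = B₀ := by rw [hh, mul_div_cancel₀ _ hA₀.ne']
      nlinarith [mul_pos hA₀ hε]
    have hAρ : Tendsto (fun x => ρ' x - A x) (𝓝[>] a) (𝓝 (0 - A₀)) := hρ'0.sub hA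
    have ev : ∀ᶠ x in 𝓝[>] a, (ρ' x - A x) * ε + (B x - A x * h) < 0 ∧
        -A x * (h + ε) + B x < 0 ∧ ρ' x - A x < 0 :=
      (hAh.eventually (gt_mem_nhds hneg)).and ((hBh.eventually (gt_mem_nhds hneg2)).and
        (hAρ.eventually (gt_mem_nhds (by linarith))))
    obtain ⟨b', hb', hsub⟩ := (mem_nhdsGT_iff_exists_Ioo_subset' hab).1
      (inter_mem ev (Ioo_mem_nhdsGT hab))
    have hcr : ∀ x ∈ Ioo a b', j x - (h + ε) = 0 → j' x < 0 := by
      intro x hx h0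
      have hx' := hsub hx
      have h1 := heq x hx'.2
      have h2 : j x = h + ε := by linarith
      rw [h2] at h1
      have h3 : ρ x * j' x < 0 := by rw [h1]; exact hx'.1.2.1
      exact neg_of_mul_neg_right h3 (hρ x hx'.2).le
    have hjd : ∀ x ∈ Ioo a b', HasDerivAt (fun x => j x - (h + ε)) (j' x) x := fun x hx =>
      (hj x (hsub hx).2).sub_const _
    by_contra hn
    rw [not_eventually] at hn
    obtain ⟨x₁, hx₁, hx₁b⟩ := (hn.and_eventually (Ioo_mem_nhdsGT hb')).exists
    rw [not_lt] at hx₁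
    -- The level can be crossed only downwards, so a large value at `x₁` forces large values all the
    -- way back to `a`.
    have hbig : ∀ x ∈ Ioo a x₁, h + ε < j x := by
      intro x hx
      by_contra hc
      push Not at hc
      have := neg_of_crossing hjd hcr ⟨hx.1, hx.2.trans hx₁b.2⟩ hx₁b hx.2 (by linarith)
      linarith
    -- Above the level this product decreases, so its value at `x₁` is at most its limit at `a`.
    -- That limit is zero, while the value at `x₁` is positive.
    have hanti : AntitoneOn (fun x => ρ x * (j x - h)) (Ioc a x₁) := by
      have hder : ∀ x ∈ Ioc a x₁, HasDerivAt (fun x => ρ x * (j x - h))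
          (ρ' x * (j x - h) + ρ x * j' x) x := by
        intro x hx
        have hx' := hsub ⟨hx.1, hx.2.trans_lt hx₁b.2⟩
        exact (hρd x hx'.2).fun_mul ((hj x hx'.2).sub_const h)
      refine antitoneOn_of_deriv_nonpos (convex_Ioc _ _)
        (fun x hx => (hder x hx).continuousAt.continuousWithinAt) (fun x hx => ?_) fun x hx => ?_
      · rw [interior_Ioc] at hx
        exact (hder x ⟨hx.1, hx.2.le⟩).differentiableAt.differentiableWithinAt
      · rw [interior_Ioc] at hx
        have hx' := hsub ⟨hx.1, hx.2.trans hx₁b.2⟩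
        rw [(hder x ⟨hx.1, hx.2.le⟩).deriv, heq x hx'.2]
        have h1 := hx'.1.1
        have h2 := hx'.1.2.2
        have h3 := hbig x hx
        nlinarith
    have hu1 : 0 < ρ x₁ * (j x₁ - h) :=
      mul_pos (hρ x₁ (hsub hx₁b).2) (by linarith)
    have hlim : Tendsto (fun x => ρ x * (j x - h)) (𝓝[>] a) (𝓝 0) := by
      have := hj0.sub (hρ0.mul_const h)
      simp only [zero_mul, sub_zero] at this
      exact this.congr fun x => by ring
    have : ρ x₁ * (j x₁ - h) ≤ 0 := by
      refine ge_of_tendsto hlim ?_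
      filter_upwards [Ioo_mem_nhdsGT hx₁b.1] with x hx
      exact hanti ⟨hx.1, hx.2.le⟩ ⟨hx₁b.1, le_rfl⟩ hx.2.le
    linarith
  have h1 := main j j' B B₀ hj heq hB hj0
  have h2 := main (fun x => -j x) (fun x => -j' x) (fun x => -B x) (-B₀)
    (fun x hx => (hj x hx).neg) (fun x hx => by linear_combination -(heq x hx)) hB.neg
    (by simpa using hj0.neg)
  rw [Metric.tendsto_nhds]
  intro ε hε
  filter_upwards [h1 ε hε, h2 ε hε] with x hx1 hx2
  rw [neg_div] at hx2
  rw [Real.dist_eq, abs_lt]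
  constructor <;> linarith

/-- The same equation approached with the flow: every solution has the formal limit. -/
theorem tendsto_of_singular_linear_left {ρ ρ' j j' A B : ℝ → ℝ} {A₀ B₀ : ℝ} (hab : a < b)
    (hρ : ∀ x ∈ Ioo a b, 0 < ρ x) (hρd : ∀ x ∈ Ioo a b, HasDerivAt ρ (ρ' x) x)
    (hj : ∀ x ∈ Ioo a b, HasDerivAt j (j' x) x)
    (heq : ∀ x ∈ Ioo a b, ρ x * j' x = -A x * j x + B x)
    (hA₀ : 0 < A₀) (hA : Tendsto A (𝓝[<] b) (𝓝 A₀)) (hB : Tendsto B (𝓝[<] b) (𝓝 B₀))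
    (hρ0 : Tendsto ρ (𝓝[<] b) (𝓝 0)) (hρ'0 : Tendsto ρ' (𝓝[<] b) (𝓝 0)) :
    Tendsto j (𝓝[<] b) (𝓝 (B₀ / A₀)) := by
  have main : ∀ (j j' B : ℝ → ℝ) (B₀ : ℝ), (∀ x ∈ Ioo a b, HasDerivAt j (j' x) x) →
      (∀ x ∈ Ioo a b, ρ x * j' x = -A x * j x + B x) → Tendsto B (𝓝[<] b) (𝓝 B₀) →
      ∀ ε > 0, ∀ᶠ x in 𝓝[<] b, j x < B₀ / A₀ + ε := by
    intro j j' B B₀ hj heq hB ε hε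
    set h := B₀ / A₀ with hh
    have hAhh : A₀ * h = B₀ := by rw [hh, mul_div_cancel₀ _ hA₀.ne']
    have hBh : Tendsto (fun x => -A x * (h + ε) + B x) (𝓝[<] b)
        (𝓝 (-A₀ * (h + ε) + B₀)) := (hA.neg.mul_const _).add hB
    have hneg2 : -A₀ * (h + ε) + B₀ < -(A₀ * ε) / 2 := by
      nlinarith [mul_pos hA₀ hε]
    have ev : ∀ᶠ x in 𝓝[<] b, -A x * (h + ε) + B x < -(A₀ * ε) / 2 ∧ 0 < A x ∧
        -1 < ρ' x :=
      (hBh.eventually (gt_mem_nhds hneg2)).and ((hA.eventually (lt_mem_nhds hA₀)).and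
        (hρ'0.eventually (lt_mem_nhds (by norm_num))))
    obtain ⟨a', ha', hsub⟩ := (mem_nhdsLT_iff_exists_Ioo_subset' hab).1
      (inter_mem ev (Ioo_mem_nhdsLT hab))
    have hAe : 0 < A₀ * ε := mul_pos hA₀ hε
    have hcr : ∀ x ∈ Ioo a' b, j x - (h + ε) = 0 → j' x < 0 := by
      intro x hx h0
      have hx' := hsub hx
      have h1 := heq x hx'.2
      have h2 : j x = h + ε := by linarith
      rw [h2] at h1
      have h3 : ρ x * j' x < 0 := by rw [h1]; linarith [hx'.1.1]
      exact neg_of_mul_neg_right h3 (hρ x hx'.2).le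
    have hjd : ∀ x ∈ Ioo a' b, HasDerivAt (fun x => j x - (h + ε)) (j' x) x := fun x hx =>
      (hj x (hsub hx).2).sub_const _
    by_cases hex : ∃ x ∈ Ioo a' b, j x ≤ h + ε
    · obtain ⟨x₁, hx₁, hle⟩ := hex
      filter_upwards [Ioo_mem_nhdsLT hx₁.2] with x hx
      have := neg_of_crossing hjd hcr hx₁ ⟨hx₁.1.trans hx.1, hx.2⟩ hx.1 (by linarith)
      linarith
    -- If `j` never came down to the level, then `ρ j' ≤ -κ` for the `κ` below. With `ρ' > -1` this
    -- makes `j - κ log ρ` nonincreasing, and `log ρ → -∞` pulls `j` to `-∞`.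
    · exfalso
      push Not at hex
      set κ := A₀ * ε / 2 with hκ
      have hκ0 : 0 < κ := by positivity
      -- `j - κ log ρ` is nonincreasing
      have hder : ∀ x ∈ Ioo a' b, HasDerivAt (fun x => j x - κ * Real.log (ρ x))
          (j' x - κ * (ρ' x / ρ x)) x := fun x hx =>
        (hj x (hsub hx).2).fun_sub (((hρd x (hsub hx).2).log (hρ x (hsub hx).2).ne').const_mul κ)
      have hanti : AntitoneOn (fun x => j x - κ * Real.log (ρ x)) (Ioo a' b) := by
        refine antitoneOn_of_deriv_nonpos (convex_Ioo _ _)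
          (fun x hx => (hder x hx).continuousAt.continuousWithinAt) (fun x hx => ?_) fun x hx => ?_
        · rw [interior_Ioo] at hx
          exact (hder x hx).differentiableAt.differentiableWithinAt
        · rw [interior_Ioo] at hx
          rw [(hder x hx).deriv]
          have hx' := hsub hx
          have hρx := hρ x hx'.2
          have h1 := heq x hx'.2
          have h2 := hex x hx
          have h3 : ρ x * j' x ≤ -κ := by
            rw [h1]
            have := hx'.1.1
            have := hx'.1.2.1
            have := mul_le_mul_of_nonneg_left h2.le this.le
            linarith
          have h4 : j' x - κ * (ρ' x / ρ x) = (ρ x * j' x - κ * ρ' x) / ρ x := by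
            field_simp
          rw [h4]
          refine div_nonpos_of_nonpos_of_nonneg ?_ hρx.le
          nlinarith [hx'.1.2.2]
      obtain ⟨x₁, hx₁⟩ : (Ioo a' b).Nonempty := nonempty_Ioo.2 ha'
      have hlog : Tendsto (fun x => Real.log (ρ x)) (𝓝[<] b) atBot := by
        refine Real.tendsto_log_nhdsGT_zero.comp (tendsto_nhdsWithin_iff.2 ⟨hρ0, ?_⟩)
        filter_upwards [Ioo_mem_nhdsLT hab] with x hx using hρ x hx
      have h5 : ∀ᶠ x in 𝓝[<] b, h + ε < j x₁ - κ * Real.log (ρ x₁) + κ * Real.log (ρ x) := by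
        filter_upwards [Ioo_mem_nhdsLT hx₁.2] with x hx
        have h6 := hanti hx₁ ⟨hx₁.1.trans hx.1, hx.2⟩ hx.1.le
        have h7 := hex x ⟨hx₁.1.trans hx.1, hx.2⟩
        simp only at h6
        linarith
      have h8 : Tendsto (fun x => j x₁ - κ * Real.log (ρ x₁) + κ * Real.log (ρ x))
          (𝓝[<] b) atBot := tendsto_atBot_add_const_left _ _ (hlog.const_mul_atBot hκ0)
      obtain ⟨x, hx1, hx2⟩ := (h5.and (h8.eventually (eventually_le_atBot (h + ε)))).exists
      linarith
  have h1 := main j j' B B₀ hj heq hB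
  have h2 := main (fun x => -j x) (fun x => -j' x) (fun x => -B x) (-B₀)
    (fun x hx => (hj x hx).neg) (fun x hx => by linear_combination -(heq x hx)) hB.neg
  rw [Metric.tendsto_nhds]
  intro ε hε
  filter_upwards [h1 ε hε, h2 ε hε] with x hx1 hx2
  rw [neg_div] at hx2
  rw [Real.dist_eq, abs_lt]
  constructor <;> linarith

end Calculus

end ShadowODE

/-! ### The clamped slope field: existence, uniqueness and comparison. -/

namespace ShadowODE
noncomputable section
namespace Reduced

variable (n : Reduced)

/-- The divided difference of `P` in the second variable. -/
def diffP (x w₁ w₂ : ℝ) : ℝ := 2 + 2 * n.μ * x - 2 * n.e * (w₁ + w₂)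

/-- The divided difference of `Q` in the second variable. -/
def diffQ (x w₁ w₂ : ℝ) : ℝ := -x * (2 * n.e - n.a) - (1 - n.p) * n.diffP x w₁ w₂

/-- The divided difference of the slope in the second variable. -/
def diffSlope (x w₁ w₂ : ℝ) : ℝ :=
  (n.p * n.diffP x w₁ w₂ - n.slope x w₂ * n.diffQ x w₁ w₂) / n.Q x w₁

/-- The slope field, extended constantly across the boundary of the strip `lo ≤ w ≤ up`. -/
def clampSlope (lo up : ℝ → ℝ) (x w : ℝ) : ℝ := n.slope x (max (lo x) (min w (up x)))

/-- A solution of the equation of the clamped slope field. -/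
def IsClampSol (lo up : ℝ → ℝ) (s t : ℝ) (h : ℝ → ℝ) : Prop :=
  ∀ x ∈ Icc s t, HasDerivWithinAt h (n.clampSlope lo up x (h x)) (Icc s t) x

/-- A strip on which the slope is defined. -/
structure IsStrip (lo up : ℝ → ℝ) (s t : ℝ) : Prop where
  lo_cont : ContinuousOn lo (Icc s t)
  up_cont : ContinuousOn up (Icc s t)
  le : ∀ x ∈ Icc s t, lo x ≤ up x
  Q_pos : ∀ x ∈ Icc s t, ∀ w ∈ Icc (lo x) (up x), 0 < n.Q x w

variable {n}

theorem P_sub (x w₁ w₂ : ℝ) : n.P x w₁ - n.P x w₂ = (w₁ - w₂) * n.diffP x w₁ w₂ := by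
  rw [P, P, diffP]; ring

/-- An exact difference quotient, continuous wherever `Q ≠ 0`. On compact sets it supplies the
Lipschitz constant, as a linear coefficient it gives uniqueness, and its sign gives uniqueness at
the singular point. -/
theorem slope_sub {x w₁ w₂ : ℝ} (h₁ : n.Q x w₁ ≠ 0) (h₂ : n.Q x w₂ ≠ 0) :
    n.slope x w₁ - n.slope x w₂ = n.diffSlope x w₁ w₂ * (w₁ - w₂) := by
  have e : n.Q x w₁ - n.Q x w₂ = (w₁ - w₂) * n.diffQ x w₁ w₂ := by
    rw [Q, Q, diffQ, diffP, P, P]; ring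
  have e2 := n.P_sub x w₁ w₂
  have e3 : n.slope x w₂ * n.Q x w₂ = n.p * n.P x w₂ := by
    rw [slope]; field_simp
  rw [diffSlope, div_mul_eq_mul_div, eq_div_iff h₁, sub_mul]
  have e4 : n.slope x w₁ * n.Q x w₁ = n.p * n.P x w₁ := by
    rw [slope]; field_simp
  linear_combination e4 - e3 + n.p * e2 - n.slope x w₂ * e

theorem continuousOn_slope {X : Type*} [TopologicalSpace X] {x w : X → ℝ} {S : Set X}
    (hx : ContinuousOn x S) (hw : ContinuousOn w S) (hQ : ∀ u ∈ S, n.Q (x u) (w u) ≠ 0) :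
    ContinuousOn (fun u => n.slope (x u) (w u)) S := by
  have h1 : ContinuousOn (fun u => n.P (x u) (w u)) S :=
    n.continuous_P.comp_continuousOn (hx.prodMk hw)
  have h2 : ContinuousOn (fun u => n.Q (x u) (w u)) S :=
    n.continuous_Q.comp_continuousOn (hx.prodMk hw)
  exact (continuousOn_const.mul h1).div h2 hQ

theorem continuousOn_diffSlope {X : Type*} [TopologicalSpace X] {x w₁ w₂ : X → ℝ} {S : Set X}
    (hx : ContinuousOn x S) (hw₁ : ContinuousOn w₁ S) (hw₂ : ContinuousOn w₂ S)
    (hQ₁ : ∀ u ∈ S, n.Q (x u) (w₁ u) ≠ 0) (hQ₂ : ∀ u ∈ S, n.Q (x u) (w₂ u) ≠ 0) :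
    ContinuousOn (fun u => n.diffSlope (x u) (w₁ u) (w₂ u)) S := by
  have h1 := continuousOn_slope hx hw₂ hQ₂
  have h2 : ContinuousOn (fun u => n.Q (x u) (w₁ u)) S :=
    n.continuous_Q.comp_continuousOn (hx.prodMk hw₁)
  unfold diffSlope diffQ diffP
  exact ContinuousOn.div (by fun_prop) h2 hQ₁

variable {lo up : ℝ → ℝ} {s t : ℝ}

theorem IsStrip.clamp_mem (hS : n.IsStrip lo up s t) {x : ℝ} (hx : x ∈ Icc s t) (w : ℝ) :
    max (lo x) (min w (up x)) ∈ Icc (lo x) (up x) :=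
  ⟨le_max_left _ _, max_le (hS.le x hx) (min_le_right _ _)⟩

theorem clampSlope_of_mem {x w : ℝ} (hw : w ∈ Icc (lo x) (up x)) :
    n.clampSlope lo up x w = n.slope x w := by
  rw [clampSlope, min_eq_left hw.2, max_eq_right hw.1]

theorem IsStrip.continuousOn_clamp (hS : n.IsStrip lo up s t) :
    ContinuousOn (fun u : ℝ × ℝ => max (lo u.1) (min u.2 (up u.1))) (Icc s t ×ˢ univ) := by
  have h1 : ContinuousOn (fun u : ℝ × ℝ => lo u.1) (Icc s t ×ˢ univ) :=
    hS.lo_cont.comp continuousOn_fst fun u hu => hu.1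
  have h2 : ContinuousOn (fun u : ℝ × ℝ => up u.1) (Icc s t ×ˢ univ) :=
    hS.up_cont.comp continuousOn_fst fun u hu => hu.1
  exact ContinuousOn.sup h1 (ContinuousOn.inf continuousOn_snd h2)

theorem IsStrip.continuousOn_clampSlope (hS : n.IsStrip lo up s t) :
    ContinuousOn (fun u : ℝ × ℝ => n.clampSlope lo up u.1 u.2) (Icc s t ×ˢ univ) :=
  continuousOn_slope continuousOn_fst hS.continuousOn_clamp fun u hu =>
    (hS.Q_pos u.1 hu.1 _ (hS.clamp_mem hu.1 _)).ne'

theorem IsStrip.exists_bounds (hS : n.IsStrip lo up s t) :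
    ∃ M, ∀ x ∈ Icc s t, |lo x| ≤ M ∧ |up x| ≤ M := by
  obtain ⟨M₁, h₁⟩ := isCompact_Icc.exists_bound_of_continuousOn hS.lo_cont
  obtain ⟨M₂, h₂⟩ := isCompact_Icc.exists_bound_of_continuousOn hS.up_cont
  exact ⟨max M₁ M₂, fun x hx => ⟨(h₁ x hx).trans (le_max_left _ _),
    (h₂ x hx).trans (le_max_right _ _)⟩⟩

/-- Clamping does not increase distances, and the divided difference is bounded on the compact set
of clamped pairs. -/
theorem IsStrip.exists_lipschitz (hS : n.IsStrip lo up s t) :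
    ∃ K : NNReal, ∀ x ∈ Icc s t, LipschitzWith K (n.clampSlope lo up x) := by
  obtain ⟨M, hM⟩ := hS.exists_bounds
  have hc1 : ContinuousOn (fun u : ℝ × ℝ × ℝ => max (lo u.1) (min u.2.1 (up u.1)))
      (Icc s t ×ˢ Icc (-M) M ×ˢ Icc (-M) M) :=
    hS.continuousOn_clamp.comp (f := fun u : ℝ × ℝ × ℝ => (u.1, u.2.1)) (by fun_prop)
      fun u hu => ⟨hu.1, mem_univ _⟩
  have hc2 : ContinuousOn (fun u : ℝ × ℝ × ℝ => max (lo u.1) (min u.2.2 (up u.1)))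
      (Icc s t ×ˢ Icc (-M) M ×ˢ Icc (-M) M) :=
    hS.continuousOn_clamp.comp (f := fun u : ℝ × ℝ × ℝ => (u.1, u.2.2)) (by fun_prop)
      fun u hu => ⟨hu.1, mem_univ _⟩
  have hcont := continuousOn_diffSlope (n := n) continuousOn_fst hc1 hc2
    (fun u hu => (hS.Q_pos u.1 hu.1 _ (hS.clamp_mem hu.1 _)).ne')
    (fun u hu => (hS.Q_pos u.1 hu.1 _ (hS.clamp_mem hu.1 _)).ne')
  obtain ⟨C, hC⟩ := (isCompact_Icc.prod (isCompact_Icc.prod isCompact_Icc)).exists_bound_of_continuousOn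
    hcont
  refine ⟨Real.toNNReal C, fun x hx => LipschitzWith.of_dist_le_mul fun w₁ w₂ => ?_⟩
  set v₁ := max (lo x) (min w₁ (up x)) with hv₁
  set v₂ := max (lo x) (min w₂ (up x)) with hv₂
  have m₁ : v₁ ∈ Icc (lo x) (up x) := hS.clamp_mem hx w₁
  have m₂ : v₂ ∈ Icc (lo x) (up x) := hS.clamp_mem hx w₂
  have hb := hM x hx
  have hb1 := abs_le.1 hb.1
  have hb2 := abs_le.1 hb.2
  have hd := hC (x, v₁, v₂) ⟨hx, ⟨by linarith [m₁.1], by linarith [m₁.2]⟩,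
    ⟨by linarith [m₂.1], by linarith [m₂.2]⟩⟩
  simp only [min_eq_left m₁.2, max_eq_right m₁.1, min_eq_left m₂.2, max_eq_right m₂.1] at hd
  have hle : |v₁ - v₂| ≤ |w₁ - w₂| := by
    refine (abs_max_sub_max_le_max _ _ _ _).trans ?_
    refine max_le (by simp) ((abs_min_sub_min_le_max _ _ _ _).trans ?_)
    exact max_le le_rfl (by simp)
  have hcl : n.clampSlope lo up x w₁ - n.clampSlope lo up x w₂
      = n.diffSlope x v₁ v₂ * (v₁ - v₂) :=
    slope_sub (hS.Q_pos x hx _ m₁).ne' (hS.Q_pos x hx _ m₂).ne'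
  rw [Real.dist_eq, Real.dist_eq, hcl, abs_mul]
  exact mul_le_mul (hd.trans (Real.le_coe_toNNReal C)) hle (abs_nonneg _) NNReal.zero_le_coe

theorem IsStrip.exists_bound_slope (hS : n.IsStrip lo up s t) :
    ∃ C : NNReal, ∀ x ∈ Icc s t, ∀ w, |n.clampSlope lo up x w| ≤ C := by
  obtain ⟨M, hM⟩ := hS.exists_bounds
  obtain ⟨C, hC⟩ := (isCompact_Icc.prod (isCompact_Icc (a := -M) (b := M))).exists_bound_of_continuousOn
    (hS.continuousOn_clampSlope.mono (prod_mono_right (subset_univ _)))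
  refine ⟨Real.toNNReal C, fun x hx w => ?_⟩
  have m₁ := hS.clamp_mem hx w
  have hb1 := abs_le.1 (hM x hx).1
  have hb2 := abs_le.1 (hM x hx).2
  have := hC (x, max (lo x) (min w (up x)))
    ⟨hx, ⟨by linarith [m₁.1], by linarith [m₁.2]⟩⟩
  rw [clampSlope_of_mem m₁] at this
  exact this.trans (Real.le_coe_toNNReal C)

/-- The clamped field is bounded by some `C`, so a solution stays in the ball of radius `C (t - s)`
and Picard–Lindelöf covers the whole interval at once. -/
theorem IsStrip.exists_sol (hS : n.IsStrip lo up s t) (hst : s ≤ t) (w₀ : ℝ) :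
    ∃ h, h s = w₀ ∧ n.IsClampSol lo up s t h := by
  obtain ⟨K, hK⟩ := hS.exists_lipschitz
  obtain ⟨C, hC⟩ := hS.exists_bound_slope
  have hPL : IsPicardLindelof (n.clampSlope lo up) (⟨s, left_mem_Icc.2 hst⟩ : Icc s t) w₀
      (C * Real.toNNReal (t - s)) 0 C K := by
    refine ⟨fun x hx => (hK x hx).lipschitzOnWith, fun w _ => ?_, fun x hx w _ => hC x hx w, ?_⟩
    · exact hS.continuousOn_clampSlope.comp (f := fun x => (x, w)) (by fun_prop)
        fun x hx => ⟨hx, mem_univ _⟩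
    · simp [sub_nonneg.2 hst]
  exact hPL.exists_eq_forall_mem_Icc_hasDerivWithinAt₀

theorem IsClampSol.mono {h : ℝ → ℝ} (hh : n.IsClampSol lo up s t h) {s' t' : ℝ} (hs : s ≤ s')
    (ht : t' ≤ t) : n.IsClampSol lo up s' t' h := fun x hx =>
  (hh x (Icc_subset_Icc hs ht hx)).mono (Icc_subset_Icc hs ht)

theorem IsClampSol.continuousOn {h : ℝ → ℝ} (hh : n.IsClampSol lo up s t h) :
    ContinuousOn h (Icc s t) := fun x hx => (hh x hx).continuousWithinAt

theorem IsClampSol.hasDerivAt {h : ℝ → ℝ} (hh : n.IsClampSol lo up s t h) {x : ℝ}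
    (hx : x ∈ Ioo s t) : HasDerivAt h (n.clampSlope lo up x (h x)) x :=
  (hh x (Ioo_subset_Icc_self hx)).hasDerivAt (Icc_mem_nhds hx.1 hx.2)

/-- The constant belongs to the whole strip and serves every subinterval, so it can be fixed before
the solutions are chosen. -/
theorem IsStrip.exists_gronwall (hS : n.IsStrip lo up s t) :
    ∃ C : ℝ, 0 ≤ C ∧ ∀ s' t' : ℝ, s ≤ s' → t' ≤ t → ∀ h₁ h₂ : ℝ → ℝ, n.IsClampSol lo up s' t' h₁ →
      n.IsClampSol lo up s' t' h₂ → ∀ x ∈ Icc s' t', |h₁ x - h₂ x| ≤ C * |h₁ s' - h₂ s'| := by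
  obtain ⟨K, hK⟩ := hS.exists_lipschitz
  refine ⟨Real.exp (K * (t - s)), (Real.exp_pos _).le, fun s' t' hs ht h₁ h₂ hh₁ hh₂ x hx => ?_⟩
  have conv : ∀ h : ℝ → ℝ, n.IsClampSol lo up s' t' h → ∀ y ∈ Ico s' t',
      HasDerivWithinAt h (n.clampSlope lo up y (h y)) (Ici y) y := fun h hh y hy =>
    (hh y (Ico_subset_Icc_self hy)).mono_of_mem_nhdsWithin
      (mem_of_superset (Icc_mem_nhdsGE hy.2) (Icc_subset_Icc_left hy.1))
  have := dist_le_of_trajectories_ODE_of_mem (v := n.clampSlope lo up) (s := fun _ => univ)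
    (K := K) (fun y hy => (hK y ⟨hs.trans hy.1, hy.2.le.trans ht⟩).lipschitzOnWith)
    hh₁.continuousOn (conv h₁ hh₁) (fun _ _ => mem_univ _) hh₂.continuousOn (conv h₂ hh₂)
    (fun _ _ => mem_univ _) le_rfl x hx
  rw [Real.dist_eq, Real.dist_eq, mul_comm] at this
  refine this.trans (mul_le_mul_of_nonneg_right (Real.exp_le_exp.2 ?_) (abs_nonneg _))
  exact mul_le_mul_of_nonneg_left (by linarith [hx.2]) K.2

theorem IsStrip.unique (hS : n.IsStrip lo up s t) {h₁ h₂ : ℝ → ℝ} {s' t' : ℝ} (hs : s ≤ s')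
    (ht : t' ≤ t) (hh₁ : n.IsClampSol lo up s' t' h₁) (hh₂ : n.IsClampSol lo up s' t' h₂)
    (h0 : h₁ s' = h₂ s') {x : ℝ} (hx : x ∈ Icc s' t') : h₁ x = h₂ x := by
  obtain ⟨C, _, hC⟩ := hS.exists_gronwall
  have := hC s' t' hs ht h₁ h₂ hh₁ hh₂ x hx
  rw [h0, sub_self, abs_zero, mul_zero] at this
  exact sub_eq_zero.1 (abs_nonpos_iff.1 this)

/-- Solutions that changed order would meet, and by uniqueness agree from the last meeting point on.
-/
theorem IsStrip.le_of_le (hS : n.IsStrip lo up s t) {h₁ h₂ : ℝ → ℝ}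
    (hh₁ : n.IsClampSol lo up s t h₁) (hh₂ : n.IsClampSol lo up s t h₂)
    (h0 : h₁ s ≤ h₂ s) {x : ℝ} (hx : x ∈ Icc s t) : h₁ x ≤ h₂ x := by
  by_contra hn
  push Not at hn
  obtain ⟨y, hy, hy0, -⟩ := exists_last_zero (f := fun x => h₂ x - h₁ x) hx.1
    ((hh₂.continuousOn.sub hh₁.continuousOn).mono (Icc_subset_Icc_right hx.2))
    (sub_nonneg.2 h0) (by linarith)
  have := hS.unique hy.1 hx.2 (hh₁.mono hy.1 hx.2) (hh₂.mono hy.1 hx.2)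
    (by linarith) (right_mem_Icc.2 hy.2.le)
  linarith

end Reduced
end
end ShadowODE

/-! ### Behaviour of clamped solutions right of the singular point. -/

namespace ShadowODE
noncomputable section
namespace Reduced

variable {n : Reduced}

/-- The summand `2 (μ h - a x)` is `∂P/∂x`. Since the slope vanishes on the boundary, its sign
decides whether a solution enters or leaves the region there. -/
theorem hasDerivAt_P {h : ℝ → ℝ} {d x : ℝ} (hh : HasDerivAt h d x) :
    HasDerivAt (fun t => n.P t (h t))
      (n.diffP x (h x) (h x) * d + 2 * (n.μ * h x - n.a * x)) x := by
  have h1 := (((hh.const_mul 2).fun_add (((hasDerivAt_id x).const_mul (2 * n.μ)).fun_mul hh)).fun_sub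
    ((hh.fun_pow 2).const_mul (2 * n.e))).fun_sub ((hasDerivAt_pow 2 x).const_mul n.a)
  refine h1.congr_deriv ?_
  simp only [diffP, id]
  push_cast
  ring

theorem slope_eq_zero {x w : ℝ} (h : n.P x w = 0) : n.slope x w = 0 := by
  rw [slope, h, mul_zero, zero_div]

theorem slope_lt_ray {x w : ℝ} (hx : 0 < x) (hQ : 0 < n.Q x w)
    (h : 0 < (w - x) * n.J x w) : n.slope x w < w / x := by
  have := n.key_ray x w
  rw [slope, div_lt_div_iff₀ hQ hx]
  linarith

/-- Below the diagonal `J < 0`, because both its terms are nonpositive and the first is negative; so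
`(w - x) J > 0`. -/
theorem slope_lt_ray_of_lt {x w : ℝ} (hx : 0 < x) (h : 0 ≤ n.P x w) (hw : w < x) :
    n.slope x w < w / x := by
  have h1 := n.a_pos
  have h2 := n.p_lt
  refine slope_lt_ray hx (Q_pos_of_lt hx h hw) ?_
  refine mul_pos_of_neg_of_neg (by linarith) ?_
  have h3 : n.a * x * (w - x) < 0 := mul_neg_of_pos_of_neg (by positivity) (by linarith)
  rw [J]; nlinarith

/-! ### Right of the singular point -/

theorem isStrip_right {s : ℝ} (hs : n.xP < s) : n.IsStrip n.bot n.top s n.xE :=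
  ⟨n.continuous_bot.continuousOn, n.continuous_top.continuousOn, fun x _ => bot_le_top x,
    fun x hx w hw => by
      have hx' : n.xP < x := hs.trans_le hx.1
      have hd := (disc_nonneg_iff (n.xP_pos.trans hx')).2 hx.2
      exact Q_pos_of_xP_lt hx' ((P_nonneg_iff hd).2 hw)⟩

theorem clampSlope_of_nonneg {x w : ℝ} (h : 0 ≤ n.P x w) :
    n.clampSlope n.bot n.top x w = n.slope x w :=
  clampSlope_of_mem ((P_nonneg_iff (disc_nonneg_of_P_nonneg h)).1 h)

/-- The clamped point is on a branch, where the slope vanishes. Clamped solutions are thus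
horizontal outside the region. -/
theorem clampSlope_of_nonpos {x w : ℝ} (hx : 0 ≤ n.disc x) (h : n.P x w ≤ 0) :
    n.clampSlope n.bot n.top x w = 0 := by
  have hbt := n.bot_le_top x
  rcases lt_or_ge w (n.bot x) with h1 | h1
  · rw [clampSlope, min_eq_left (h1.le.trans hbt), max_eq_left h1.le]
    exact slope_eq_zero (P_bot hx)
  rcases lt_or_ge (n.top x) w with h2 | h2
  · rw [clampSlope, min_eq_right h2.le, max_eq_right hbt]
    exact slope_eq_zero (P_top hx)
  · rw [clampSlope_of_mem ⟨h1, h2⟩]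
    exact slope_eq_zero (h.antisymm ((P_nonneg_iff hx).2 ⟨h1, h2⟩))

theorem clampSlope_nonneg {x w : ℝ} (hx : n.xP < x) (hE : x ≤ n.xE) :
    0 ≤ n.clampSlope n.bot n.top x w := by
  rcases le_total 0 (n.P x w) with h | h
  · rw [clampSlope_of_nonneg h]
    exact div_nonneg (mul_nonneg n.p_pos.le h) (Q_pos_of_xP_lt hx h).le
  · rw [clampSlope_of_nonpos ((disc_nonneg_iff (n.xP_pos.trans hx)).2 hE) h]

variable {s : ℝ} {h : ℝ → ℝ}

theorem monotoneOn_right (hs : n.xP < s) (hh : n.IsClampSol n.bot n.top s n.xE h) :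
    MonotoneOn h (Icc s n.xE) := by
  refine monotoneOn_of_deriv_nonneg (convex_Icc _ _) hh.continuousOn (fun x hx => ?_) fun x hx => ?_
  · rw [interior_Icc] at hx
    exact (hh.hasDerivAt hx).differentiableAt.differentiableWithinAt
  · rw [interior_Icc] at hx
    rw [(hh.hasDerivAt hx).deriv]
    exact clampSlope_nonneg (hs.trans hx.1) hx.2.le

/-- Inside the region the slope lies below that of the ray, and outside it is zero while `h > 0`.
Consequently `μ h - a x` changes sign at most once. -/
theorem strictAntiOn_ratio (hs : n.xP < s) (hh : n.IsClampSol n.bot n.top s n.xE h)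
    (h0 : 0 < h s) : StrictAntiOn (fun x => h x / x) (Icc s n.xE) := by
  have hpos : ∀ x ∈ Icc s n.xE, 0 < x := fun x hx => n.xP_pos.trans (hs.trans_le hx.1)
  refine strictAntiOn_of_deriv_neg (convex_Icc _ _)
    (hh.continuousOn.div continuousOn_id fun x hx => (hpos x hx).ne') fun x hx => ?_
  rw [interior_Icc] at hx
  have hx' := Ioo_subset_Icc_self hx
  have hx0 := hpos x hx'
  have hd := (hh.hasDerivAt hx).fun_div (hasDerivAt_id x) hx0.ne'
  simp only [id] at hd
  rw [hd.deriv]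
  refine div_neg_of_neg_of_pos ?_ (by positivity)
  have hhx : 0 < h x :=
    h0.trans_le (monotoneOn_right hs hh (left_mem_Icc.2 (hx.1.trans hx.2).le) hx' hx.1.le)
  rcases le_total 0 (n.P x (h x)) with h1 | h1
  · rw [clampSlope_of_nonneg h1]
    have := slope_lt_ray_of_lt hx0 h1 (lt_of_xP_lt (hs.trans hx.1) h1)
    rw [lt_div_iff₀ hx0] at this
    linarith
  · rw [clampSlope_of_nonpos ((disc_nonneg_iff hx0).2 hx.2.le) h1]
    linarith

/-- The derivative of `P` along a solution of the equation. -/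
theorem hasDerivAt_P_sol {x : ℝ} (hh : HasDerivAt h (n.slope x (h x)) x) :
    HasDerivAt (fun t => n.P t (h t))
      (n.p * n.diffP x (h x) (h x) / n.Q x (h x) * n.P x (h x) + 2 * (n.μ * h x - n.a * x)) x := by
  refine (hasDerivAt_P hh).congr_deriv ?_
  rw [slope]; ring

theorem continuousOn_P_coeff {S : Set ℝ} (hc : ContinuousOn h S)
    (hQ : ∀ x ∈ S, n.Q x (h x) ≠ 0) :
    ContinuousOn (fun x => n.p * n.diffP x (h x) (h x) / n.Q x (h x)) S := by
  have : ContinuousOn (fun x => n.Q x (h x)) S :=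
    n.continuous_Q.comp_continuousOn (continuousOn_id.prodMk hc)
  unfold diffP
  exact ContinuousOn.div (by fun_prop) this hQ

/-- Before `y` the source `2 (μ h - a x)` is positive, by the decreasing ratio. While `P < 0` the
solution is horizontal and `P` can only increase, so `P` never drops below zero. Then the true
equation holds, and the linear equation for `P` makes it strictly positive. -/
theorem P_pos_right (hs : n.xP < s) (hh : n.IsClampSol n.bot n.top s n.xE h)
    (h0 : 0 ≤ n.P s (h s)) {y : ℝ} (hy : y ∈ Ioc s n.xE) (hY : n.a * y ≤ n.μ * h y) :
    0 < n.P y (h y) := by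
  have hs0 := n.xP_pos.trans hs
  have hμ := n.μ_pos
  have hanti := strictAntiOn_ratio hs hh (pos_of_P_nonneg hs0 h0)
  have hYx : ∀ x ∈ Ico s y, n.a * x < n.μ * h x := by
    intro x hx
    have hx0 : 0 < x := hs0.trans_le hx.1
    have h1 := hanti ⟨hx.1, hx.2.le.trans hy.2⟩ ⟨hy.1.le, hy.2⟩ hx.2
    simp only at h1
    have h2 : n.a ≤ n.μ * (h y / y) := by
      rw [← mul_div_assoc, le_div_iff₀ (hs0.trans hy.1)]; exact hY
    have h3 : n.a < n.μ * (h x / x) := h2.trans_lt (mul_lt_mul_of_pos_left h1 hμ)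
    rwa [← mul_div_assoc, lt_div_iff₀ hx0] at h3
  have hcP : ContinuousOn (fun x => n.P x (h x)) (Icc s n.xE) :=
    n.continuous_P.comp_continuousOn (continuousOn_id.prodMk hh.continuousOn)
  have hnn : ∀ x ∈ Icc s y, 0 ≤ n.P x (h x) := by
    intro x hx
    by_contra hn
    push Not at hn
    obtain ⟨z, hz, hz0, hzn⟩ := exists_last_zero hx.1
      (hcP.mono (Icc_subset_Icc_right (hx.2.trans hy.2))) h0 hn
    have hm : MonotoneOn (fun x => n.P x (h x)) (Icc z x) := by
      have hder : ∀ t ∈ Ioo z x, HasDerivAt (fun x => n.P x (h x))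
          (2 * (n.μ * h t - n.a * t)) t := by
        intro t ht
        have ht' : t ∈ Ioo s n.xE := ⟨hz.1.trans_lt ht.1, (ht.2.trans_le hx.2).trans_le hy.2⟩
        have h1 := hh.hasDerivAt ht'
        rw [clampSlope_of_nonpos ((disc_nonneg_iff (hs0.trans ht'.1)).2 ht'.2.le)
          (hzn t ⟨ht.1, ht.2.le⟩).le] at h1
        exact (hasDerivAt_P h1).congr_deriv (by ring)
      refine monotoneOn_of_deriv_nonneg (convex_Icc _ _)
        (hcP.mono (Icc_subset_Icc hz.1 (hx.2.trans hy.2))) (fun t ht => ?_) fun t ht => ?_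
      · rw [interior_Icc] at ht
        exact (hder t ht).differentiableAt.differentiableWithinAt
      · rw [interior_Icc] at ht
        rw [(hder t ht).deriv]
        linarith [hYx t ⟨hz.1.trans ht.1.le, ht.2.trans_le hx.2⟩]
    have h2 := hm (left_mem_Icc.2 hz.2.le) (right_mem_Icc.2 hz.2.le) hz.2.le
    simp only at h2
    linarith
  have hQ : ∀ x ∈ Icc s y, n.Q x (h x) ≠ 0 := fun x hx =>
    (Q_pos_of_xP_lt (hs.trans_le hx.1) (hnn x hx)).ne'
  refine pos_of_linear_ode (f := fun x => n.P x (h x)) hy.1 (hcP.mono (Icc_subset_Icc_right hy.2))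
    (continuousOn_P_coeff (hh.continuousOn.mono (Icc_subset_Icc_right hy.2)) hQ)
    (r := fun x => 2 * (n.μ * h x - n.a * x)) (fun x hx => ?_) (fun x hx => ?_) h0
  · have h1 := hh.hasDerivAt ⟨hx.1, hx.2.trans_le hy.2⟩
    rw [clampSlope_of_nonneg (hnn x (Ioo_subset_Icc_self hx))] at h1
    exact hasDerivAt_P_sol h1
  · linarith [hYx x ⟨hx.1.le, hx.2⟩]

theorem P_xE_nonpos (w : ℝ) : n.P n.xE w ≤ 0 := by
  have h1 := n.two_e_mul_P n.xE w
  have he := n.e_pos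
  have h2 : n.disc n.xE = 0 := by
    refine le_antisymm ?_ ((disc_nonneg_iff n.xE_pos).2 le_rfl)
    by_contra hn
    push Not at hn
    exact lt_irrefl _ ((disc_pos_iff n.xE_pos).1 hn)
  rw [h2] at h1
  by_contra hn
  push Not at hn
  have : 0 < 2 * n.e * n.P n.xE w := by positivity
  nlinarith [sq_nonneg (2 * n.e * w - 1 - n.μ * n.xE)]

/-- The end of a solution: it leaves the region at a point of the right part of the boundary and
is constant afterwards. -/
theorem exists_exit (hs : n.xP < s) (hsE : s < n.xE) (hh : n.IsClampSol n.bot n.top s n.xE h)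
    (h0 : 0 ≤ n.P s (h s)) (hY : n.a * s < n.μ * h s) :
    ∃ b ∈ Ioc s n.xE, (∀ x ∈ Ioo s b, 0 < n.P x (h x)) ∧ n.P b (h b) = 0 ∧
      n.μ * h b < n.a * b ∧ (∀ x ∈ Icc b n.xE, h x = h b) ∧
      ∀ x ∈ Ioc b n.xE, n.P x (h x) < 0 := by
  have hs0 := n.xP_pos.trans hs
  have hμ := n.μ_pos
  have hanti := strictAntiOn_ratio hs hh (pos_of_P_nonneg hs0 h0)
  have hcP : ContinuousOn (fun x => n.P x (h x)) (Icc s n.xE) :=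
    n.continuous_P.comp_continuousOn (continuousOn_id.prodMk hh.continuousOn)
  -- No point over `xE` has `P > 0`, so `P_pos_right` cannot apply there: the ratio has already
  -- fallen below `a / μ`.
  have hYE : n.μ * h n.xE < n.a * n.xE := by
    by_contra hn
    push Not at hn
    exact absurd (P_pos_right hs hh h0 ⟨hsE, le_rfl⟩ hn) (not_lt.2 (P_xE_nonpos _))
  obtain ⟨z, hz, hz0⟩ : ∃ z ∈ Icc s n.xE, n.μ * h z - n.a * z = 0 := by
    have hc : ContinuousOn (fun x => n.μ * h x - n.a * x) (Icc s n.xE) :=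
      (continuousOn_const.mul hh.continuousOn).sub (by fun_prop)
    have := intermediate_value_Icc' hsE.le hc (show (0 : ℝ) ∈ Icc _ _ from
      ⟨by linarith, by linarith⟩)
    exact this
  have hzs : s < z := by
    refine lt_of_le_of_ne hz.1 ?_
    rintro rfl
    linarith
  have hYmono : ∀ x ∈ Icc s n.xE, ∀ y ∈ Icc s n.xE, x < y →
      n.μ * h x ≤ n.a * x → n.μ * h y < n.a * y := by
    intro x hx y hy hxy hle
    have h1 := hanti hx hy hxy
    simp only at h1
    have h2 : n.μ * (h x / x) ≤ n.a := by
      rw [← mul_div_assoc, div_le_iff₀ (hs0.trans_le hx.1)]; exact hle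
    have h3 : n.μ * (h y / y) < n.a := (mul_lt_mul_of_pos_left h1 hμ).trans_le h2
    rwa [← mul_div_assoc, div_lt_iff₀ (hs0.trans_le hy.1)] at h3
  have hPz : 0 < n.P z (h z) := P_pos_right hs hh h0 ⟨hzs, hz.2⟩ (by linarith)
  -- The exit is sought only after `z`, where `P > 0` and `μ h - a x` changes sign; from there on
  -- the source is negative.
  obtain ⟨b, hb, hb0, hbn⟩ := exists_first_zero (f := fun x => -n.P x (h x)) hz.2
    (hcP.mono (Icc_subset_Icc_left hz.1)).neg (by simpa using hPz)
    (by simpa using P_xE_nonpos (h n.xE))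
  have hPb : n.P b (h b) = 0 := by simpa using hb0
  have hsb : s < b := hzs.trans hb.1
  have hYafter : ∀ x ∈ Ioc z n.xE, n.μ * h x < n.a * x := fun x hx =>
    hYmono z hz x ⟨hz.1.trans hx.1.le, hx.2⟩ hx.1 (by linarith)
  -- `P` can cross zero only downwards after `z`
  have hcr : ∀ x ∈ Ioo b n.xE, n.P x (h x) ≤ 0 := by
    intro x hx
    by_contra hn
    push Not at hn
    obtain ⟨y, hy, hy0, hyn⟩ := exists_last_zero (f := fun x => -n.P x (h x)) hx.1.le
      (hcP.mono (Icc_subset_Icc hsb.le hx.2.le)).neg (by simp [hPb]) (by simpa using hn)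
    have hy' : y ∈ Ioo z n.xE := ⟨hb.1.trans_le hy.1, hy.2.trans hx.2⟩
    have hPy : n.P y (h y) = 0 := by simpa using hy0
    have h1 := hh.hasDerivAt ⟨hzs.trans hy'.1, hy'.2⟩
    rw [clampSlope_of_nonneg hPy.ge, slope_eq_zero hPy] at h1
    have h2 := neg_right_of_hasDerivAt (hasDerivAt_P h1) (by
      have := hYafter y ⟨hy'.1, hy'.2.le⟩
      rw [mul_zero, zero_add]
      linarith) hPy
    obtain ⟨t, ht1, ht2⟩ := (h2.and (Ioo_mem_nhdsGT hy.2)).exists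
    have := hyn t ⟨ht2.1, ht2.2.le⟩
    linarith
  have hder : ∀ x ∈ Ioo b n.xE, HasDerivAt h 0 x := by
    intro x hx
    have h1 := hh.hasDerivAt ⟨hsb.trans hx.1, hx.2⟩
    rwa [clampSlope_of_nonpos ((disc_nonneg_iff (hs0.trans (hsb.trans hx.1))).2 hx.2.le)
      (hcr x hx)] at h1
  have hconst : ∀ x ∈ Icc b n.xE, h x = h b := by
    intro x hx
    have hc : ContinuousOn (fun x => h x - h b) (Icc b x) :=
      (hh.continuousOn.mono (Icc_subset_Icc hsb.le hx.2)).sub continuousOn_const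
    have := eq_zero_of_linear_ode (c := fun _ => 0) hx.1 hc continuousOn_const
      (fun y hy => by simpa using (hder y ⟨hy.1, hy.2.trans_le hx.2⟩).sub_const (h b)) (sub_self _)
    linarith
  refine ⟨b, ⟨hsb, hb.2⟩, fun x hx => ?_, hPb, hYafter b hb, hconst, fun x hx => ?_⟩
  · rcases le_or_gt x z with hxz | hxz
    · refine P_pos_right hs hh h0 ⟨hx.1, hxz.trans hz.2⟩ ?_
      by_contra hn
      push Not at hn
      rcases hxz.eq_or_lt with h1 | h1
      · rw [h1] at hn; linarith
      · have := hYmono x ⟨hx.1.le, hxz.trans hz.2⟩ z hz h1 hn.le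
        linarith
    · simpa using hbn x ⟨hxz.le, hx.2⟩
  · have hanti2 : StrictAntiOn (fun x => n.P x (h x)) (Icc b n.xE) := by
      refine strictAntiOn_of_deriv_neg (convex_Icc _ _) (hcP.mono (Icc_subset_Icc_left hsb.le))
        fun y hy => ?_
      rw [interior_Icc] at hy
      rw [(hasDerivAt_P (hder y hy)).deriv, mul_zero, zero_add]
      linarith [hYafter y ⟨hb.1.trans hy.1, hy.2.le⟩]
    have := hanti2 (left_mem_Icc.2 hb.2) ⟨hx.1.le, hx.2⟩ hx.1
    simp only [hPb] at this
    exact this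

/-- The right-hand boundary point at height `w`. -/
def xRight (n : Reduced) (w : ℝ) : ℝ :=
  (n.μ * w + Real.sqrt (w * (2 * n.a - (2 * n.e * n.a - n.μ ^ 2) * w))) / n.a

theorem continuous_xRight : Continuous n.xRight := by unfold xRight; fun_prop

/-- The quadratic equation `a_mul_P` for `x`, with the root selected by `hY`. It makes the exit
abscissa a continuous function of the exit height. -/
theorem eq_xRight {x w : ℝ} (h : n.P x w = 0) (hY : n.μ * w ≤ n.a * x) : x = n.xRight w := by
  have ha := n.a_pos
  have h1 := n.a_mul_P x w
  rw [h, mul_zero] at h1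
  have h2 : w * (2 * n.a - (2 * n.e * n.a - n.μ ^ 2) * w) = (n.a * x - n.μ * w) ^ 2 := by linarith
  rw [xRight, h2, Real.sqrt_sq (by linarith)]
  field_simp; ring

end Reduced
end
end ShadowODE

/-! ### The family started right of the singular point, its limit, and the exit point. -/

namespace ShadowODE
noncomputable section
namespace Reduced

variable {n : Reduced}

/-- A solution of the clamped equation right of the singular point, constant up to `α`. -/
theorem exists_rightSol {α : ℝ} (hα : α ∈ Ioo n.xP n.xN) :
    ∃ h : ℝ → ℝ, (∀ x ≤ α, h x = n.top α) ∧
      ∀ s, n.xP < s → n.IsClampSol n.bot n.top s n.xE h := by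
  have hα0 : 0 < α := n.xP_pos.trans hα.1
  have hαE : α < n.xE := hα.2.trans n.xN_lt_xE
  obtain ⟨h, h0, hh⟩ := (isStrip_right hα.1).exists_sol hαE.le (n.top α)
  set g : ℝ → ℝ := fun x => if x ≤ α then n.top α else h x with hg
  have hgl : ∀ x ≤ α, g x = n.top α := fun x hx => if_pos hx
  have hgr : ∀ x ∈ Icc α n.xE, g x = h x := by
    intro x hx
    rcases hx.1.eq_or_lt with e | e
    · rw [← e, h0, hgl α le_rfl]
    · exact if_neg (not_le.2 e)
  have hd : 0 ≤ n.disc α := (disc_nonneg_iff hα0).2 hαE.le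
  refine ⟨g, hgl, fun s hs => ?_⟩
  -- Left of `α` the constant `top α` lies above the increasing branch, where the clamped slope is
  -- zero. So one function solves the equation on every `[s, xE]` with `xP < s`.
  have left : ∀ x ∈ Icc s α, HasDerivWithinAt g (n.clampSlope n.bot n.top x (g x)) (Iic α) x := by
    intro x hx
    have hx0 : 0 < x := n.xP_pos.trans (hs.trans_le hx.1)
    have e : n.clampSlope n.bot n.top x (g x) = 0 := by
      refine clampSlope_of_nonpos ((disc_nonneg_iff hx0).2 (hx.2.trans hαE.le)) ?_
      rw [hgl x hx.2]
      rcases hx.2.eq_or_lt with e | e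
      · rw [e, P_top hd]
      · by_contra hn
        push Not at hn
        have h1 := (P_pos_iff.1 hn).2
        have h2 := n.strictMonoOn_top ⟨hx0.le, (hx.2.trans hα.2.le)⟩ ⟨hα0.le, hα.2.le⟩ e
        exact lt_asymm h1 h2
    rw [e]
    exact (hasDerivWithinAt_const x (Iic α) (n.top α)).congr_of_mem (fun y hy => hgl y hy) hx.2
  have right : ∀ x ∈ Icc α n.xE,
      HasDerivWithinAt g (n.clampSlope n.bot n.top x (g x)) (Icc α n.xE) x := by
    intro x hx
    rw [hgr x hx]
    exact (hh x hx).congr_of_mem hgr hx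
  intro x hx
  rcases lt_trichotomy x α with hxα | hxα | hxα
  · exact ((left x ⟨hx.1, hxα.le⟩).hasDerivAt (Iic_mem_nhds hxα)).hasDerivWithinAt
  · have h1 := (left x ⟨hx.1, hxα.le⟩).union (right x ⟨hxα.ge, hx.2⟩)
    refine h1.mono fun y hy => ?_
    rcases le_total y α with h2 | h2
    · exact Or.inl h2
    · exact Or.inr ⟨h2, hy.2⟩
  · refine (right x ⟨hxα.le, hx.2⟩).mono_of_mem_nhdsWithin ?_
    exact mem_nhdsWithin.2 ⟨Ioi α, isOpen_Ioi, hxα, fun y hy => ⟨hy.1.le, hy.2.2⟩⟩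

open Classical in
/-- The chosen solution started on the upper branch at `α`, right of the singular point. -/
def rightSol (n : Reduced) (α : ℝ) : ℝ → ℝ :=
  if hα : α ∈ Ioo n.xP n.xN then (exists_rightSol hα).choose else fun _ => 0

theorem rightSol_of_le {α x : ℝ} (hα : α ∈ Ioo n.xP n.xN) (hx : x ≤ α) :
    n.rightSol α x = n.top α := by
  rw [rightSol, dif_pos hα]
  exact (exists_rightSol hα).choose_spec.1 x hx

theorem isClampSol_rightSol {α s : ℝ} (hα : α ∈ Ioo n.xP n.xN) (hs : n.xP < s) :
    n.IsClampSol n.bot n.top s n.xE (n.rightSol α) := by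
  rw [rightSol, dif_pos hα]
  exact (exists_rightSol hα).choose_spec.2 s hs

/-- From a common abscissa `s` below both starts the initial values are `top α'` and `top α`, so
Grönwall transfers the continuity of `top`. -/
theorem continuousAt_rightSol {α x : ℝ} (hα : α ∈ Ioo n.xP n.xN) (hx : x ∈ Ioc n.xP n.xE) :
    ContinuousAt (fun α => n.rightSol α x) α := by
  obtain ⟨s, hs1, hs2⟩ := exists_between (lt_min hα.1 hx.1)
  obtain ⟨C, hC0, hC⟩ := (isStrip_right hs1).exists_gronwall
  have hsα := hs2.trans_le (min_le_left _ _)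
  have hsx := hs2.trans_le (min_le_right _ _)
  rw [ContinuousAt, tendsto_iff_dist_tendsto_zero]
  have hlim : Tendsto (fun α' => C * |n.top α' - n.top α|) (𝓝 α) (𝓝 0) := by
    have : Continuous fun α' => C * |n.top α' - n.top α| := by
      have := n.continuous_top
      fun_prop
    simpa using this.tendsto α
  refine squeeze_zero' (Eventually.of_forall fun _ => dist_nonneg) ?_ hlim
  filter_upwards [Ioo_mem_nhds hsα hα.2] with α' hα'
  have hα'' : α' ∈ Ioo n.xP n.xN := ⟨hs1.trans hα'.1, hα'.2⟩
  have := hC s n.xE le_rfl le_rfl _ _ (isClampSol_rightSol hα'' hs1) (isClampSol_rightSol hα hs1)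
    x ⟨hsx.le, hx.2⟩
  rwa [rightSol_of_le hα'' hα'.1.le, rightSol_of_le hα hsα.le] at this

theorem monotoneOn_rightSol {x : ℝ} (hx : x ∈ Ioc n.xP n.xE) :
    MonotoneOn (fun α => n.rightSol α x) (Ioo n.xP n.xN) := by
  intro α hα α' hα' hle
  obtain ⟨s, hs1, hs2⟩ := exists_between (lt_min hα.1 hx.1)
  have hsα := hs2.trans_le (min_le_left _ _)
  have hsx := hs2.trans_le (min_le_right _ _)
  refine (isStrip_right hs1).le_of_le (isClampSol_rightSol hα hs1) (isClampSol_rightSol hα' hs1) ?_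
    ⟨hsx.le, hx.2⟩
  rw [rightSol_of_le hα hsα.le, rightSol_of_le hα' (hsα.le.trans hle)]
  exact n.strictMonoOn_top.monotoneOn ⟨n.xP_pos.le.trans hα.1.le, hα.2.le⟩
    ⟨n.xP_pos.le.trans hα'.1.le, hα'.2.le⟩ hle

theorem xP_lt_top {α : ℝ} (hα : α ∈ Ioo n.xP n.xN) : n.xP < n.top α := by
  conv_lhs => rw [← n.top_xP]
  exact n.strictMonoOn_top ⟨n.xP_pos.le, n.xP_le_xN⟩ ⟨n.xP_pos.le.trans hα.1.le, hα.2.le⟩ hα.1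

theorem top_le_rightSol {α x : ℝ} (hα : α ∈ Ioo n.xP n.xN) (hx : x ∈ Ioc n.xP n.xE) :
    n.top α ≤ n.rightSol α x := by
  obtain ⟨s, hs1, hs2⟩ := exists_between (lt_min hα.1 hx.1)
  have hsα := hs2.trans_le (min_le_left _ _)
  have hsx := hs2.trans_le (min_le_right _ _)
  rw [← rightSol_of_le hα hsα.le]
  exact monotoneOn_right hs1 (isClampSol_rightSol hα hs1) ⟨le_rfl, hsx.le.trans hx.2⟩
    ⟨hsx.le, hx.2⟩ hsx.le

open Classical in
/-- The solution that emanates to the right from the singular point (constant if there is none). -/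
def singSol (n : Reduced) (x : ℝ) : ℝ :=
  if x ≤ n.xP ∨ n.μ ≤ n.a then n.xP else sInf ((fun α => n.rightSol α x) '' Ioo n.xP n.xN)

theorem singSol_xP : n.singSol n.xP = n.xP := if_pos (Or.inl le_rfl)

theorem bddBelow_rightSol {x : ℝ} (hx : x ∈ Ioc n.xP n.xE) :
    BddBelow ((fun α => n.rightSol α x) '' Ioo n.xP n.xN) := by
  refine ⟨n.xP, ?_⟩
  rintro _ ⟨α, hα, rfl⟩
  exact (xP_lt_top hα).le.trans (top_le_rightSol hα hx)

theorem tendsto_rightSol (ha : n.a < n.μ) {x : ℝ} (hx : x ∈ Ioc n.xP n.xE) :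
    Tendsto (fun α => n.rightSol α x) (𝓝[>] n.xP) (𝓝 (n.singSol x)) := by
  have hne : (Ioo n.xP n.xN).Nonempty := nonempty_Ioo.2 (xP_lt_xN ha)
  have := (monotoneOn_rightSol hx).tendsto_nhdsWithin_Ioo_right hne
    (bddBelow_rightSol hx)
  rwa [singSol, if_neg (by rw [not_or, not_le, not_le]; exact ⟨hx.1, ha⟩)]

/-- Grönwall compares the family with the solution through the limit value at `s`. The two have the
same limit at every `x`, so the pointwise limit is a solution. -/
theorem isClampSol_singSol (ha : n.a < n.μ) {s : ℝ} (hs : s ∈ Ioc n.xP n.xE) :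
    n.IsClampSol n.bot n.top s n.xE n.singSol := by
  obtain ⟨h, h0, hh⟩ := (isStrip_right hs.1).exists_sol hs.2 (n.singSol s)
  obtain ⟨C, hC0, hC⟩ := (isStrip_right hs.1).exists_gronwall
  have heq : ∀ x ∈ Icc s n.xE, n.singSol x = h x := by
    intro x hx
    refine tendsto_nhds_unique (tendsto_rightSol ha ⟨hs.1.trans_le hx.1, hx.2⟩) ?_
    rw [tendsto_iff_dist_tendsto_zero]
    have hlim : Tendsto (fun α => C * |n.rightSol α s - n.singSol s|) (𝓝[>] n.xP) (𝓝 0) := by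
      simpa using (((tendsto_rightSol ha hs).sub_const (n.singSol s)).abs).const_mul C
    refine squeeze_zero' (Eventually.of_forall fun _ => dist_nonneg) ?_ hlim
    filter_upwards [Ioo_mem_nhdsGT (xP_lt_xN ha)] with α hα
    have := hC s n.xE le_rfl le_rfl _ _ (isClampSol_rightSol hα hs.1) hh x hx
    rwa [h0] at this
  intro x hx
  rw [heq x hx]
  exact (hh x hx).congr_of_mem heq hx

theorem xP_le_singSol (ha : n.a < n.μ) {x : ℝ} (hx : x ∈ Ioc n.xP n.xE) : n.xP ≤ n.singSol x := by
  refine ge_of_tendsto (tendsto_rightSol ha hx) ?_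
  filter_upwards [Ioo_mem_nhdsGT (xP_lt_xN ha)] with α hα
  exact (xP_lt_top hα).le.trans (top_le_rightSol hα hx)

/-- Near the singular point, `singSol` stays in the region `0 ≤ P`. -/
theorem P_singSol_nonneg (ha : n.a < n.μ) {x : ℝ} (hx : n.xP < x) (hxN : x < n.xN)
    (hx' : n.a * x < n.μ * n.xP) : 0 ≤ n.P x (n.singSol x) := by
  have hxE : x ∈ Ioc n.xP n.xE := ⟨hx, (hxN.trans n.xN_lt_xE).le⟩
  have hlim : Tendsto (fun α => n.P x (n.rightSol α x)) (𝓝[>] n.xP) (𝓝 (n.P x (n.singSol x))) :=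
    ((n.continuous_P.comp (Continuous.prodMk_right x)).tendsto _).comp (tendsto_rightSol ha hxE)
  refine ge_of_tendsto hlim ?_
  filter_upwards [Ioo_mem_nhdsGT hx] with α hα
  have hα' : α ∈ Ioo n.xP n.xN := ⟨hα.1, hα.2.trans hxN⟩
  have hα0 : 0 < α := n.xP_pos.trans hα.1
  refine (P_pos_right hα.1 (isClampSol_rightSol hα' hα.1) ?_ ⟨hα.2, hxE.2⟩ ?_).le
  · rw [rightSol_of_le hα' le_rfl, P_top]
    exact (disc_nonneg_iff hα0).2 (hα'.2.trans n.xN_lt_xE).le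
  · have h1 := (xP_lt_top hα').trans_le (top_le_rightSol hα' hxE)
    have := mul_lt_mul_of_pos_left h1 n.μ_pos
    linarith

/-- The right-hand side of the domain on which `singSol` behaves as just stated. -/
theorem exists_near (ha : n.a < n.μ) : ∃ t, n.xP < t ∧ t < n.xN ∧
    ∀ x ∈ Ioo n.xP t, n.a * x < n.μ * n.xP := by
  have h1 : n.xP < n.μ * n.xP / n.a := by
    rw [lt_div_iff₀ n.a_pos, mul_comm]
    exact mul_lt_mul_of_pos_right ha n.xP_pos
  obtain ⟨t, ht1, ht2⟩ := exists_between (lt_min (xP_lt_xN ha) h1)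
  refine ⟨t, ht1, ht2.trans_le (min_le_left _ _), fun x hx => ?_⟩
  have := (hx.2.trans ht2).trans_le (min_le_right _ _)
  rw [lt_div_iff₀ n.a_pos] at this
  linarith

/-- Near the singular point `singSol` is squeezed between the constant `xP` and the upper branch. -/
theorem tendsto_singSol (ha : n.a < n.μ) : Tendsto n.singSol (𝓝[>] n.xP) (𝓝 n.xP) := by
  obtain ⟨t, ht, htN, hn⟩ := n.exists_near ha
  have h1 : Tendsto n.top (𝓝[>] n.xP) (𝓝 n.xP) := by
    have := (n.continuous_top.tendsto n.xP).mono_left (nhdsWithin_le_nhds (s := Ioi n.xP))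
    rwa [top_xP] at this
  refine tendsto_of_tendsto_of_tendsto_of_le_of_le' tendsto_const_nhds h1 ?_ ?_
  · filter_upwards [Ioo_mem_nhdsGT ht] with x hx
    exact xP_le_singSol ha ⟨hx.1, ((hx.2.trans htN).trans n.xN_lt_xE).le⟩
  · filter_upwards [Ioo_mem_nhdsGT ht] with x hx
    have h2 := P_singSol_nonneg ha hx.1 (hx.2.trans htN) (hn x hx)
    exact ((P_nonneg_iff (disc_nonneg_of_P_nonneg h2)).1 h2).2

/-- The solution started on the upper branch at `α ∈ [xP, xN)`. -/
def rightFam (n : Reduced) (α : ℝ) : ℝ → ℝ := if α = n.xP then n.singSol else n.rightSol α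

theorem rightFam_xP : n.rightFam n.xP = n.singSol := if_pos rfl

theorem rightFam_of_lt {α : ℝ} (hα : n.xP < α) : n.rightFam α = n.rightSol α := if_neg hα.ne'

theorem rightFam_of_le {α x : ℝ} (hα : α ∈ Ico n.xP n.xN) (hx : x ≤ α) :
    n.rightFam α x = n.top α := by
  rcases hα.1.eq_or_lt with h | h
  · rw [← h, rightFam_xP, singSol, if_pos (Or.inl (h ▸ hx)), top_xP]
  · rw [rightFam_of_lt h, rightSol_of_le ⟨h, hα.2⟩ hx]

theorem isClampSol_rightFam {α s : ℝ} (hα : α ∈ Ico n.xP n.xN) (hs : s ∈ Ioc n.xP n.xE) :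
    n.IsClampSol n.bot n.top s n.xE (n.rightFam α) := by
  rcases hα.1.eq_or_lt with h | h
  · rw [← h, rightFam_xP]
    exact isClampSol_singSol ((not_le.1 fun hn => by
      have := xN_eq_xP (n.a_le.antisymm hn)
      rw [this, h] at hα
      exact lt_irrefl _ hα.2)) hs
  · rw [rightFam_of_lt h]
    exact isClampSol_rightSol ⟨h, hα.2⟩ hs.1

theorem lt_of_mem_Ico {α : ℝ} (hα : α ∈ Ico n.xP n.xN) : n.a < n.μ := by
  by_contra hn
  have := xN_eq_xP (n.a_le.antisymm (not_lt.1 hn))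
  rw [this] at hα
  exact lt_irrefl _ (hα.1.trans_lt hα.2)

/-- The right end-point of the solution. -/
def exit (n : Reduced) (α : ℝ) : ℝ := n.xRight (n.rightFam α n.xE)

theorem continuousOn_rightFam {α : ℝ} (hα : α ∈ Ico n.xP n.xN) :
    ContinuousOn (n.rightFam α) (Icc α n.xE) := by
  intro x hx
  rcases hx.1.eq_or_lt with h | h
  · rcases hα.1.eq_or_lt with h1 | h1
    · subst h1 h
      refine (continuousWithinAt_Ioi_iff_Ici.1 ?_).mono fun y hy => hy.1
      rw [ContinuousWithinAt, rightFam_xP, singSol_xP]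
      exact tendsto_singSol (lt_of_mem_Ico hα)
    · exact (isClampSol_rightFam hα ⟨h1, hx.1.trans hx.2⟩).continuousOn x hx
  · obtain ⟨s, hs1, hs2⟩ := exists_between h
    have := (isClampSol_rightFam hα ⟨hα.1.trans_lt hs1, hs2.le.trans hx.2⟩).continuousOn x
      ⟨hs2.le, hx.2⟩
    refine this.mono_of_mem_nhdsWithin ?_
    exact mem_nhdsWithin.2 ⟨Ioi s, isOpen_Ioi, hs2, fun y hy => ⟨hy.1.le, hy.2.2⟩⟩

/-- `exists_exit` needs a start strictly right of `xP`, so for `α = xP` it is applied to starts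
arbitrarily close to `α`. All the resulting exits are the same point. -/
theorem exit_spec {α : ℝ} (hα : α ∈ Ico n.xP n.xN) :
    n.exit α ∈ Ioc α n.xE ∧ (∀ x ∈ Ioo α (n.exit α), 0 < n.P x (n.rightFam α x)) ∧
      n.P (n.exit α) (n.rightFam α (n.exit α)) = 0 ∧
      n.μ * n.rightFam α (n.exit α) < n.a * n.exit α ∧
      (∀ x ∈ Icc (n.exit α) n.xE, n.rightFam α x = n.rightFam α (n.exit α)) ∧
      ∀ x ∈ Ioc (n.exit α) n.xE, n.P x (n.rightFam α x) < 0 := by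
  have ha := lt_of_mem_Ico hα
  -- starting points arbitrarily close to `α`
  have hstart : ∀ y > α, ∃ s ∈ Ico α y, n.xP < s ∧ s < n.xE ∧ 0 ≤ n.P s (n.rightFam α s) ∧
      n.a * s < n.μ * n.rightFam α s := by
    intro y hy
    rcases hα.1.eq_or_lt with h | h
    · obtain ⟨t, ht, htN, hn⟩ := n.exists_near ha
      subst h
      obtain ⟨s, hs1, hs2⟩ := exists_between (lt_min ht hy)
      have hst := hs2.trans_le (min_le_left _ _)
      have hsy := hs2.trans_le (min_le_right _ _)
      have hsN := hst.trans htN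
      have hsE := hsN.trans n.xN_lt_xE
      refine ⟨s, ⟨hs1.le, hsy⟩, hs1, hsE, ?_, ?_⟩
      · rw [rightFam_xP]
        exact P_singSol_nonneg ha hs1 hsN (hn s ⟨hs1, hst⟩)
      · rw [rightFam_xP]
        have := mul_le_mul_of_nonneg_left (xP_le_singSol ha ⟨hs1, hsE.le⟩) n.μ_pos.le
        linarith [hn s ⟨hs1, hst⟩]
    · refine ⟨α, ⟨le_rfl, hy⟩, h, hα.2.trans n.xN_lt_xE, ?_, ?_⟩
      · rw [rightFam_of_le hα le_rfl, P_top]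
        exact (disc_nonneg_iff (n.xP_pos.trans h)).2 (hα.2.trans n.xN_lt_xE).le
      · rw [rightFam_of_le hα le_rfl]
        exact top_gt hα.2
  have hex : ∀ y > α, ∃ s ∈ Ico α y, ∃ b ∈ Ioc s n.xE,
      (∀ x ∈ Ioo s b, 0 < n.P x (n.rightFam α x)) ∧
      n.P b (n.rightFam α b) = 0 ∧ n.μ * n.rightFam α b < n.a * b ∧
      (∀ x ∈ Icc b n.xE, n.rightFam α x = n.rightFam α b) ∧
      ∀ x ∈ Ioc b n.xE, n.P x (n.rightFam α x) < 0 := by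
    intro y hy
    obtain ⟨s, hs, hsP, hsE, h0, hY⟩ := hstart y hy
    obtain ⟨b, hb, h⟩ := exists_exit hsP hsE (isClampSol_rightFam hα ⟨hsP, hsE.le⟩) h0 hY
    exact ⟨s, hs, b, hb, h⟩
  -- After the exit the solution is constant, so the exit height is the value at `xE` and does not
  -- depend on the auxiliary start.
  have hbx : ∀ b ≤ n.xE, n.P b (n.rightFam α b) = 0 → n.μ * n.rightFam α b < n.a * b →
      (∀ x ∈ Icc b n.xE, n.rightFam α x = n.rightFam α b) → b = n.exit α := by
    intro b hb h0 hY hc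
    rw [exit, hc n.xE ⟨hb, le_rfl⟩]
    exact eq_xRight h0 hY.le
  obtain ⟨s, hs, b, hb, -, h0, hY, hc, hn⟩ := hex (α + 1) (by linarith)
  have hbe := hbx b hb.2 h0 hY hc
  rw [← hbe]
  refine ⟨⟨hs.1.trans_lt hb.1, hb.2⟩, fun x hx => ?_, h0, hY, hc, hn⟩
  obtain ⟨s', hs', b', hb', h0', h1', hY', hc', -⟩ := hex x hx.1
  have hbe' := hbx b' hb'.2 h1' hY' hc'
  rw [← hbe] at hbe'
  rw [hbe'] at h0'
  exact h0' x ⟨hs'.2, hx.2⟩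

theorem hasDerivAt_rightFam {α x : ℝ} (hα : α ∈ Ico n.xP n.xN) (hx : x ∈ Ioo α (n.exit α)) :
    HasDerivAt (n.rightFam α) (n.slope x (n.rightFam α x)) x := by
  have h := exit_spec hα
  obtain ⟨s, hs1, hs2⟩ := exists_between hx.1
  have hxE : x < n.xE := hx.2.trans_le h.1.2
  have := (isClampSol_rightFam hα ⟨hα.1.trans_lt hs1, (hs2.trans hxE).le⟩).hasDerivAt ⟨hs2, hxE⟩
  rwa [clampSlope_of_nonneg (h.2.1 x hx).le] at this

/-- Since `exit` is read off from the value at `xE`, convergence of the family at that one abscissa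
suffices. -/
theorem tendsto_exit (ha : n.a < n.μ) :
    Tendsto n.exit (𝓝[>] n.xP) (𝓝 (n.exit n.xP)) := by
  have h := (n.continuous_xRight.tendsto _).comp
    (tendsto_rightSol ha ⟨n.xP_lt_xE, le_rfl⟩)
  rw [← rightFam_xP] at h
  refine h.congr' ?_
  filter_upwards [self_mem_nhdsWithin] with α hα
  rw [exit, rightFam_of_lt hα]
  rfl

end Reduced
end
end ShadowODE

namespace ShadowODE
noncomputable section
namespace Reduced

variable {n : Reduced}

/-! ### Left of the singular point -/

/-- The positive root of `J x · = 0`. -/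
def rootJ (n : Reduced) (x : ℝ) : ℝ :=
  (2 * (1 - n.p) * (1 + n.μ * x) - n.a * x
    + Real.sqrt ((n.a * x - 2 * (1 - n.p) * (1 + n.μ * x)) ^ 2
      + 8 * (1 - n.p) * n.e * n.p * n.a * x ^ 2)) / (4 * (1 - n.p) * n.e)

theorem continuous_rootJ : Continuous n.rootJ := by unfold rootJ; fun_prop

theorem one_sub_p_pos (n : Reduced) : 0 < 1 - n.p := by linarith [n.p_lt]

theorem J_eq (x w : ℝ) : 8 * (1 - n.p) * n.e * n.J x w =
    (4 * (1 - n.p) * n.e * w + (n.a * x - 2 * (1 - n.p) * (1 + n.μ * x))) ^ 2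
      - ((n.a * x - 2 * (1 - n.p) * (1 + n.μ * x)) ^ 2
        + 8 * (1 - n.p) * n.e * n.p * n.a * x ^ 2) := by
  rw [J, P]; ring

/-- The discriminant dominates the square of the linear coefficient, so the other root of `J` is not
positive and plays no role for `w > 0`. -/
theorem rootJ_le_iff {x w : ℝ} (hw : 0 < w) : n.rootJ x ≤ w ↔ 0 ≤ n.J x w := by
  have hb := n.one_sub_p_pos
  have he := n.e_pos
  have hp := n.p_pos
  have ha := n.a_pos
  have h1 := n.J_eq x w
  set B := n.a * x - 2 * (1 - n.p) * (1 + n.μ * x) with hB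
  set Dd := B ^ 2 + 8 * (1 - n.p) * n.e * n.p * n.a * x ^ 2 with hD
  have hsq : |B| ≤ Real.sqrt Dd := Real.abs_le_sqrt (by
    have : 0 ≤ 8 * (1 - n.p) * n.e * n.p * n.a * x ^ 2 := by positivity
    linarith)
  have hB' := abs_le.1 hsq
  have e1 : n.rootJ x = (-B + Real.sqrt Dd) / (4 * (1 - n.p) * n.e) := by
    rw [rootJ, hD, hB]; ring_nf
  have h8 : 0 < 8 * (1 - n.p) * n.e := by positivity
  have hw4 : 0 < 4 * (1 - n.p) * n.e * w := by positivity
  have hDs : Real.sqrt Dd ^ 2 = Dd := Real.sq_sqrt (by positivity)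
  have e2 : 0 ≤ n.J x w ↔ Real.sqrt Dd ^ 2 ≤ (4 * (1 - n.p) * n.e * w + B) ^ 2 := by
    rw [hDs]
    constructor
    · intro h
      have := mul_nonneg h8.le h
      linarith
    · intro h
      exact nonneg_of_mul_nonneg_right (show 0 ≤ 8 * (1 - n.p) * n.e * n.J x w by linarith) h8
  rw [e1, e2, div_le_iff₀ (by positivity)]
  constructor
  · intro h
    exact pow_le_pow_left₀ (Real.sqrt_nonneg _) (by linarith) 2
  · intro h
    by_contra hn
    push Not at hn
    have h3 : 4 * (1 - n.p) * n.e * w + B < Real.sqrt Dd := by linarith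
    exact absurd (sq_lt_sq' (by linarith) h3) (not_lt.2 h)

theorem rootJ_pos {x : ℝ} (hx : 0 < x) : 0 < n.rootJ x := by
  have hb := n.one_sub_p_pos
  have he := n.e_pos
  have hp := n.p_pos
  have ha := n.a_pos
  rw [rootJ]
  refine div_pos ?_ (by positivity)
  have h1 : 0 < 8 * (1 - n.p) * n.e * n.p * n.a * x ^ 2 := by positivity
  have h2 := Real.sqrt_lt_sqrt (sq_nonneg (n.a * x - 2 * (1 - n.p) * (1 + n.μ * x)))
    (lt_add_of_pos_right ((n.a * x - 2 * (1 - n.p) * (1 + n.μ * x)) ^ 2) h1)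
  rw [Real.sqrt_sq_eq_abs] at h2
  linarith [le_abs_self (n.a * x - 2 * (1 - n.p) * (1 + n.μ * x))]

theorem J_rootJ {x : ℝ} (hx : 0 < x) : n.J x (n.rootJ x) = 0 := by
  refine le_antisymm ?_ ((rootJ_le_iff (rootJ_pos hx)).1 le_rfl)
  by_contra hn
  push Not at hn
  have hc : Continuous fun w => n.J x w := by unfold J P; fun_prop
  have h1 : ∀ᶠ w in 𝓝[<] n.rootJ x, 0 < n.J x w :=
    (hc.continuousAt.eventually (lt_mem_nhds hn)).filter_mono nhdsWithin_le_nhds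
  obtain ⟨w, hw, hw'⟩ := (h1.and (Ioo_mem_nhdsLT (rootJ_pos hx))).exists
  exact absurd ((rootJ_le_iff hw'.1).2 hw.le) (not_le.2 hw'.2)

theorem J_xP : n.J n.xP n.xP = 0 := by rw [J, P_xP]; ring

/-- `xP` is a root of `J` there because `P` vanishes on it, and the product of the two roots is
negative, so there is only one positive root. -/
theorem rootJ_xP : n.rootJ n.xP = n.xP := by
  have hx := n.xP_pos
  refine le_antisymm ((rootJ_le_iff hx).2 n.J_xP.ge) ?_
  by_contra hn
  push Not at hn
  have h1 := n.J_eq n.xP n.xP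
  have h2 := n.J_eq n.xP (n.rootJ n.xP)
  rw [J_xP, mul_zero] at h1
  rw [J_rootJ hx, mul_zero] at h2
  have hr := rootJ_pos (n := n) hx
  have hb := n.one_sub_p_pos
  have he := n.e_pos
  have hp := n.p_pos
  have ha := n.a_pos
  -- both are positive roots
  have h3 : (n.xP - n.rootJ n.xP) * (4 * (1 - n.p) * n.e * (n.xP + n.rootJ n.xP)
      + 2 * (n.a * n.xP - 2 * (1 - n.p) * (1 + n.μ * n.xP))) = 0 := by
    have : (4 * (1 - n.p) * n.e) ≠ 0 := by positivity
    refine mul_left_cancel₀ this ?_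
    linear_combination h2 - h1
  have h4 := (mul_eq_zero.1 h3).resolve_left (by linarith)
  have h5 : 8 * (1 - n.p) * n.e * n.p * n.a * n.xP ^ 2 > 0 := by positivity
  have h6 : 0 < (4 * (1 - n.p) * n.e) ^ 2 * (n.xP * n.rootJ n.xP) := by positivity
  nlinarith

theorem lt_rootJ {x : ℝ} (hx : 0 < x) (h : x < n.xP) : x < n.rootJ x := by
  by_contra hn
  push Not at hn
  have h1 := (rootJ_le_iff hx).1 hn
  have h2 := P_diag_pos hx h
  have := mul_pos n.one_sub_p_pos h2
  rw [J, sub_self, mul_zero] at h1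
  linarith

theorem P_rootJ_pos {x : ℝ} (hx : 0 < x) (h : x < n.xP) : 0 < n.P x (n.rootJ x) := by
  have h1 := J_rootJ (n := n) hx
  have h2 := lt_rootJ hx h
  have h3 : 0 < n.a * x * (n.rootJ x - x) := mul_pos (mul_pos n.a_pos hx) (by linarith)
  rw [J] at h1
  exact pos_of_mul_pos_right (show 0 < (1 - n.p) * n.P x (n.rootJ x) by linarith)
    n.one_sub_p_pos.le

theorem mem_left_iff {x w : ℝ} (hx : 0 < x) (h : x < n.xP) :
    w ∈ Icc (n.rootJ x) (n.top x) ↔ 0 ≤ n.P x w ∧ 0 ≤ n.J x w := by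
  have hd : 0 ≤ n.disc x := (disc_nonneg_iff hx).2 (h.trans n.xP_lt_xE).le
  constructor
  · rintro ⟨h1, h2⟩
    have hb := (P_pos_iff.1 (P_rootJ_pos hx h)).1
    exact ⟨(P_nonneg_iff hd).2 ⟨hb.le.trans h1, h2⟩,
      (rootJ_le_iff ((rootJ_pos hx).trans_le h1)).1 h1⟩
  · rintro ⟨h1, h2⟩
    exact ⟨(rootJ_le_iff (pos_of_P_nonneg hx h1)).2 h2, ((P_nonneg_iff hd).1 h1).2⟩

theorem isStrip_left {s t : ℝ} (hs : 0 < s) (ht : t < n.xP) : n.IsStrip n.rootJ n.top s t := by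
  refine ⟨n.continuous_rootJ.continuousOn, n.continuous_top.continuousOn, fun x hx => ?_,
    fun x hx w hw => ?_⟩
  · have hx0 := hs.trans_le hx.1
    have hxP := hx.2.trans_lt ht
    exact (P_pos_iff.1 (P_rootJ_pos hx0 hxP)).2.le
  · have hx0 := hs.trans_le hx.1
    have hxP := hx.2.trans_lt ht
    have := (mem_left_iff hx0 hxP).1 hw
    exact Q_pos_of_lt_xP hx0 hxP this.1 this.2

/-- On the curve `J = 0` the ratio `r` satisfies `2 (1 - p) e r + (a - 2 (1 - p) μ) - p a / r = 2 (1
- p) / x`. The left side increases in `r` and the right side decreases in `x`. -/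
theorem ratio_rootJ {x y : ℝ} (hx : 0 < x) (hxy : x < y) : n.rootJ y / y ≤ n.rootJ x / x := by
  have hb := n.one_sub_p_pos
  have he := n.e_pos
  have hp := n.p_pos
  have ha := n.a_pos
  have hy := hx.trans hxy
  have eq : ∀ t, 0 < t → t * (2 * (1 - n.p) * n.e * (n.rootJ t / t) ^ 2
      + (n.a - 2 * (1 - n.p) * n.μ) * (n.rootJ t / t) - n.p * n.a)
        = 2 * (1 - n.p) * (n.rootJ t / t) := by
    intro t ht
    have h1 := J_rootJ (n := n) ht
    rw [J, P] at h1
    field_simp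
    linear_combination h1
  have e1 := eq x hx
  have e2 := eq y hy
  have r1 : 0 < n.rootJ x / x := div_pos (rootJ_pos hx) hx
  have r2 : 0 < n.rootJ y / y := div_pos (rootJ_pos hy) hy
  set r := n.rootJ x / x
  set q := n.rootJ y / y
  clear_value r q
  by_contra hn
  push Not at hn
  -- eliminate the linear terms
  have h1 : 2 * (1 - n.p) * r * q * (y - x)
      = -(x * y) * (q - r) * (2 * (1 - n.p) * n.e * r * q + n.p * n.a) := by
    linear_combination -(y * q) * e1 + x * r * e2
  have h2 : 0 < 2 * (1 - n.p) * r * q * (y - x) := by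
    have : 0 < y - x := by linarith
    positivity
  have h3 : 0 < (x * y) * (q - r) * (2 * (1 - n.p) * n.e * r * q + n.p * n.a) := by
    have : 0 < q - r := by linarith
    positivity
  linarith

variable {s t : ℝ} {h : ℝ → ℝ}

/-- The clamped solutions that start on the upper branch stay in the strip. -/
theorem mem_strip_left (hs : 0 < s) (ht : t < n.xP) (hh : n.IsClampSol n.rootJ n.top s t h)
    (h0 : h s = n.top s) {x : ℝ} (hx : x ∈ Icc s t) : h x ∈ Icc (n.rootJ x) (n.top x) := by
  have hS := isStrip_left hs ht
  have hx0 := hs.trans_le hx.1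
  have hxP := hx.2.trans_lt ht
  have hst : s ∈ Icc s t := ⟨le_rfl, hx.1.trans hx.2⟩
  constructor
  · by_contra hn
    push Not at hn
    obtain ⟨z, hz, hz0, hzn⟩ := exists_last_zero (f := fun x => h x - n.rootJ x) hx.1
      ((hh.continuousOn.mono (Icc_subset_Icc_right hx.2)).sub n.continuous_rootJ.continuousOn)
      (by rw [h0]; exact sub_nonneg.2 (hS.le s hst)) (by linarith)
    have hz00 := hs.trans_le hz.1
    -- Below the edge the clamped slope is that of the ray through the edge point, steeper than the
    -- ray through the solution. So `h x / x` would rise from the edge value at `z`, while the ratio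
    -- of the edge does not.
    have hm : StrictMonoOn (fun x => h x / x) (Icc z x) := by
      refine strictMonoOn_of_deriv_pos (convex_Icc _ _)
        ((hh.continuousOn.mono (Icc_subset_Icc hz.1 hx.2)).div continuousOn_id
          fun y hy => (hz00.trans_le hy.1).ne') fun y hy => ?_
      rw [interior_Icc] at hy
      have hy0 : 0 < y := hz00.trans hy.1
      have hyP : y < n.xP := hy.2.trans hxP
      have hd := (hh.hasDerivAt ⟨hz.1.trans_lt hy.1, hy.2.trans_le hx.2⟩).fun_div
        (hasDerivAt_id y) hy0.ne'
      simp only [id] at hd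
      rw [hd.deriv]
      have hlt := hzn y ⟨hy.1, hy.2.le⟩
      have hle := hS.le y ⟨hz.1.trans hy.1.le, hy.2.le.trans hx.2⟩
      have e : n.clampSlope n.rootJ n.top y (h y) = n.rootJ y / y := by
        rw [clampSlope, min_eq_left (by linarith), max_eq_left (by linarith), slope,
          div_eq_div_iff (hS.Q_pos y ⟨hz.1.trans hy.1.le, hy.2.le.trans hx.2⟩ _ ⟨le_rfl, hle⟩).ne'
            hy0.ne']
        have := n.key_ray y (n.rootJ y)
        rw [J_rootJ hy0] at this
        linarith
      rw [e]
      refine div_pos ?_ (by positivity)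
      rw [div_mul_cancel₀ _ hy0.ne', mul_one]
      linarith
    have h1 := hm (left_mem_Icc.2 hz.2.le) (right_mem_Icc.2 hz.2.le) hz.2
    have h2 := ratio_rootJ (n := n) hz00 hz.2
    have h3 : h x / x < n.rootJ x / x := div_lt_div_of_pos_right hn hx0
    have h4 : h z = n.rootJ z := by linarith
    simp only [h4] at h1
    linarith
  · by_contra hn
    push Not at hn
    obtain ⟨z, hz, hz0, hzn⟩ := exists_last_zero (f := fun x => n.top x - h x) hx.1
      (n.continuous_top.continuousOn.sub (hh.continuousOn.mono (Icc_subset_Icc_right hx.2)))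
      (by rw [h0, sub_self]) (by linarith)
    -- Above the upper edge the clamped solution is constant, but the edge increases and cannot fall
    -- below it.
    have hc : ContinuousOn (fun y => h y - h z) (Icc z x) :=
      (hh.continuousOn.mono (Icc_subset_Icc hz.1 hx.2)).sub continuousOn_const
    have hconst := eq_zero_of_linear_ode (c := fun _ => 0) hz.2.le hc continuousOn_const
      (fun y hy => by
        have hlt := hzn y ⟨hy.1, hy.2.le⟩
        have hy' : y ∈ Icc s t := ⟨hz.1.trans hy.1.le, hy.2.le.trans hx.2⟩
        have h1 := hh.hasDerivAt ⟨hz.1.trans_lt hy.1, hy.2.trans_le hx.2⟩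
        rw [clampSlope, min_eq_right (by linarith), max_eq_right (hS.le y hy'),
          slope_eq_zero (P_top ((disc_nonneg_iff (hs.trans_le hy'.1)).2
            ((hy'.2.trans_lt ht).trans n.xP_lt_xE).le))] at h1
        simpa using h1.sub_const (h z)) (sub_self _)
    have h1 := n.strictMonoOn_top ⟨(hs.trans_le hz.1).le, (hz.2.le.trans hxP.le).trans n.xP_le_xN⟩
      ⟨hx0.le, hxP.le.trans n.xP_le_xN⟩ hz.2
    linarith

theorem exists_leftSol {α t : ℝ} (hα : 0 < α) (hαt : α < t) (ht : t < n.xP) :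
    ∃ h : ℝ → ℝ, (∀ x ≤ α, h x = n.top α) ∧
      ∀ s, 0 < s → n.IsClampSol n.rootJ n.top s t h := by
  obtain ⟨h, h0, hh⟩ := (isStrip_left hα ht).exists_sol hαt.le (n.top α)
  set g : ℝ → ℝ := fun x => if x ≤ α then n.top α else h x with hg
  have hgl : ∀ x ≤ α, g x = n.top α := fun x hx => if_pos hx
  have hgr : ∀ x ∈ Icc α t, g x = h x := by
    intro x hx
    rcases hx.1.eq_or_lt with e | e
    · rw [← e, h0, hgl α le_rfl]
    · exact if_neg (not_le.2 e)
  refine ⟨g, hgl, fun s hs => ?_⟩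
  have left : ∀ x ∈ Icc s α, HasDerivWithinAt g (n.clampSlope n.rootJ n.top x (g x)) (Iic α) x := by
    intro x hx
    have hx0 : 0 < x := hs.trans_le hx.1
    have hxP : x < n.xP := (hx.2.trans_lt hαt).trans ht
    have e : n.clampSlope n.rootJ n.top x (g x) = 0 := by
      have h2 := n.strictMonoOn_top.monotoneOn ⟨hx0.le, hxP.le.trans n.xP_le_xN⟩
        ⟨hα.le, (hαt.trans ht).le.trans n.xP_le_xN⟩ hx.2
      rw [hgl x hx.2, clampSlope, min_eq_right h2,
        max_eq_right ((isStrip_left hs ht).le x ⟨hx.1, hx.2.trans hαt.le⟩)]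
      exact slope_eq_zero (P_top ((disc_nonneg_iff hx0).2 (hxP.trans n.xP_lt_xE).le))
    rw [e]
    exact (hasDerivWithinAt_const x (Iic α) (n.top α)).congr_of_mem (fun y hy => hgl y hy) hx.2
  have right : ∀ x ∈ Icc α t,
      HasDerivWithinAt g (n.clampSlope n.rootJ n.top x (g x)) (Icc α t) x := by
    intro x hx
    rw [hgr x hx]
    exact (hh x hx).congr_of_mem hgr hx
  intro x hx
  rcases lt_trichotomy x α with hxα | hxα | hxα
  · exact ((left x ⟨hx.1, hxα.le⟩).hasDerivAt (Iic_mem_nhds hxα)).hasDerivWithinAt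
  · have h1 := (left x ⟨hx.1, hxα.le⟩).union (right x ⟨hxα.ge, hx.2⟩)
    refine h1.mono fun y hy => ?_
    rcases le_total y α with h2 | h2
    · exact Or.inl h2
    · exact Or.inr ⟨h2, hy.2⟩
  · refine (right x ⟨hxα.le, hx.2⟩).mono_of_mem_nhdsWithin ?_
    exact mem_nhdsWithin.2 ⟨Ioi α, isOpen_Ioi, hxα, fun y hy => ⟨hy.1.le, hy.2.2⟩⟩

open Classical in
/-- The chosen solution started on the upper branch at `α`, up to `t < xP`. -/
def leftAux (n : Reduced) (α t : ℝ) : ℝ → ℝ :=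
  if h : 0 < α ∧ α < t ∧ t < n.xP then (exists_leftSol h.1 h.2.1 h.2.2).choose else fun _ => 0

theorem leftAux_of_le {α t x : ℝ} (hα : 0 < α) (hαt : α < t) (ht : t < n.xP) (hx : x ≤ α) :
    n.leftAux α t x = n.top α := by
  rw [leftAux, dif_pos ⟨hα, hαt, ht⟩]
  exact (exists_leftSol hα hαt ht).choose_spec.1 x hx

theorem isClampSol_leftAux {α t s : ℝ} (hα : 0 < α) (hαt : α < t) (ht : t < n.xP) (hs : 0 < s) :
    n.IsClampSol n.rootJ n.top s t (n.leftAux α t) := by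
  rw [leftAux, dif_pos ⟨hα, hαt, ht⟩]
  exact (exists_leftSol hα hαt ht).choose_spec.2 s hs

/-- The solution started on the upper branch at `α`, continued through the singular point. -/
def leftSol (n : Reduced) (α x : ℝ) : ℝ :=
  if x ≤ α then n.top α else if x < n.xP then n.leftAux α ((x + n.xP) / 2) x else n.singSol x

theorem leftSol_of_le {α x : ℝ} (hx : x ≤ α) : n.leftSol α x = n.top α := if_pos hx

theorem leftSol_of_xP_le {α x : ℝ} (hα : α < n.xP) (hx : n.xP ≤ x) :
    n.leftSol α x = n.singSol x := by
  rw [leftSol, if_neg (not_le.2 (hα.trans_le hx)), if_neg (not_lt.2 hx)]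

/-- The field is regular only up to some `t < xP`, so the solution is assembled from pieces.
Uniqueness makes the value independent of `t`; the midpoint in the definition is just one choice. -/
theorem leftSol_eq_leftAux {α t x : ℝ} (hα : 0 < α) (hαt : α < t) (ht : t < n.xP)
    (hx : x ≤ t) : n.leftSol α x = n.leftAux α t x := by
  rcases le_or_gt x α with h | h
  · rw [leftSol_of_le h, leftAux_of_le hα hαt ht h]
  have hxP := hx.trans_lt ht
  rw [leftSol, if_neg (not_le.2 h), if_pos hxP]
  set u := (x + n.xP) / 2
  have hxu : x < u := by simp only [u]; linarith
  have hu : u < n.xP := by simp only [u]; linarith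
  have hαu := h.trans hxu
  have hm : max u t < n.xP := max_lt hu ht
  refine (isStrip_left hα hm).unique (s' := α) (t' := x) le_rfl (hx.trans (le_max_right _ _))
    ((isClampSol_leftAux hα hαu hu hα).mono le_rfl hxu.le)
    ((isClampSol_leftAux hα hαt ht hα).mono le_rfl hx) ?_ (right_mem_Icc.2 h.le)
  rw [leftAux_of_le hα hαu hu le_rfl, leftAux_of_le hα hαt ht le_rfl]

theorem isClampSol_leftSol {α s t : ℝ} (hα : 0 < α) (hα' : α < n.xP) (hs : 0 < s)
    (ht : t < n.xP) : n.IsClampSol n.rootJ n.top s t (n.leftSol α) := by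
  obtain ⟨u, hu1, hu2⟩ := exists_between (max_lt hα' ht)
  have hαu := (le_max_left _ _).trans_lt hu1
  have htu := (le_max_right α t).trans_lt hu1
  have h1 := isClampSol_leftAux hα hαu hu2 hs
  have h2 : n.IsClampSol n.rootJ n.top s u (n.leftSol α) := fun x hx => by
    rw [leftSol_eq_leftAux hα hαu hu2 hx.2]
    exact (h1 x hx).congr_of_mem (fun y hy => leftSol_eq_leftAux hα hαu hu2 hy.2) hx
  exact h2.mono le_rfl htu.le

theorem leftSol_mem {α x : ℝ} (hα : 0 < α) (hx : x ∈ Ico α n.xP) :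
    n.leftSol α x ∈ Icc (n.rootJ x) (n.top x) :=
  mem_strip_left hα hx.2 (isClampSol_leftSol hα (hx.1.trans_lt hx.2) hα hx.2)
    (leftSol_of_le le_rfl) ⟨hx.1, le_rfl⟩

theorem leftSol_spec {α x : ℝ} (hα : 0 < α) (hx : x ∈ Ico α n.xP) :
    0 ≤ n.P x (n.leftSol α x) ∧ 0 ≤ n.J x (n.leftSol α x) :=
  (mem_left_iff (hα.trans_le hx.1) hx.2).1 (leftSol_mem hα hx)

theorem lt_leftSol {α x : ℝ} (hα : 0 < α) (hx : x ∈ Ico α n.xP) : x < n.leftSol α x :=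
  lt_of_lt_xP (hα.trans_le hx.1) hx.2 (leftSol_spec hα hx).1 (leftSol_spec hα hx).2

theorem Q_leftSol_pos {α x : ℝ} (hα : 0 < α) (hx : x ∈ Ico α n.xP) :
    0 < n.Q x (n.leftSol α x) :=
  Q_pos_of_lt_xP (hα.trans_le hx.1) hx.2 (leftSol_spec hα hx).1 (leftSol_spec hα hx).2

theorem hasDerivAt_leftSol {α x : ℝ} (hα : 0 < α) (hx : x ∈ Ioo α n.xP) :
    HasDerivAt (n.leftSol α) (n.slope x (n.leftSol α x)) x := by
  obtain ⟨t, ht1, ht2⟩ := exists_between hx.2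
  have := (isClampSol_leftSol hα (hx.1.trans hx.2) hα ht2).hasDerivAt ⟨hx.1, ht1⟩
  rwa [clampSlope_of_mem (leftSol_mem hα ⟨hx.1.le, hx.2⟩)] at this

/-- The source is positive all the way to the singular point, because `a x ≤ μ x < μ h`. -/
theorem P_leftSol_pos {α x : ℝ} (hα : 0 < α) (hx : x ∈ Ioo α n.xP) :
    0 < n.P x (n.leftSol α x) := by
  have hsub : ∀ y ∈ Icc α x, y ∈ Ico α n.xP := fun y hy => ⟨hy.1, hy.2.trans_lt hx.2⟩
  have hc : ContinuousOn (n.leftSol α) (Icc α x) :=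
    (isClampSol_leftSol hα (hx.1.trans hx.2) hα hx.2).continuousOn
  refine pos_of_linear_ode (f := fun x => n.P x (n.leftSol α x)) hx.1
    (n.continuous_P.comp_continuousOn (continuousOn_id.prodMk hc))
    (continuousOn_P_coeff hc fun y hy => (Q_leftSol_pos hα (hsub y hy)).ne')
    (r := fun y => 2 * (n.μ * n.leftSol α y - n.a * y))
    (fun y hy => hasDerivAt_P_sol (hasDerivAt_leftSol hα ⟨hy.1, hy.2.trans hx.2⟩))
    (fun y hy => ?_) (leftSol_spec hα ⟨le_rfl, hx.1.trans hx.2⟩).1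
  have h1 := lt_leftSol hα ⟨hy.1.le, hy.2.trans hx.2⟩
  have h2 := mul_lt_mul_of_pos_left h1 n.μ_pos
  have h3 := mul_le_mul_of_nonneg_right n.a_le (hα.trans hy.1).le
  linarith

/-- The funnel closes: both of its edges pass through `(xP, xP)`. -/
theorem tendsto_leftSol {α : ℝ} (hα : α ∈ Ioo 0 n.xP) :
    Tendsto (n.leftSol α) (𝓝[<] n.xP) (𝓝 n.xP) := by
  have h1 : Tendsto n.top (𝓝[<] n.xP) (𝓝 n.xP) := by
    have := (n.continuous_top.tendsto n.xP).mono_left (nhdsWithin_le_nhds (s := Iio n.xP))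
    rwa [top_xP] at this
  have h2 : Tendsto n.rootJ (𝓝[<] n.xP) (𝓝 n.xP) := by
    have := (n.continuous_rootJ.tendsto n.xP).mono_left (nhdsWithin_le_nhds (s := Iio n.xP))
    rwa [rootJ_xP] at this
  refine tendsto_of_tendsto_of_tendsto_of_le_of_le' h2 h1 ?_ ?_
  · filter_upwards [Ioo_mem_nhdsLT hα.2] with x hx
    exact (leftSol_mem hα.1 ⟨hx.1.le, hx.2⟩).1
  · filter_upwards [Ioo_mem_nhdsLT hα.2] with x hx
    exact (leftSol_mem hα.1 ⟨hx.1.le, hx.2⟩).2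

theorem continuousAt_leftSol {α x : ℝ} (hα : α ∈ Ioo 0 n.xP) (hx : x ∈ Ioo 0 n.xP) :
    ContinuousAt (fun α => n.leftSol α x) α := by
  obtain ⟨s, hs1, hs2⟩ := exists_between (lt_min hα.1 hx.1)
  obtain ⟨t, ht1, ht2⟩ := exists_between (max_lt hα.2 hx.2)
  obtain ⟨C, hC0, hC⟩ := (isStrip_left hs1 ht2).exists_gronwall
  have hsα := hs2.trans_le (min_le_left _ _)
  have hsx := hs2.trans_le (min_le_right _ _)
  have hαt := (le_max_left _ _).trans_lt ht1
  have hxt := (le_max_right α x).trans_lt ht1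
  rw [ContinuousAt, tendsto_iff_dist_tendsto_zero]
  have hlim : Tendsto (fun α' => C * |n.top α' - n.top α|) (𝓝 α) (𝓝 0) := by
    have : Continuous fun α' => C * |n.top α' - n.top α| := by
      have := n.continuous_top
      fun_prop
    simpa using this.tendsto α
  refine squeeze_zero' (Eventually.of_forall fun _ => dist_nonneg) ?_ hlim
  filter_upwards [Ioo_mem_nhds hsα hαt] with α' hα'
  have := hC s t le_rfl le_rfl _ _
    (isClampSol_leftSol (hs1.trans hα'.1) (hα'.2.trans ht2) hs1 ht2)
    (isClampSol_leftSol hα.1 hα.2 hs1 ht2) x ⟨hsx.le, hxt.le⟩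
  rwa [leftSol_of_le hα'.1.le, leftSol_of_le hsα.le] at this

end Reduced
end
end ShadowODE

namespace ShadowODE
noncomputable section
namespace Reduced

variable (n : Reduced)

/-! ### The equation for the slope near the singular point -/

/-- The polynomial that governs the derivative of the slope `k` in terms of the ratio
`r = w / x`. -/
def Psi (r k : ℝ) : ℝ :=
  (n.p * r - k + (1 - n.p) * k * r) ^ 2
      * (k * (2 * n.e * r ^ 2 - n.a) - 2 * n.μ * r ^ 2 + 2 * n.a * r)
    - n.a * (n.p * r - k + (1 - n.p) * k * r) * k ^ 2 * (r - 1) ^ 2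
    + n.a * (1 - n.p) * r * k ^ 2 * (r - 1) ^ 2 * (1 - k)
    + n.a * r * k * (n.p * r - k + (1 - n.p) * k * r) * (r - 1) * (r - 1 + 2 * k - 2)

/-- The partial derivative of `Psi` in its first argument; `PsiK` is the one in the second. -/
def PsiR (r k : ℝ) : ℝ :=
  2 * (n.p * r - k + (1 - n.p) * k * r) * (n.p + (1 - n.p) * k)
      * (k * (2 * n.e * r ^ 2 - n.a) - 2 * n.μ * r ^ 2 + 2 * n.a * r)
    + (n.p * r - k + (1 - n.p) * k * r) ^ 2 * (4 * n.e * k * r - 4 * n.μ * r + 2 * n.a)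
    - n.a * (n.p + (1 - n.p) * k) * k ^ 2 * (r - 1) ^ 2
    - 2 * n.a * (n.p * r - k + (1 - n.p) * k * r) * k ^ 2 * (r - 1)
    + n.a * (1 - n.p) * k ^ 2 * (r - 1) ^ 2 * (1 - k)
    + 2 * n.a * (1 - n.p) * r * k ^ 2 * (r - 1) * (1 - k)
    + n.a * k * (n.p * r - k + (1 - n.p) * k * r) * (r - 1) * (r - 1 + 2 * k - 2)
    + n.a * r * k * (n.p + (1 - n.p) * k) * (r - 1) * (r - 1 + 2 * k - 2)
    + n.a * r * k * (n.p * r - k + (1 - n.p) * k * r) * (2 * (r - 1) + 2 * k - 2)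

def PsiK (r k : ℝ) : ℝ :=
  2 * (n.p * r - k + (1 - n.p) * k * r) * (-1 + (1 - n.p) * r)
      * (k * (2 * n.e * r ^ 2 - n.a) - 2 * n.μ * r ^ 2 + 2 * n.a * r)
    + (n.p * r - k + (1 - n.p) * k * r) ^ 2 * (2 * n.e * r ^ 2 - n.a)
    - n.a * (-1 + (1 - n.p) * r) * k ^ 2 * (r - 1) ^ 2
    - 2 * n.a * (n.p * r - k + (1 - n.p) * k * r) * k * (r - 1) ^ 2
    + n.a * (1 - n.p) * r * (r - 1) ^ 2 * (2 * k - 3 * k ^ 2)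
    + n.a * r * (n.p * r - k + (1 - n.p) * k * r) * (r - 1) * (r - 1 + 2 * k - 2)
    + n.a * r * k * (-1 + (1 - n.p) * r) * (r - 1) * (r - 1 + 2 * k - 2)
    + 2 * n.a * r * k * (n.p * r - k + (1 - n.p) * k * r) * (r - 1)

/-- The value of the second derivative at the singular point. -/
def curv : ℝ :=
  (1 - n.m) * (n.p * (4 * n.e * n.m - 4 * n.μ + 2 * n.a) - 2 * n.a * n.m)
    / (n.xP * (n.p * (2 * n.e - n.a)))

/-- The coefficient of the derivative of the slope. -/
def rho (x r : ℝ) : ℝ := n.p * n.a * r ^ 2 * (r - 1) ^ 2 * x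

variable {n}

theorem continuous_Psi : Continuous fun u : ℝ × ℝ => n.Psi u.1 u.2 := by unfold Psi; fun_prop
theorem continuous_PsiR : Continuous fun u : ℝ × ℝ => n.PsiR u.1 u.2 := by unfold PsiR; fun_prop
theorem continuous_PsiK : Continuous fun u : ℝ × ℝ => n.PsiK u.1 u.2 := by unfold PsiK; fun_prop

/-- The simple zero is the slope of the upper branch, the double zero the slope of the diagonal. The
signs on either side of `m` make levels near `m` barriers for the slope. -/
theorem Psi_one (k : ℝ) :
    n.Psi 1 k = n.p ^ 2 * (1 - k) ^ 2 * (2 * n.e - n.a) * (k - n.m) := by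
  have := n.m_mul
  rw [Psi]; linear_combination (n.p ^ 2 * (1 - k) ^ 2) * this

theorem PsiK_one : n.PsiK 1 n.m = n.p ^ 2 * (1 - n.m) ^ 2 * (2 * n.e - n.a) := by
  have := n.m_mul
  rw [PsiK]; linear_combination (-2 * n.p ^ 2 * (1 - n.m)) * this

theorem PsiR_one : n.PsiR 1 n.m = n.p * (1 - n.m) ^ 2 *
    (n.p * (4 * n.e * n.m - 4 * n.μ + 2 * n.a) - 2 * n.a * n.m) := by
  have := n.m_mul
  rw [PsiR]
  linear_combination (2 * n.p * (1 - n.m) * (n.p + (1 - n.p) * n.m)) * this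

theorem hasDerivAt_Psi {r k : ℝ → ℝ} {r' k' x : ℝ} (hr : HasDerivAt r r' x)
    (hk : HasDerivAt k k' x) :
    HasDerivAt (fun t => n.Psi (r t) (k t)) (n.PsiR (r x) (k x) * r' + n.PsiK (r x) (k x) * k') x := by
  have hD := ((hr.const_mul n.p).fun_sub hk).fun_add ((hk.const_mul (1 - n.p)).fun_mul hr)
  have hT := ((hk.fun_mul (((hr.fun_pow 2).const_mul (2 * n.e)).sub_const n.a)).fun_sub
    ((hr.fun_pow 2).const_mul (2 * n.μ))).fun_add (hr.const_mul (2 * n.a))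
  have hv := hr.sub_const 1
  have h1 := (hD.fun_pow 2).fun_mul hT
  have h2 := ((hD.const_mul n.a).fun_mul (hk.fun_pow 2)).fun_mul (hv.fun_pow 2)
  have h3 := (((hr.const_mul (n.a * (1 - n.p))).fun_mul (hk.fun_pow 2)).fun_mul
    (hv.fun_pow 2)).fun_mul (hk.const_sub 1)
  have h4 := ((((hr.const_mul n.a).fun_mul hk).fun_mul hD).fun_mul hv).fun_mul
    ((hv.fun_add (hk.const_mul 2)).sub_const 2)
  refine (((h1.fun_sub h2).fun_add h3).fun_add h4).congr_deriv ?_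
  simp only [PsiR, PsiK]
  push_cast
  ring

theorem hasDerivAt_Q {h : ℝ → ℝ} {d x : ℝ} (hh : HasDerivAt h d x) :
    HasDerivAt (fun t => n.Q t (h t))
      (2 + 2 * (n.μ - n.a) * x - (2 * n.e - n.a) * h x
        + x * (2 * (n.μ - n.a) - (2 * n.e - n.a) * d)
        - (1 - n.p) * (n.diffP x (h x) (h x) * d + 2 * (n.μ * h x - n.a * x))) x := by
  have hid : HasDerivAt (fun t : ℝ => t) 1 x := hasDerivAt_id' x
  have h1 := (hid.fun_mul (((hid.const_mul (2 * (n.μ - n.a))).const_add 2).fun_sub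
    (hh.const_mul (2 * n.e - n.a)))).fun_sub ((hasDerivAt_P (n := n) hh).const_mul (1 - n.p))
  refine h1.congr_deriv ?_
  ring

theorem hasDerivAt_ratio {h : ℝ → ℝ} {d x : ℝ} (hx : 0 < x) (hh : HasDerivAt h d x) :
    HasDerivAt (fun t => h t / t) ((d - h x / x) / x) x := by
  refine (hh.fun_div (hasDerivAt_id x) hx.ne').congr_deriv ?_
  simp only [id]
  field_simp

/-- The derivative of the slope along a solution. -/
theorem hasDerivAt_slope {h : ℝ → ℝ} {x : ℝ} (hx : 0 < x) (hw : 0 < h x) (hQ : n.Q x (h x) ≠ 0)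
    (hne : h x ≠ x) (hh : HasDerivAt h (n.slope x (h x)) x) :
    HasDerivAt (fun t => n.slope t (h t))
      (-n.Psi (h x / x) (n.slope x (h x)) / n.rho x (h x / x)) x := by
  have hp := n.p_pos
  have ha := n.a_pos
  have hP := hasDerivAt_P (n := n) hh
  have hQd := hasDerivAt_Q (n := n) hh
  refine ((hP.const_mul n.p).fun_div hQd hQ).congr_deriv ?_
  have hk : n.slope x (h x) * n.Q x (h x) = n.p * n.P x (h x) := by
    rw [slope]; field_simp
  have hkey := n.key x (h x)
  set w := h x
  set k := n.slope x w
  have hne' : w - x ≠ 0 := sub_ne_zero.2 hne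
  set P' := n.diffP x w w * k + 2 * (n.μ * w - n.a * x) with hP'
  set Q' := 2 + 2 * (n.μ - n.a) * x - (2 * n.e - n.a) * w
        + x * (2 * (n.μ - n.a) - (2 * n.e - n.a) * k) - (1 - n.p) * P' with hQ'
  set j := (n.p * P' * n.Q x w - n.p * n.P x w * Q') / n.Q x w ^ 2 with hj
  have e0 : j * n.Q x w = n.p * P' - k * Q' := by
    rw [hj]; field_simp
    linear_combination Q' * hk
  -- The identity `key`, differentiated along the solution.
  have keyD : k * (n.Q x w + (1 - n.p) * n.P x w) + w * (Q' + (1 - n.p) * P')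
      = n.P x w + x * P' + n.a * (w - x) ^ 2 + 2 * n.a * x * (w - x) * (k - 1) := by
    rw [hQ', hP']; simp only [Q, P, diffP]; ring
  set D := n.p * w - k * x + (1 - n.p) * k * w with hD
  have e1 : D * n.Q x w = n.p * n.a * x * (w - x) ^ 2 := by
    rw [hD]; linear_combination n.p * hkey + ((1 - n.p) * w - x) * hk
  have e2 : D * n.P x w = n.a * k * x * (w - x) ^ 2 := by
    rw [hD]; linear_combination k * hkey - w * hk
  have e3 : w * (j * n.Q x w) = P' * D + n.P x w * (n.p * k + (1 - n.p) * k ^ 2 - k)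
      - n.a * k * (w - x) ^ 2 - 2 * n.a * k * x * (w - x) * (k - 1) := by
    rw [hD]; linear_combination w * e0 - k * keyD + k * hk
  have e4 : w * P' = k * n.P x w + k * (n.a * x ^ 2 - 2 * n.e * w ^ 2) + 2 * n.μ * w ^ 2
      - 2 * n.a * x * w := by
    rw [hP']; simp only [P, diffP]; ring
  have e5 : j * (n.p * n.a * x * w ^ 2 * (w - x) ^ 2)
      = D ^ 2 * (k * (n.a * x ^ 2 - 2 * n.e * w ^ 2) + 2 * n.μ * w ^ 2 - 2 * n.a * x * w)
        + n.a * D * k ^ 2 * x * (w - x) ^ 2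
        + n.a * w * k * x * (w - x) ^ 2 * (n.p * k + (1 - n.p) * k ^ 2 - k)
        - w * D * (n.a * k * (w - x) ^ 2 + 2 * n.a * k * x * (w - x) * (k - 1)) := by
    linear_combination (-(j * w ^ 2)) * e1 + w * D * e3 + D ^ 2 * e4
      + (D * k + w * (n.p * k + (1 - n.p) * k ^ 2 - k)) * e2
  have hrho : n.rho x (w / x) ≠ 0 := by
    have : w / x - 1 ≠ 0 := by
      rw [div_sub_one hx.ne']; exact div_ne_zero hne' hx.ne'
    rw [rho]
    have h1 : w / x ≠ 0 := (div_pos hw hx).ne'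
    positivity
  rw [eq_div_iff hrho]
  have e6 : j * n.rho x (w / x) * x ^ 4 = j * (n.p * n.a * x * w ^ 2 * (w - x) ^ 2) := by
    rw [rho]; field_simp
  have e7 : -n.Psi (w / x) k * x ^ 4
      = D ^ 2 * (k * (n.a * x ^ 2 - 2 * n.e * w ^ 2) + 2 * n.μ * w ^ 2 - 2 * n.a * x * w)
        + n.a * D * k ^ 2 * x * (w - x) ^ 2
        + n.a * w * k * x * (w - x) ^ 2 * (n.p * k + (1 - n.p) * k ^ 2 - k)
        - w * D * (n.a * k * (w - x) ^ 2 + 2 * n.a * k * x * (w - x) * (k - 1)) := by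
    rw [Psi, hD]; field_simp; ring
  exact mul_right_cancel₀ (pow_ne_zero 4 hx.ne') (by rw [e6, e7, e5])

end Reduced
end
end ShadowODE

namespace ShadowODE
noncomputable section
namespace Reduced
variable {n : Reduced}

/-! ### Limits at the singular point -/

/-- Taylor expansion at the singular point: the linear part vanishes on the tangent of slope `m` to
the upper branch. -/
theorem P_expand (x w : ℝ) : n.P x w =
    n.xP * (2 * n.e - n.a) * (n.m * (x - n.xP) - (w - n.xP))
      + (2 * n.μ * (x - n.xP) * (w - n.xP) - 2 * n.e * (w - n.xP) ^ 2
        - n.a * (x - n.xP) ^ 2) := by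
  have h := n.m_mul
  have h1 := n.xP_mul
  rw [P]
  linear_combination (-(n.xP * (x - n.xP))) * h - w * h1

/-- The form is negative because `μ² < 2 e a`; hence `P` is negative everywhere above the tangent.
-/
theorem quad_nonpos (t ζ : ℝ) : 2 * n.μ * t * ζ - 2 * n.e * ζ ^ 2 - n.a * t ^ 2 ≤ 0 := by
  have h1 := n.gap_pos
  have h2 := n.a_pos
  have : n.a * (2 * n.μ * t * ζ - 2 * n.e * ζ ^ 2 - n.a * t ^ 2)
      = -(n.a * t - n.μ * ζ) ^ 2 - (2 * n.e * n.a - n.μ ^ 2) * ζ ^ 2 := by ring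
  have h3 : n.a * (2 * n.μ * t * ζ - 2 * n.e * ζ ^ 2 - n.a * t ^ 2) ≤ 0 := by
    rw [this]
    have := mul_nonneg h1.le (sq_nonneg ζ)
    nlinarith [sq_nonneg (n.a * t - n.μ * ζ)]
  exact nonpos_of_mul_nonpos_right h3 h2

theorem d_pos (n : Reduced) : 0 < n.xP * (2 * n.e - n.a) :=
  mul_pos n.xP_pos (by linarith [n.a_lt])

theorem P_neg_of {x w : ℝ} (h : n.m * (x - n.xP) < w - n.xP) : n.P x w < 0 := by
  rw [P_expand]
  have h1 := n.quad_nonpos (x - n.xP) (w - n.xP)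
  have h2 := mul_pos n.d_pos (sub_pos.2 h)
  linarith

/-- Clearly below the tangent, and close to the singular point, half of the linear part outweighs
the quadratic part. -/
theorem P_lower {c : ℝ} (hc : 0 < c) :
    ∃ ε > 0, ∀ x w : ℝ, |x - n.xP| < ε → |w - n.xP| ≤ 2 * |x - n.xP| →
      c * |x - n.xP| ≤ n.m * (x - n.xP) - (w - n.xP) →
      n.xP * (2 * n.e - n.a) * c / 2 * |x - n.xP| ≤ n.P x w := by
  have hd := n.d_pos
  have hμ := n.μ_pos
  have he := n.e_pos
  have ha := n.a_pos
  refine ⟨n.xP * (2 * n.e - n.a) * c / 2 / (4 * n.μ + 8 * n.e + n.a), by positivity, ?_⟩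
  intro x w hx hw h
  rw [P_expand]
  set d := n.xP * (2 * n.e - n.a)
  set t := x - n.xP
  set ζ := w - n.xP
  rw [lt_div_iff₀ (by positivity)] at hx
  have h1 : d * (c * |t|) ≤ d * (n.m * t - ζ) := mul_le_mul_of_nonneg_left h hd.le
  have h2 : ζ ^ 2 ≤ 4 * |t| ^ 2 := by
    rw [← sq_abs ζ]
    nlinarith [abs_nonneg ζ, abs_nonneg t]
  have h3 : -(2 * |t| ^ 2) ≤ t * ζ := by
    have := neg_abs_le (t * ζ)
    rw [abs_mul] at this
    nlinarith [abs_nonneg t]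
  have h4 : t ^ 2 = |t| ^ 2 := (sq_abs t).symm
  have h5 : (4 * n.μ + 8 * n.e + n.a) * |t| ^ 2 ≤ d * c / 2 * |t| := by
    nlinarith [abs_nonneg t]
  nlinarith

section crossing
variable {h : ℝ → ℝ} {a b : ℝ}

theorem tendsto_ratio {l : Filter ℝ} (hl : l ≤ 𝓝 n.xP) (hh : Tendsto h l (𝓝 n.xP)) :
    Tendsto (fun x => h x / x) l (𝓝 1) := by
  have := hh.div (tendsto_id.mono_left hl) n.xP_pos.ne'
  rwa [div_self n.xP_pos.ne'] at this

theorem eventually_Psi_pos {l : Filter ℝ} (hl : l ≤ 𝓝 n.xP) (hh : Tendsto h l (𝓝 n.xP))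
    {κ : ℝ} (hκ : n.m < κ) (hκ' : κ < 1) : ∀ᶠ x in l, 0 < n.Psi (h x / x) κ := by
  have h1 : Tendsto (fun x => n.Psi (h x / x) κ) l (𝓝 (n.Psi 1 κ)) :=
    ((n.continuous_Psi.comp (by fun_prop : Continuous fun r : ℝ => (r, κ))).tendsto 1).comp
      (tendsto_ratio hl hh)
  refine h1.eventually_const_lt ?_
  rw [Psi_one]
  have := n.p_pos
  have := n.a_lt
  have h3 : 0 < 1 - κ := by linarith
  have h4 : 0 < 2 * n.e - n.a := by linarith
  have h5 : 0 < κ - n.m := by linarith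
  positivity

theorem eventually_Psi_neg {l : Filter ℝ} (hl : l ≤ 𝓝 n.xP) (hh : Tendsto h l (𝓝 n.xP))
    {κ : ℝ} (hκ : κ < n.m) : ∀ᶠ x in l, n.Psi (h x / x) κ < 0 := by
  have h1 : Tendsto (fun x => n.Psi (h x / x) κ) l (𝓝 (n.Psi 1 κ)) :=
    ((n.continuous_Psi.comp (by fun_prop : Continuous fun r : ℝ => (r, κ))).tendsto 1).comp
      (tendsto_ratio hl hh)
  refine h1.eventually_lt_const ?_
  rw [Psi_one]
  have := n.p_pos
  have := n.a_lt
  have h3 : 0 < 1 - κ := by linarith [n.m_lt_one]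
  have h4 : 0 < 2 * n.e - n.a := by linarith
  have h5 : 0 < n.m - κ := by linarith
  have : 0 < n.p ^ 2 * (1 - κ) ^ 2 * (2 * n.e - n.a) * (n.m - κ) := by positivity
  linarith

theorem rho_pos {x w : ℝ} (hx : 0 < x) (hw : 0 < w) (hne : w ≠ x) : 0 < n.rho x (w / x) := by
  have := n.p_pos
  have := n.a_pos
  have h1 : w / x - 1 ≠ 0 := by
    rw [div_sub_one hx.ne']; exact div_ne_zero (sub_ne_zero.2 hne) hx.ne'
  rw [rho]; positivity

/-- A solution of the reduced equation on `(a, b)` off the diagonal with `0 < Q`. -/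
structure IsSol (n : Reduced) (a b : ℝ) (h : ℝ → ℝ) : Prop where
  pos : ∀ x ∈ Ioo a b, 0 < x
  P_pos : ∀ x ∈ Ioo a b, 0 < n.P x (h x)
  Q_pos : ∀ x ∈ Ioo a b, 0 < n.Q x (h x)
  ne : ∀ x ∈ Ioo a b, h x ≠ x
  sol : ∀ x ∈ Ioo a b, HasDerivAt h (n.slope x (h x)) x

theorem IsSol.mono {a' b' : ℝ} (hs : n.IsSol a b h) (ha : a ≤ a') (hb : b' ≤ b) :
    n.IsSol a' b' h := by
  have : Ioo a' b' ⊆ Ioo a b := Ioo_subset_Ioo ha hb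
  exact ⟨fun x hx => hs.pos x (this hx), fun x hx => hs.P_pos x (this hx),
    fun x hx => hs.Q_pos x (this hx), fun x hx => hs.ne x (this hx), fun x hx => hs.sol x (this hx)⟩

theorem IsSol.h_pos (hs : n.IsSol a b h) {x : ℝ} (hx : x ∈ Ioo a b) : 0 < h x :=
  pos_of_P_nonneg (hs.pos x hx) (hs.P_pos x hx).le

theorem IsSol.slope_pos (hs : n.IsSol a b h) {x : ℝ} (hx : x ∈ Ioo a b) :
    0 < n.slope x (h x) :=
  div_pos (mul_pos n.p_pos (hs.P_pos x hx)) (hs.Q_pos x hx)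

theorem IsSol.hasDerivAt_slope (hs : n.IsSol a b h) {x : ℝ} (hx : x ∈ Ioo a b) :
    HasDerivAt (fun t => n.slope t (h t))
      (-n.Psi (h x / x) (n.slope x (h x)) / n.rho x (h x / x)) x :=
  Reduced.hasDerivAt_slope (hs.pos x hx) (hs.h_pos hx) (hs.Q_pos x hx).ne' (hs.ne x hx) (hs.sol x hx)

/-- When the slope equals `κ`, its derivative `-Psi / ρ` is negative. -/
theorem IsSol.crossing_down (hs : n.IsSol a b h) {κ : ℝ}
    (hκ : ∀ x ∈ Ioo a b, 0 < n.Psi (h x / x) κ) {x y : ℝ} (hx : x ∈ Ioo a b) (hy : y ∈ Ioo a b)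
    (hxy : x < y) (hle : n.slope x (h x) ≤ κ) : n.slope y (h y) < κ := by
  have := neg_of_crossing (fun z hz => (hs.hasDerivAt_slope hz).sub_const κ) (fun z hz h0 => ?_)
    hx hy hxy (by linarith)
  · linarith
  · rw [sub_eq_zero.1 h0]
    exact div_neg_of_neg_of_pos (neg_neg_of_pos (hκ z hz))
      (rho_pos (hs.pos z hz) (hs.h_pos hz) (hs.ne z hz))

theorem IsSol.crossing_up (hs : n.IsSol a b h) {κ : ℝ}
    (hκ : ∀ x ∈ Ioo a b, n.Psi (h x / x) κ < 0) {x y : ℝ} (hx : x ∈ Ioo a b) (hy : y ∈ Ioo a b)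
    (hxy : x < y) (hle : κ ≤ n.slope x (h x)) : κ < n.slope y (h y) := by
  have := neg_of_crossing (fun z hz => (hs.hasDerivAt_slope hz).const_sub κ) (fun z hz h0 => ?_)
    hx hy hxy (by linarith)
  · linarith
  · rw [← sub_eq_zero.1 h0]
    exact neg_neg_of_pos (div_pos (neg_pos.2 (hκ z hz))
      (rho_pos (hs.pos z hz) (hs.h_pos hz) (hs.ne z hz)))

theorem IsSol.monotoneOn_sub (hs : n.IsSol a b h) {κ : ℝ}
    (hκ : ∀ x ∈ Ioo a b, κ ≤ n.slope x (h x)) : MonotoneOn (fun x => h x - κ * x) (Ioo a b) := by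
  have hd : ∀ x ∈ Ioo a b, HasDerivAt (fun x => h x - κ * x) (n.slope x (h x) - κ) x :=
    fun x hx => ((hs.sol x hx).fun_sub ((hasDerivAt_id' x).const_mul κ)).congr_deriv (by ring)
  refine monotoneOn_of_deriv_nonneg (convex_Ioo _ _)
    (fun x hx => (hd x hx).continuousAt.continuousWithinAt) (fun x hx => ?_) fun x hx => ?_
  · rw [interior_Ioo] at hx; exact (hd x hx).differentiableAt.differentiableWithinAt
  · rw [interior_Ioo] at hx; rw [(hd x hx).deriv]; linarith [hκ x hx]

theorem IsSol.antitoneOn_sub (hs : n.IsSol a b h) {κ : ℝ}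
    (hκ : ∀ x ∈ Ioo a b, n.slope x (h x) ≤ κ) : AntitoneOn (fun x => h x - κ * x) (Ioo a b) := by
  have hd : ∀ x ∈ Ioo a b, HasDerivAt (fun x => h x - κ * x) (n.slope x (h x) - κ) x :=
    fun x hx => ((hs.sol x hx).fun_sub ((hasDerivAt_id' x).const_mul κ)).congr_deriv (by ring)
  refine antitoneOn_of_deriv_nonpos (convex_Ioo _ _)
    (fun x hx => (hd x hx).continuousAt.continuousWithinAt) (fun x hx => ?_) fun x hx => ?_
  · rw [interior_Ioo] at hx; exact (hd x hx).differentiableAt.differentiableWithinAt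
  · rw [interior_Ioo] at hx; rw [(hd x hx).deriv]; linarith [hκ x hx]

theorem tendsto_sub_mul {l : Filter ℝ} (hl : l ≤ 𝓝 n.xP) (hh : Tendsto h l (𝓝 n.xP)) (κ : ℝ) :
    Tendsto (fun x => h x - κ * x) l (𝓝 (n.xP - κ * n.xP)) :=
  hh.sub ((tendsto_id.mono_left hl).const_mul κ)

/-! Bounds for a solution ending (`left`) or starting (`right`) at the singular point. -/

theorem IsSol.left_le (hs : n.IsSol a n.xP h) (hh : Tendsto h (𝓝[<] n.xP) (𝓝 n.xP)) {κ : ℝ}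
    (hκ : ∀ x ∈ Ioo a n.xP, κ ≤ n.slope x (h x)) {x : ℝ} (hx : x ∈ Ioo a n.xP) :
    h x - n.xP ≤ κ * (x - n.xP) := by
  have := ge_of_tendsto (tendsto_sub_mul nhdsWithin_le_nhds hh κ) (b := h x - κ * x) ?_
  · linarith
  · filter_upwards [Ioo_mem_nhdsLT hx.2] with y hy
    exact hs.monotoneOn_sub hκ hx ⟨hx.1.trans hy.1, hy.2⟩ hy.1.le

theorem IsSol.le_left (hs : n.IsSol a n.xP h) (hh : Tendsto h (𝓝[<] n.xP) (𝓝 n.xP)) {κ : ℝ}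
    (hκ : ∀ x ∈ Ioo a n.xP, n.slope x (h x) ≤ κ) {x : ℝ} (hx : x ∈ Ioo a n.xP) :
    κ * (x - n.xP) ≤ h x - n.xP := by
  have := le_of_tendsto (tendsto_sub_mul nhdsWithin_le_nhds hh κ) (b := h x - κ * x) ?_
  · linarith
  · filter_upwards [Ioo_mem_nhdsLT hx.2] with y hy
    exact hs.antitoneOn_sub hκ hx ⟨hx.1.trans hy.1, hy.2⟩ hy.1.le

theorem IsSol.right_le (hs : n.IsSol n.xP b h) (hh : Tendsto h (𝓝[>] n.xP) (𝓝 n.xP)) {κ : ℝ}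
    (hκ : ∀ x ∈ Ioo n.xP b, n.slope x (h x) ≤ κ) {x : ℝ} (hx : x ∈ Ioo n.xP b) :
    h x - n.xP ≤ κ * (x - n.xP) := by
  have := ge_of_tendsto (tendsto_sub_mul nhdsWithin_le_nhds hh κ) (b := h x - κ * x) ?_
  · linarith
  · filter_upwards [Ioo_mem_nhdsGT hx.1] with y hy
    exact hs.antitoneOn_sub hκ ⟨hy.1, hy.2.trans hx.2⟩ hx hy.2.le

theorem IsSol.le_right (hs : n.IsSol n.xP b h) (hh : Tendsto h (𝓝[>] n.xP) (𝓝 n.xP)) {κ : ℝ}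
    (hκ : ∀ x ∈ Ioo n.xP b, κ ≤ n.slope x (h x)) {x : ℝ} (hx : x ∈ Ioo n.xP b) :
    κ * (x - n.xP) ≤ h x - n.xP := by
  have := le_of_tendsto (tendsto_sub_mul nhdsWithin_le_nhds hh κ) (b := h x - κ * x) ?_
  · linarith
  · filter_upwards [Ioo_mem_nhdsGT hx.1] with y hy
    exact hs.monotoneOn_sub hκ ⟨hy.1, hy.2.trans hx.2⟩ hx hy.2.le

/-- Levels below `m` are crossed only upwards. If the slope stayed below `κ`, integration up to the
singular point would put the solution above the tangent, where `P < 0`. -/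
theorem IsSol.eventually_lt_slope_left (hs : n.IsSol a n.xP h) (hab : a < n.xP)
    (hh : Tendsto h (𝓝[<] n.xP) (𝓝 n.xP)) {κ : ℝ} (hκ : κ < n.m) :
    ∀ᶠ x in 𝓝[<] n.xP, κ < n.slope x (h x) := by
  obtain ⟨a', ha', hP⟩ := (mem_nhdsLT_iff_exists_Ioo_subset' hab).1
    ((eventually_Psi_neg nhdsWithin_le_nhds hh hκ).and (Ioo_mem_nhdsLT hab))
  have ha'' : a' < n.xP := ha'
  set c := max a a'
  have hc : c < n.xP := max_lt hab ha''
  have hs' := hs.mono (le_max_left a a') le_rfl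
  have hP' : ∀ x ∈ Ioo c n.xP, n.Psi (h x / x) κ < 0 := fun x hx =>
    (hP ⟨(le_max_right a a').trans_lt hx.1, hx.2⟩).1
  by_cases hex : ∃ x ∈ Ioo c n.xP, κ ≤ n.slope x (h x)
  · obtain ⟨x, hx, hle⟩ := hex
    filter_upwards [Ioo_mem_nhdsLT hx.2] with y hy
    exact hs'.crossing_up hP' hx ⟨hx.1.trans hy.1, hy.2⟩ hy.1 hle
  · exfalso
    push Not at hex
    obtain ⟨x, hx⟩ := exists_between hc
    have h1 := hs'.le_left hh (fun x hx => (hex x hx).le) hx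
    have h2 := hs'.P_pos x hx
    have : n.m * (x - n.xP) < h x - n.xP := by nlinarith [hx.2]
    linarith [P_neg_of this]

/-- Levels between `m` and `1` are crossed only downwards, so a slope at least `κ` would persist
back to the singular point and again put the solution above the tangent. -/
theorem IsSol.eventually_slope_lt_right (hs : n.IsSol n.xP b h) (hab : n.xP < b)
    (hh : Tendsto h (𝓝[>] n.xP) (𝓝 n.xP)) {κ : ℝ} (hκ : n.m < κ) (hκ' : κ < 1) :
    ∀ᶠ x in 𝓝[>] n.xP, n.slope x (h x) < κ := by
  obtain ⟨b', hb', hP⟩ := (mem_nhdsGT_iff_exists_Ioo_subset' hab).1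
    (eventually_Psi_pos nhdsWithin_le_nhds hh hκ hκ')
  have hb'' : n.xP < b' := hb'
  set c := min b b'
  have hc : n.xP < c := lt_min hab hb''
  have hs' := hs.mono le_rfl (min_le_left b b')
  have hP' : ∀ x ∈ Ioo n.xP c, 0 < n.Psi (h x / x) κ := fun x hx =>
    hP ⟨hx.1, hx.2.trans_le (min_le_right b b')⟩
  filter_upwards [Ioo_mem_nhdsGT hc] with y hy
  by_contra hcon
  push Not at hcon
  have hall : ∀ x ∈ Ioo n.xP y, κ ≤ n.slope x (h x) := fun x hx => by
    by_contra hlt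
    push Not at hlt
    have := hs'.crossing_down hP' ⟨hx.1, hx.2.trans hy.2⟩ hy hx.2 hlt.le
    linarith
  have hs'' := hs'.mono le_rfl hy.2.le
  obtain ⟨x, hx⟩ := exists_between hy.1
  have h1 := hs''.le_right hh hall hx
  have h2 := hs''.P_pos x hx
  have : n.m * (x - n.xP) < h x - n.xP := by nlinarith [hx.1]
  linarith [P_neg_of this]

/-- Here the tangent gives no contradiction: a slope above `κ > m` keeps the solution below it. But
then `P`, and by `key` also `Q`, is at least a multiple of `xP - x`, while `J` is at most such a
multiple. So `h / x - 1` decays at a bounded relative rate and cannot reach zero at `xP`. -/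
theorem IsSol.eventually_slope_lt_left (hs : n.IsSol a n.xP h) (hab : a < n.xP)
    (hJ : ∀ x ∈ Ioo a n.xP, 0 ≤ n.J x (h x))
    (hh : Tendsto h (𝓝[<] n.xP) (𝓝 n.xP)) {κ : ℝ} (hκ : n.m < κ) (hκ' : κ < 1) :
    ∀ᶠ x in 𝓝[<] n.xP, n.slope x (h x) < κ := by
  have hp := n.p_pos
  have hp1 := n.one_sub_p_pos
  have hA := n.a_pos
  have hxP := n.xP_pos
  have hd := n.d_pos
  have hm0 := n.m_nonneg
  have hid : Tendsto (fun x : ℝ => x) (𝓝[<] n.xP) (𝓝 n.xP) := nhdsWithin_le_nhds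
  obtain ⟨ε, hε, hlow⟩ := P_lower (n := n) (sub_pos.2 hκ)
  have hcoef : ∀ᶠ x in 𝓝[<] n.xP, n.p * n.xP / 2 < x - (1 - n.p) * h x := by
    have : Tendsto (fun x => x - (1 - n.p) * h x) (𝓝[<] n.xP) (𝓝 (n.xP - (1 - n.p) * n.xP)) :=
      hid.sub (hh.const_mul _)
    refine this.eventually_const_lt ?_
    nlinarith [mul_pos hp hxP]
  have hrat : ∀ᶠ x in 𝓝[<] n.xP, h x / x < 2 :=
    (tendsto_ratio nhdsWithin_le_nhds hh).eventually_lt_const (by norm_num)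
  have hnear : ∀ᶠ x in 𝓝[<] n.xP, n.xP - ε < x := hid.eventually_const_lt (by linarith)
  have hbd : ∀ᶠ x in 𝓝[<] n.xP, h x < 2 * n.xP := hh.eventually_lt_const (by linarith)
  have hbx : ∀ᶠ x in 𝓝[<] n.xP, n.xP / 2 < x := hid.eventually_const_lt (by linarith)
  obtain ⟨a', ha', hP⟩ := (mem_nhdsLT_iff_exists_Ioo_subset' hab).1
    ((eventually_Psi_pos nhdsWithin_le_nhds hh hκ hκ').and (hcoef.and (hrat.and (hnear.and
      (hbd.and hbx)))))
  have ha'' : a' < n.xP := ha'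
  set c := max a a'
  have hc : c < n.xP := max_lt hab ha''
  have hs' := hs.mono (le_max_left a a') le_rfl
  have hev : ∀ x ∈ Ioo c n.xP, 0 < n.Psi (h x / x) κ ∧ n.p * n.xP / 2 < x - (1 - n.p) * h x ∧
      h x / x < 2 ∧ n.xP - ε < x ∧ h x < 2 * n.xP ∧ n.xP / 2 < x := fun x hx =>
    hP ⟨(le_max_right a a').trans_lt hx.1, hx.2⟩
  by_cases hex : ∃ x ∈ Ioo c n.xP, n.slope x (h x) ≤ κ
  · obtain ⟨x, hx, hle⟩ := hex
    filter_upwards [Ioo_mem_nhdsLT hx.2] with y hy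
    exact hs'.crossing_down (fun x hx => (hev x hx).1) hx ⟨hx.1.trans hy.1, hy.2⟩ hy.1 hle
  · exfalso
    push Not at hex
    have hJ' : ∀ x ∈ Ioo c n.xP, 0 ≤ n.J x (h x) := fun x hx =>
      hJ x ⟨(le_max_left a a').trans_lt hx.1, hx.2⟩
    have hgt : ∀ x ∈ Ioo c n.xP, x < h x := fun x hx =>
      lt_of_lt_xP (hs'.pos x hx) hx.2 (hs'.P_pos x hx).le (hJ' x hx)
    have hray : ∀ x ∈ Ioo c n.xP, n.slope x (h x) - h x / x
        = -((h x / x - 1) * (n.J x (h x) / n.Q x (h x))) := fun x hx => by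
      have h1 := n.key_ray x (h x)
      have hx0 := hs'.pos x hx
      have hQ := hs'.Q_pos x hx
      rw [slope]
      field_simp
      linear_combination -h1
    -- A crude bound from the ray comparison. Integrated, it gives the condition `|w - xP| ≤ 2 |x -
    -- xP|` of `P_lower`.
    have hk2 : ∀ x ∈ Ioo c n.xP, n.slope x (h x) ≤ 2 := fun x hx => by
      have h1 := hray x hx
      have h2 : 0 ≤ (h x / x - 1) * (n.J x (h x) / n.Q x (h x)) := by
        refine mul_nonneg ?_ (div_nonneg (hJ' x hx) (hs'.Q_pos x hx).le)
        rw [sub_nonneg, one_le_div (hs'.pos x hx)]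
        exact (hgt x hx).le
      linarith [(hev x hx).2.2.1]
    -- the quotient `J / (x Q)` is bounded
    have hquot : ∃ C, 0 < C ∧ ∀ x ∈ Ioo c n.xP, n.J x (h x) ≤ C * (x * n.Q x (h x)) := by
      set c₀ := n.xP * (2 * n.e - n.a) * (κ - n.m) / 2 with hc₀
      have hc₀' : 0 < c₀ := by
        have : 0 < κ - n.m := by linarith
        positivity
      refine ⟨4 * n.a / (c₀ * n.p), by positivity, fun x hx => ?_⟩
      have hx0 := hs'.pos x hx
      obtain ⟨-, e2, -, e4, e5, e6⟩ := hev x hx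
      have hle := hs'.left_le hh (fun x hx => (hex x hx).le) hx
      have hge := hs'.le_left hh hk2 hx
      have ht : x - n.xP < 0 := by linarith [hx.2]
      have habs : |x - n.xP| = n.xP - x := by rw [abs_of_neg ht]; ring
      have hPl := hlow x (h x) (by rw [habs]; linarith) (by
        rw [habs, abs_le]; constructor
        · linarith
        · nlinarith) (by rw [habs]; nlinarith)
      rw [habs] at hPl
      have hJle : n.J x (h x) ≤ n.a * x * (n.xP - x) := by
        have h1 : n.J x (h x) ≤ n.a * x * (h x - x) := by
          rw [J]; nlinarith [mul_pos hp1 (hs'.P_pos x hx)]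
        have h2 : h x - x ≤ n.xP - x := by nlinarith
        exact h1.trans (mul_le_mul_of_nonneg_left h2 (by positivity))
      have hkey := n.key x (h x)
      have hw := hs'.h_pos hx
      have hQl : c₀ * (n.xP - x) * (n.p * n.xP / 2) ≤ h x * n.Q x (h x) := by
        have h1 : h x * n.Q x (h x)
          = n.P x (h x) * (x - (1 - n.p) * h x) + n.a * x * (h x - x) ^ 2 := by
          linear_combination hkey
        rw [h1]
        have h2 : 0 ≤ n.a * x * (h x - x) ^ 2 := by positivity
        have h3 : c₀ * (n.xP - x) * (n.p * n.xP / 2) ≤ n.P x (h x) * (x - (1 - n.p) * h x) :=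
          mul_le_mul hPl e2.le (by positivity) (hs'.P_pos x hx).le
        linarith
      have hQl' : c₀ * n.p * (n.xP - x) ≤ 4 * n.Q x (h x) := by
        have h1 : h x * n.Q x (h x) ≤ 2 * n.xP * n.Q x (h x) :=
          mul_le_mul_of_nonneg_right e5.le (hs'.Q_pos x hx).le
        have h2 : n.xP * (c₀ * n.p * (n.xP - x)) ≤ n.xP * (4 * n.Q x (h x)) := by nlinarith
        exact le_of_mul_le_mul_left h2 hxP
      rw [div_mul_eq_mul_div, le_div_iff₀ (by positivity)]
      calc n.J x (h x) * (c₀ * n.p) ≤ n.a * x * (n.xP - x) * (c₀ * n.p) := by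
            gcongr
        _ = n.a * x * (c₀ * n.p * (n.xP - x)) := by ring
        _ ≤ n.a * x * (4 * n.Q x (h x)) := by gcongr
        _ = 4 * n.a * (x * n.Q x (h x)) := by ring
    obtain ⟨C, hC, hq⟩ := hquot
    -- `(h / x - 1) exp (C x)` is monotone
    have hder : ∀ x ∈ Ioo c n.xP, HasDerivAt (fun x => (h x / x - 1) * Real.exp (C * x))
        (((n.slope x (h x) - h x / x) / x + C * (h x / x - 1)) * Real.exp (C * x)) x := fun x hx => by
      have h1 := (hasDerivAt_ratio (hs'.pos x hx) (hs'.sol x hx)).sub_const 1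
      have h2 := ((hasDerivAt_id' x).const_mul C).exp
      exact (h1.fun_mul h2).congr_deriv (by ring)
    have hmono : MonotoneOn (fun x => (h x / x - 1) * Real.exp (C * x)) (Ioo c n.xP) := by
      refine monotoneOn_of_deriv_nonneg (convex_Ioo _ _)
        (fun x hx => (hder x hx).continuousAt.continuousWithinAt) (fun x hx => ?_) fun x hx => ?_
      · rw [interior_Ioo] at hx; exact (hder x hx).differentiableAt.differentiableWithinAt
      · rw [interior_Ioo] at hx; rw [(hder x hx).deriv, hray x hx]
        refine mul_nonneg ?_ (Real.exp_pos _).le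
        have hx0 := hs'.pos x hx
        have hQ := hs'.Q_pos x hx
        have h1 : 0 ≤ h x / x - 1 := by
          rw [sub_nonneg, one_le_div hx0]; exact (hgt x hx).le
        have h2 : n.J x (h x) / n.Q x (h x) / x ≤ C := by
          rw [div_div, div_le_iff₀ (by positivity)]
          linarith [hq x hx]
        have h3 : -((h x / x - 1) * (n.J x (h x) / n.Q x (h x))) / x + C * (h x / x - 1)
            = (h x / x - 1) * (C - n.J x (h x) / n.Q x (h x) / x) := by ring
        rw [h3]
        exact mul_nonneg h1 (by linarith)
    obtain ⟨x, hx⟩ := exists_between hc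
    have hx1 : 0 < (h x / x - 1) * Real.exp (C * x) := by
      refine mul_pos ?_ (Real.exp_pos _)
      rw [sub_pos, one_lt_div (hs'.pos x hx)]; exact hgt x hx
    have hlim : Tendsto (fun x => (h x / x - 1) * Real.exp (C * x)) (𝓝[<] n.xP) (𝓝 0) := by
      have h1 := (tendsto_ratio nhdsWithin_le_nhds hh).sub_const 1
      have h2 : Tendsto (fun x => Real.exp (C * x)) (𝓝[<] n.xP) (𝓝 (Real.exp (C * n.xP))) :=
        ((by fun_prop : Continuous fun x => Real.exp (C * x)).tendsto _).comp hid
      simpa using h1.mul h2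
    have := ge_of_tendsto hlim (b := (h x / x - 1) * Real.exp (C * x)) (by
      filter_upwards [Ioo_mem_nhdsLT hx.2] with y hy
      exact hmono hx ⟨hx.1.trans hy.1, hy.2⟩ hy.1.le)
    linarith

/-- A slope at most `κ < m` back to the singular point keeps the solution below the tangent, so `P`
is at least linear in `x - xP`. Through `key`, the same slope bound forces `P` to be at most
quadratic. Negative `κ` are trivial because the slope is positive. -/
theorem IsSol.eventually_lt_slope_right (hs : n.IsSol n.xP b h) (hab : n.xP < b)
    (hh : Tendsto h (𝓝[>] n.xP) (𝓝 n.xP)) {κ : ℝ} (hκ : κ < n.m) :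
    ∀ᶠ x in 𝓝[>] n.xP, κ < n.slope x (h x) := by
  have hp := n.p_pos
  have hA := n.a_pos
  have hxP := n.xP_pos
  have hd := n.d_pos
  have hm1 := n.m_lt_one
  rcases lt_or_ge κ 0 with h0 | h0
  · filter_upwards [Ioo_mem_nhdsGT hab] with x hx
    exact h0.trans (hs.slope_pos hx)
  have hid : Tendsto (fun x : ℝ => x) (𝓝[>] n.xP) (𝓝 n.xP) := nhdsWithin_le_nhds
  obtain ⟨ε, hε, hlow⟩ := P_lower (n := n) (sub_pos.2 hκ)
  set c₁ := n.p * n.xP * (1 - κ) / 2 with hc₁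
  have hc₁' : 0 < c₁ := by
    have : 0 < 1 - κ := by linarith
    positivity
  have hcoef : ∀ᶠ x in 𝓝[>] n.xP, c₁ < n.p * h x - κ * (x - (1 - n.p) * h x) := by
    have : Tendsto (fun x => n.p * h x - κ * (x - (1 - n.p) * h x)) (𝓝[>] n.xP)
        (𝓝 (n.p * n.xP - κ * (n.xP - (1 - n.p) * n.xP))) :=
      (hh.const_mul _).sub ((hid.sub (hh.const_mul _)).const_mul _)
    refine this.eventually_const_lt ?_
    rw [hc₁]
    have : 0 < n.p * n.xP * (1 - κ) := mul_pos (mul_pos hp hxP) (by linarith)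
    nlinarith
  set c₀ := n.xP * (2 * n.e - n.a) * (n.m - κ) / 2 with hc₀
  have hc₀' : 0 < c₀ := by
    have : 0 < n.m - κ := by linarith
    positivity
  have hsmall : ∀ᶠ x in 𝓝[>] n.xP, n.a * x * (x - n.xP) < c₀ * c₁ := by
    have : Tendsto (fun x => n.a * x * (x - n.xP)) (𝓝[>] n.xP)
        (𝓝 (n.a * n.xP * (n.xP - n.xP))) := (hid.const_mul _).mul (hid.sub_const _)
    refine this.eventually_lt_const ?_
    rw [sub_self, mul_zero]; positivity
  have hnear : ∀ᶠ x in 𝓝[>] n.xP, x < n.xP + ε := hid.eventually_lt_const (by linarith)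
  obtain ⟨b', hb', hP⟩ := (mem_nhdsGT_iff_exists_Ioo_subset' hab).1
    ((eventually_Psi_neg nhdsWithin_le_nhds hh hκ).and (hcoef.and (hsmall.and hnear)))
  have hb'' : n.xP < b' := hb'
  set c := min b b'
  have hc : n.xP < c := lt_min hab hb''
  have hs' := hs.mono le_rfl (min_le_left b b')
  have hP' : ∀ x ∈ Ioo n.xP c, n.Psi (h x / x) κ < 0 ∧
      c₁ < n.p * h x - κ * (x - (1 - n.p) * h x) ∧ n.a * x * (x - n.xP) < c₀ * c₁ ∧
      x < n.xP + ε := fun x hx =>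
    hP ⟨hx.1, hx.2.trans_le (min_le_right b b')⟩
  filter_upwards [Ioo_mem_nhdsGT hc] with y hy
  by_contra hcon
  push Not at hcon
  have hall : ∀ x ∈ Ioo n.xP y, n.slope x (h x) ≤ κ := fun x hx => by
    by_contra hlt
    push Not at hlt
    have := hs'.crossing_up (fun x hx => (hP' x hx).1) ⟨hx.1, hx.2.trans hy.2⟩ hy hx.2 hlt.le
    linarith
  have hs'' := hs'.mono le_rfl hy.2.le
  obtain ⟨x, hx⟩ := exists_between hy.1
  have hx0 := hs''.pos x hx
  obtain ⟨-, e2, e3, e4⟩ := hP' x ⟨hx.1, hx.2.trans hy.2⟩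
  have hle := hs''.right_le hh hall hx
  have hge := hs''.le_right hh (fun x hx => (hs''.slope_pos hx).le) hx
  rw [zero_mul] at hge
  have ht : 0 < x - n.xP := by linarith [hx.1]
  have habs : |x - n.xP| = x - n.xP := abs_of_pos ht
  have hPl := hlow x (h x) (by rw [habs]; linarith) (by
    rw [habs, abs_of_nonneg hge]; nlinarith) (by rw [habs]; nlinarith)
  rw [habs] at hPl
  have hkey := n.key x (h x)
  have hQ := hs''.Q_pos x hx
  have hk := hall x hx
  rw [slope, div_le_iff₀ hQ] at hk
  have hw := hs''.h_pos hx
  have h1 : n.p * n.P x (h x) * h x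
      ≤ κ * (n.P x (h x) * (x - (1 - n.p) * h x) + n.a * x * (h x - x) ^ 2) := by
    have := mul_le_mul_of_nonneg_right hk hw.le
    have h2 : κ * n.Q x (h x) * h x
        = κ * (n.P x (h x) * (x - (1 - n.p) * h x) + n.a * x * (h x - x) ^ 2) := by
      linear_combination κ * hkey
    linarith
  have h2 : n.P x (h x) * (n.p * h x - κ * (x - (1 - n.p) * h x))
      ≤ n.a * x * (x - n.xP) ^ 2 := by
    have h3 : (h x - x) ^ 2 ≤ (x - n.xP) ^ 2 := by
      have : h x ≤ x := by nlinarith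
      apply sq_le_sq'
      · linarith
      · linarith
    have h4 : κ * (n.a * x * (h x - x) ^ 2) ≤ 1 * (n.a * x * (x - n.xP) ^ 2) := by
      have : κ ≤ 1 := by linarith
      gcongr
    linarith
  have h3 : c₀ * (x - n.xP) * c₁ ≤ n.P x (h x) * (n.p * h x - κ * (x - (1 - n.p) * h x)) :=
    mul_le_mul hPl e2.le hc₁'.le (hs''.P_pos x hx).le
  nlinarith

theorem tendsto_of_eventually {l : Filter ℝ} {f : ℝ → ℝ} {m u : ℝ} (hmu : m < u)
    (h1 : ∀ κ < m, ∀ᶠ x in l, κ < f x) (h2 : ∀ κ, m < κ → κ < u → ∀ᶠ x in l, f x < κ) :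
    Tendsto f l (𝓝 m) := by
  refine tendsto_order.2 ⟨h1, fun κ hκ => ?_⟩
  obtain ⟨v, hv, hv'⟩ := exists_between (lt_min hκ hmu)
  filter_upwards [h2 v hv (hv'.trans_le (min_le_right _ _))] with x hx
  exact hx.trans (hv'.trans_le (min_le_left _ _))

theorem IsSol.tendsto_slope_left (hs : n.IsSol a n.xP h) (hab : a < n.xP)
    (hJ : ∀ x ∈ Ioo a n.xP, 0 ≤ n.J x (h x)) (hh : Tendsto h (𝓝[<] n.xP) (𝓝 n.xP)) :
    Tendsto (fun x => n.slope x (h x)) (𝓝[<] n.xP) (𝓝 n.m) :=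
  tendsto_of_eventually n.m_lt_one (fun _ hκ => hs.eventually_lt_slope_left hab hh hκ)
    fun _ hκ hκ' => hs.eventually_slope_lt_left hab hJ hh hκ hκ'

theorem IsSol.tendsto_slope_right (hs : n.IsSol n.xP b h) (hab : n.xP < b)
    (hh : Tendsto h (𝓝[>] n.xP) (𝓝 n.xP)) :
    Tendsto (fun x => n.slope x (h x)) (𝓝[>] n.xP) (𝓝 n.m) :=
  tendsto_of_eventually n.m_lt_one (fun _ hκ => hs.eventually_lt_slope_right hab hh hκ)
    fun _ hκ hκ' => hs.eventually_slope_lt_right hab hh hκ hκ'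

/-- The derivative of the slope along a solution. -/
def slopeDeriv (n : Reduced) (x w : ℝ) : ℝ :=
  -n.Psi (w / x) (n.slope x w) / n.rho x (w / x)

theorem IsSol.hasDerivAt_rho (hs : n.IsSol a b h) {x : ℝ} (hx : x ∈ Ioo a b) :
    HasDerivAt (fun t => n.rho t (h t / t))
      (n.p * n.a * ((h x / x) ^ 2 * (h x / x - 1) ^ 2
        + 2 * (h x / x) * (h x / x - 1) * (2 * (h x / x) - 1) * (n.slope x (h x) - h x / x))) x := by
  have hx0 := hs.pos x hx
  have hr := hasDerivAt_ratio hx0 (hs.sol x hx)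
  refine ((((hr.fun_pow 2).const_mul (n.p * n.a)).fun_mul ((hr.sub_const 1).fun_pow 2)).fun_mul
    (hasDerivAt_id' x)).congr_deriv ?_
  set r := h x / x
  field_simp
  push_cast
  ring

/-- Differentiating `ρ j = -Psi(r, k)` gives an equation linear in `j = k'`, with `ρ' + PsiK` as the
damping coefficient. -/
theorem IsSol.exists_hasDerivAt_slopeDeriv (hs : n.IsSol a b h) {x : ℝ} (hx : x ∈ Ioo a b) :
    ∃ d, HasDerivAt (fun t => n.slopeDeriv t (h t)) d x ∧ n.rho x (h x / x) * d
      = -(n.PsiK (h x / x) (n.slope x (h x)) + n.p * n.a * ((h x / x) ^ 2 * (h x / x - 1) ^ 2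
        + 2 * (h x / x) * (h x / x - 1) * (2 * (h x / x) - 1) * (n.slope x (h x) - h x / x)))
          * n.slopeDeriv x (h x)
        + -(n.PsiR (h x / x) (n.slope x (h x)) * ((n.slope x (h x) - h x / x) / x)) := by
  have hx0 := hs.pos x hx
  have hr := hasDerivAt_ratio hx0 (hs.sol x hx)
  have hρ := hs.hasDerivAt_rho hx
  have hk := hs.hasDerivAt_slope hx
  have hρ0 := (rho_pos (n := n) hx0 (hs.h_pos hx) (hs.ne x hx)).ne'
  have hΨ := hasDerivAt_Psi (n := n) hr hk
  refine ⟨_, hΨ.fun_neg.fun_div hρ hρ0, ?_⟩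
  rw [slopeDeriv]
  field_simp
  ring

theorem curv_eq : -n.PsiR 1 n.m * ((n.m - 1) / n.xP) / n.PsiK 1 n.m = n.curv := by
  have h1 : 1 - n.m ≠ 0 := by linarith [n.m_lt_one]
  have h2 : 2 * n.e - n.a ≠ 0 := by linarith [n.a_lt]
  have hp := n.p_pos
  have hx := n.xP_pos
  rw [PsiR_one, PsiK_one, curv]
  field_simp
  ring

theorem PsiK_one_pos : 0 < n.PsiK 1 n.m := by
  have h1 : 0 < 1 - n.m := by linarith [n.m_lt_one]
  have h2 : 0 < 2 * n.e - n.a := by linarith [n.a_lt]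
  have hp := n.p_pos
  rw [PsiK_one]; positivity

section limits
variable {l : Filter ℝ}

theorem tendsto_coeffs (hl : l ≤ 𝓝 n.xP) (hh : Tendsto h l (𝓝 n.xP))
    (hk : Tendsto (fun x => n.slope x (h x)) l (𝓝 n.m)) :
    Tendsto (fun x => n.PsiK (h x / x) (n.slope x (h x))
      + n.p * n.a * ((h x / x) ^ 2 * (h x / x - 1) ^ 2
        + 2 * (h x / x) * (h x / x - 1) * (2 * (h x / x) - 1) * (n.slope x (h x) - h x / x))) l
      (𝓝 (n.PsiK 1 n.m)) ∧
    Tendsto (fun x => -(n.PsiR (h x / x) (n.slope x (h x)) * ((n.slope x (h x) - h x / x) / x))) l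
      (𝓝 (-n.PsiR 1 n.m * ((n.m - 1) / n.xP))) ∧
    Tendsto (fun x => n.rho x (h x / x)) l (𝓝 0) ∧
    Tendsto (fun x => n.p * n.a * ((h x / x) ^ 2 * (h x / x - 1) ^ 2
        + 2 * (h x / x) * (h x / x - 1) * (2 * (h x / x) - 1) * (n.slope x (h x) - h x / x))) l
      (𝓝 0) ∧
    Tendsto (fun x => -n.Psi (h x / x) (n.slope x (h x))) l (𝓝 0) := by
  have hr := tendsto_ratio hl hh
  have hid : Tendsto (fun x : ℝ => x) l (𝓝 n.xP) := hl
  have hrk := hr.prodMk_nhds hk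
  have h1 := (n.continuous_PsiK.tendsto (1, n.m)).comp hrk
  have h2 := (n.continuous_PsiR.tendsto (1, n.m)).comp hrk
  have h3 := (n.continuous_Psi.tendsto (1, n.m)).comp hrk
  have h4 : Tendsto (fun x => n.p * n.a * ((h x / x) ^ 2 * (h x / x - 1) ^ 2
        + 2 * (h x / x) * (h x / x - 1) * (2 * (h x / x) - 1) * (n.slope x (h x) - h x / x))) l
      (𝓝 0) := by
    have := ((by fun_prop : Continuous fun u : ℝ × ℝ => n.p * n.a * (u.1 ^ 2 * (u.1 - 1) ^ 2
        + 2 * u.1 * (u.1 - 1) * (2 * u.1 - 1) * (u.2 - u.1))).tendsto (1, n.m)).comp hrk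
    simpa [Function.comp_def] using this
  refine ⟨by simpa using h1.add h4, ?_, ?_, h4, ?_⟩
  · have := (h2.mul ((hk.sub hr).div hid n.xP_pos.ne')).neg
    rw [neg_mul]; exact this
  · have := ((by fun_prop : Continuous fun u : ℝ × ℝ =>
      n.p * n.a * u.1 ^ 2 * (u.1 - 1) ^ 2 * u.2).tendsto (1, n.xP)).comp (hr.prodMk_nhds hid)
    simpa [rho, Function.comp_def] using this
  · have := h3.neg
    simp only [Psi_one, sub_self, mul_zero, neg_zero] at this
    exact this

end limits

theorem IsSol.tendsto_slopeDeriv_left (hs : n.IsSol a n.xP h) (hab : a < n.xP)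
    (hJ : ∀ x ∈ Ioo a n.xP, 0 ≤ n.J x (h x)) (hh : Tendsto h (𝓝[<] n.xP) (𝓝 n.xP)) :
    Tendsto (fun x => n.slopeDeriv x (h x)) (𝓝[<] n.xP) (𝓝 n.curv) := by
  have hk := hs.tendsto_slope_left hab hJ hh
  obtain ⟨hA, hB, hρ, hρ', -⟩ := tendsto_coeffs nhdsWithin_le_nhds hh hk
  choose! d hd hd' using fun x (hx : x ∈ Ioo a n.xP) => hs.exists_hasDerivAt_slopeDeriv hx
  rw [← curv_eq]
  exact tendsto_of_singular_linear_left hab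
    (fun x hx => rho_pos (hs.pos x hx) (hs.h_pos hx) (hs.ne x hx))
    (fun x hx => hs.hasDerivAt_rho hx) hd hd' PsiK_one_pos hA hB hρ hρ'

/-- Against the flow one piece of extra information is needed: `ρ j = -Psi(r, k)` tends to `-Psi(1,
m) = 0`. -/
theorem IsSol.tendsto_slopeDeriv_right (hs : n.IsSol n.xP b h) (hab : n.xP < b)
    (hh : Tendsto h (𝓝[>] n.xP) (𝓝 n.xP)) :
    Tendsto (fun x => n.slopeDeriv x (h x)) (𝓝[>] n.xP) (𝓝 n.curv) := by
  have hk := hs.tendsto_slope_right hab hh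
  obtain ⟨hA, hB, hρ, hρ', hΨ⟩ := tendsto_coeffs nhdsWithin_le_nhds hh hk
  choose! d hd hd' using fun x (hx : x ∈ Ioo n.xP b) => hs.exists_hasDerivAt_slopeDeriv hx
  rw [← curv_eq]
  refine tendsto_of_singular_linear_right hab
    (fun x hx => rho_pos (hs.pos x hx) (hs.h_pos hx) (hs.ne x hx))
    (fun x hx => hs.hasDerivAt_rho hx) hd hd' PsiK_one_pos hA hB hρ hρ' (hΨ.congr' ?_)
  filter_upwards [Ioo_mem_nhdsGT hab] with x hx
  rw [slopeDeriv, mul_div_cancel₀ _ (rho_pos (hs.pos x hx) (hs.h_pos hx) (hs.ne x hx)).ne']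

end crossing
end Reduced
end
end ShadowODE

namespace ShadowODE
noncomputable section
namespace Reduced
variable {n : Reduced}

/-! ### The family of maximal inner solutions -/

/-- Inner solutions in the reduced variables. -/
structure IsInner (n : Reduced) (D : Set ℝ) (g : ℝ → ℝ) : Prop where
  interval : D.OrdConnected
  pos : D ⊆ Ioi 0
  continuous : ContinuousOn g D
  P_nonneg : ∀ x ∈ D, 0 ≤ n.P x (g x)
  equation : ∀ x ∈ interior D, x ≠ n.xP →
    n.Q x (g x) ≠ 0 ∧ HasDerivAt g (n.slope x (g x)) x

/-- The inner solution that starts at the point of the upper branch over `α`. -/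
def fam (n : Reduced) (α : ℝ) : ℝ → ℝ :=
  if α < n.xP then n.leftSol α else n.rightFam α

/-- The right end point of the domain of `fam α`. -/
def finish (n : Reduced) (α : ℝ) : ℝ :=
  if α < n.xP then if n.a < n.μ then n.exit n.xP else n.xP else n.exit α

theorem fam_of_lt {α : ℝ} (hα : α < n.xP) : n.fam α = n.leftSol α := if_pos hα
theorem fam_of_le {α : ℝ} (hα : n.xP ≤ α) : n.fam α = n.rightFam α := if_neg hα.not_gt
theorem finish_of_le {α : ℝ} (hα : n.xP ≤ α) : n.finish α = n.exit α := if_neg hα.not_gt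

theorem finish_of_lt {α : ℝ} (hα : α < n.xP) (ha : n.a < n.μ) :
    n.finish α = n.exit n.xP := by
  rw [finish, if_pos hα, if_pos ha]

theorem finish_of_eq {α : ℝ} (hα : α < n.xP) (ha : n.a = n.μ) : n.finish α = n.xP := by
  rw [finish, if_pos hα, if_neg ha.not_lt]

theorem fam_start {α : ℝ} (hα : α ∈ Ioo 0 n.xN) : n.fam α α = n.top α := by
  rcases lt_or_ge α n.xP with h | h
  · rw [fam_of_lt h, leftSol_of_le le_rfl]
  · rw [fam_of_le h, rightFam_of_le ⟨h, hα.2⟩ le_rfl]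

theorem xP_mem (ha : n.a < n.μ) : n.xP ∈ Ico n.xP n.xN := ⟨le_rfl, xP_lt_xN ha⟩

theorem fam_eq_singSol {α x : ℝ} (hα : α < n.xP) (hx : n.xP ≤ x) :
    n.fam α x = n.rightFam n.xP x := by
  rw [fam_of_lt hα, leftSol_of_xP_le hα hx, rightFam_xP]

theorem fam_xP {α : ℝ} (hα : α < n.xP) : n.fam α n.xP = n.xP := by
  rw [fam_of_lt hα, leftSol_of_xP_le hα le_rfl, singSol_xP]

theorem lt_finish {α : ℝ} (hα : α ∈ Ioo 0 n.xN) : α < n.finish α := by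
  rcases lt_or_ge α n.xP with h | h
  · rcases n.a_le.eq_or_lt with ha | ha
    · rwa [finish_of_eq h ha]
    · rw [finish_of_lt h ha]
      exact h.trans (exit_spec (xP_mem ha)).1.1
  · rw [finish_of_le h]
    exact (exit_spec ⟨h, hα.2⟩).1.1

theorem finish_le {α : ℝ} (hα : α ∈ Ioo 0 n.xN) : n.finish α ≤ n.xE := by
  rcases lt_or_ge α n.xP with h | h
  · rcases n.a_le.eq_or_lt with ha | ha
    · rw [finish_of_eq h ha]; exact n.xP_lt_xE.le
    · rw [finish_of_lt h ha]
      exact (exit_spec (xP_mem ha)).1.2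
  · rw [finish_of_le h]
    exact (exit_spec ⟨h, hα.2⟩).1.2

theorem xP_le_finish {α : ℝ} (hα : α ∈ Ioo 0 n.xN) : n.xP ≤ n.finish α := by
  rcases lt_or_ge α n.xP with h | h
  · rcases n.a_le.eq_or_lt with ha | ha
    · rw [finish_of_eq h ha]
    · rw [finish_of_lt h ha]
      exact (exit_spec (xP_mem ha)).1.1.le
  · exact h.trans (lt_finish hα).le

theorem isSol_left {α : ℝ} (hα : α ∈ Ioo 0 n.xP) : n.IsSol α n.xP (n.leftSol α) where
  pos _ hx := hα.1.trans hx.1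
  P_pos _ hx := P_leftSol_pos hα.1 hx
  Q_pos _ hx := Q_leftSol_pos hα.1 ⟨hx.1.le, hx.2⟩
  ne _ hx := (lt_leftSol hα.1 ⟨hx.1.le, hx.2⟩).ne'
  sol _ hx := hasDerivAt_leftSol hα.1 hx

theorem isSol_right {α : ℝ} (hα : α ∈ Ico n.xP n.xN) : n.IsSol α (n.exit α) (n.rightFam α) where
  pos _ hx := n.xP_pos.trans_le (hα.1.trans hx.1.le)
  P_pos x hx := (exit_spec hα).2.1 x hx
  Q_pos x hx := Q_pos_of_xP_lt (hα.1.trans_lt hx.1) ((exit_spec hα).2.1 x hx).le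
  ne x hx := (lt_of_xP_lt (hα.1.trans_lt hx.1) ((exit_spec hα).2.1 x hx).le).ne
  sol _ hx := hasDerivAt_rightFam hα hx

theorem continuousOn_leftSol {α : ℝ} (hα : α ∈ Ioo 0 n.xP) :
    ContinuousOn (n.leftSol α) (Icc α n.xP) := by
  intro x hx
  rcases hx.2.eq_or_lt with h | h
  · subst h
    have h1 := tendsto_leftSol hα
    rw [← continuousWithinAt_sdiff_self, ContinuousWithinAt,
      leftSol_of_xP_le hα.2 le_rfl, singSol_xP]
    exact h1.mono_left (nhdsWithin_mono _ fun y hy => lt_of_le_of_ne hy.1.2 hy.2)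
  · obtain ⟨t, ht, ht'⟩ := exists_between h
    have h1 := (isClampSol_leftSol hα.1 hα.2 hα.1 ht').continuousOn x ⟨hx.1, ht.le⟩
    refine h1.mono_of_mem_nhdsWithin ?_
    filter_upwards [self_mem_nhdsWithin, mem_nhdsWithin_of_mem_nhds (Iio_mem_nhds ht)] with y hy hy'
    exact ⟨hy.1, hy'.le⟩

theorem rightFam_xP_xP : n.rightFam n.xP n.xP = n.xP := by rw [rightFam_xP, singSol_xP]

theorem continuousOn_fam {α : ℝ} (hα : α ∈ Ioo 0 n.xN) :
    ContinuousOn (n.fam α) (Icc α (n.finish α)) := by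
  rcases lt_or_ge α n.xP with h | h
  · have h1 : ContinuousOn (n.fam α) (Icc α n.xP) := by
      rw [fam_of_lt h]; exact continuousOn_leftSol ⟨hα.1, h⟩
    rcases n.a_le.eq_or_lt with ha | ha
    · rwa [finish_of_eq h ha]
    · rw [finish_of_lt h ha]
      have he := (exit_spec (xP_mem ha)).1
      rw [← Icc_union_Icc_eq_Icc h.le he.1.le]
      refine h1.union_of_isClosed ?_ isClosed_Icc isClosed_Icc
      refine ((continuousOn_rightFam (xP_mem ha)).mono
        (Icc_subset_Icc_right he.2)).congr fun x hx => fam_eq_singSol h hx.1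
  · rw [finish_of_le h, fam_of_le h]
    exact (continuousOn_rightFam ⟨h, hα.2⟩).mono
      (Icc_subset_Icc_right (exit_spec ⟨h, hα.2⟩).1.2)

theorem P_fam_nonneg {α x : ℝ} (hα : α ∈ Ioo 0 n.xN) (hx : x ∈ Icc α (n.finish α)) :
    0 ≤ n.P x (n.fam α x) := by
  have hright : ∀ α', α' ∈ Ico n.xP n.xN → x ∈ Icc α' (n.exit α') →
      0 ≤ n.P x (n.rightFam α' x) := by
    intro α' hα' hx
    rcases hx.1.eq_or_lt with h | h
    · rw [← h, rightFam_of_le hα' le_rfl, P_top]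
      exact (disc_nonneg_iff (n.xP_pos.trans_le hα'.1)).2 (hα'.2.trans n.xN_lt_xE).le
    · rcases hx.2.eq_or_lt with h' | h'
      · rw [h']; exact (exit_spec hα').2.2.1.ge
      · exact ((isSol_right hα').P_pos x ⟨h, h'⟩).le
  rcases lt_or_ge α n.xP with h | h
  · rcases lt_or_ge x n.xP with hx' | hx'
    · rw [fam_of_lt h]; exact (leftSol_spec hα.1 ⟨hx.1, hx'⟩).1
    · rcases n.a_le.eq_or_lt with ha | ha
      · rw [finish_of_eq h ha] at hx
        have : x = n.xP := le_antisymm hx.2 hx'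
        rw [this, fam_xP h, P_xP]
      · rw [finish_of_lt h ha] at hx
        rw [fam_eq_singSol h hx']
        exact hright _ (xP_mem ha) ⟨hx', hx.2⟩
  · rw [fam_of_le h]
    rw [finish_of_le h] at hx
    exact hright α ⟨h, hα.2⟩ hx

theorem fam_equation {α x : ℝ} (hα : α ∈ Ioo 0 n.xN) (hx : x ∈ Ioo α (n.finish α))
    (hne : x ≠ n.xP) : 0 < n.P x (n.fam α x) ∧ 0 < n.Q x (n.fam α x) ∧
      HasDerivAt (n.fam α) (n.slope x (n.fam α x)) x := by
  rcases lt_or_ge α n.xP with h | h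
  · rcases lt_or_gt_of_ne hne with hx' | hx'
    · have hs := isSol_left ⟨hα.1, h⟩
      rw [fam_of_lt h]
      exact ⟨hs.P_pos x ⟨hx.1, hx'⟩, hs.Q_pos x ⟨hx.1, hx'⟩, hs.sol x ⟨hx.1, hx'⟩⟩
    · rcases n.a_le.eq_or_lt with ha | ha
      · rw [finish_of_eq h ha] at hx; exact absurd hx.2 hx'.not_gt
      · rw [finish_of_lt h ha] at hx
        have hs := isSol_right (xP_mem ha)
        rw [fam_eq_singSol h hx'.le]
        refine ⟨hs.P_pos x ⟨hx', hx.2⟩, hs.Q_pos x ⟨hx', hx.2⟩,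
          (hs.sol x ⟨hx', hx.2⟩).congr_of_eventuallyEq ?_⟩
        filter_upwards [lt_mem_nhds hx'] with y hy
        exact fam_eq_singSol h hy.le
  · rw [fam_of_le h]
    rw [finish_of_le h] at hx
    have hs := isSol_right ⟨h, hα.2⟩
    exact ⟨hs.P_pos x hx, hs.Q_pos x hx, hs.sol x hx⟩

theorem isInner_fam {α : ℝ} (hα : α ∈ Ioo 0 n.xN) :
    n.IsInner (Icc α (n.finish α)) (n.fam α) where
  interval := ordConnected_Icc
  pos x hx := hα.1.trans_le hx.1
  continuous := continuousOn_fam hα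
  P_nonneg x hx := P_fam_nonneg hα hx
  equation x hx hne := by
    rw [interior_Icc] at hx
    have := fam_equation hα hx hne
    exact ⟨this.2.1.ne', this.2.2⟩

/-! ### Containment -/

theorem Q_top_pos {x : ℝ} (hx : x ∈ Ioo 0 n.xN) (hne : x ≠ n.xP) : 0 < n.Q x (n.top x) := by
  have hP := n.P_top ((disc_nonneg_iff hx.1).2 (hx.2.trans n.xN_lt_xE).le)
  rcases lt_or_gt_of_ne hne with h | h
  · exact Q_pos_of_lt_xP hx.1 h hP.ge (J_top_pos hx.1 h).le
  · exact Q_pos_of_xP_lt h hP.ge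

theorem eq_of_eq_of_Q_ne {g h : ℝ → ℝ} {s t : ℝ} (hst : s ≤ t) (hg : ContinuousOn g (Icc s t))
    (hh : ContinuousOn h (Icc s t)) (hg' : ∀ x ∈ Ioo s t, HasDerivAt g (n.slope x (g x)) x)
    (hh' : ∀ x ∈ Ioo s t, HasDerivAt h (n.slope x (h x)) x)
    (hgQ : ∀ x ∈ Icc s t, n.Q x (g x) ≠ 0) (hhQ : ∀ x ∈ Icc s t, n.Q x (h x) ≠ 0)
    (h0 : g s = h s) : g t = h t := by
  have := eq_zero_of_linear_ode (f := fun x => g x - h x) hst (hg.sub hh)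
    (continuousOn_diffSlope continuousOn_id hg hh hgQ hhQ) (fun x hx => ?_) (by simp [h0])
  · linarith
  · have h1 := slope_sub (hgQ x (Ioo_subset_Icc_self hx)) (hhQ x (Ioo_subset_Icc_self hx))
    exact ((hg' x hx).fun_sub (hh' x hx)).congr_deriv h1

section containment
variable {D : Set ℝ} {g : ℝ → ℝ} {α : ℝ}

theorem IsInner.Icc_subset (hD : n.IsInner D g) {s t : ℝ} (hs : s ∈ D) (ht : t ∈ D) :
    Icc s t ⊆ D := hD.interval.out hs ht

theorem IsInner.Ioo_subset (hD : n.IsInner D g) {s t : ℝ} (hs : s ∈ D) (ht : t ∈ D) :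
    Ioo s t ⊆ interior D :=
  interior_maximal (Ioo_subset_Icc_self.trans (hD.Icc_subset hs ht)) isOpen_Ioo

/-- Just left of `α` the source `2 (μ g - a x)` is positive, so an inner solution arriving from
there would have `P > 0` at `α`, contrary to its start on the boundary. -/
theorem IsInner.le_of_mem (hD : n.IsInner D g) (hα : α ∈ Ioo 0 n.xN) (hne : α ≠ n.xP)
    (hαD : α ∈ D) (h0 : g α = n.top α) {x : ℝ} (hx : x ∈ D) : α ≤ x := by
  by_contra hlt
  push Not at hlt
  have hsub := hD.Icc_subset hx hαD
  have hcont := hD.continuous.mono hsub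
  have hg : Tendsto g (𝓝[<] α) (𝓝 (g α)) := by
    have := hcont α ⟨hlt.le, le_rfl⟩
    exact this.mono_left (nhdsWithin_le_of_mem
      (mem_of_superset (Ioo_mem_nhdsLT hlt) Ioo_subset_Icc_self))
  have hid : Tendsto (fun x : ℝ => x) (𝓝[<] α) (𝓝 α) := nhdsWithin_le_nhds
  have h1 : ∀ᶠ y in 𝓝[<] α, 0 < 2 * (n.μ * g y - n.a * y) := by
    refine (((hg.const_mul n.μ).sub (hid.const_mul n.a)).const_mul 2).eventually_const_lt ?_
    rw [h0]; linarith [top_gt hα.2]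
  have h2 : ∀ᶠ y in 𝓝[<] α, y ≠ n.xP := hid.eventually_ne hne
  obtain ⟨s, hs, hs'⟩ := (mem_nhdsLT_iff_exists_Ioo_subset' hlt).1
    ((h1.and h2).and (Ioo_mem_nhdsLT hlt))
  obtain ⟨s', hs1, hs2⟩ := exists_between (show s < α from hs)
  have hmem : ∀ y ∈ Ico s' α, 0 < 2 * (n.μ * g y - n.a * y) ∧ y ≠ n.xP ∧ y ∈ Ioo x α := by
    intro y hy
    have := hs' ⟨hs1.trans_le hy.1, hy.2⟩
    exact ⟨this.1.1, this.1.2, this.2⟩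
  have hQ : ∀ y ∈ Icc s' α, n.Q y (g y) ≠ 0 := by
    intro y hy
    rcases hy.2.eq_or_lt with h | h
    · rw [h, h0]; exact (Q_top_pos hα hne).ne'
    · have := hmem y ⟨hy.1, h⟩
      exact (hD.equation y (hD.Ioo_subset hx hαD this.2.2) this.2.1).1
  have hc' : ContinuousOn g (Icc s' α) :=
    hcont.mono (Icc_subset_Icc_left (hmem s' ⟨le_rfl, hs2⟩).2.2.1.le)
  have hpos := pos_of_linear_ode (f := fun y => n.P y (g y)) hs2
    (n.continuous_P.comp_continuousOn (continuousOn_id.prodMk hc'))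
    (continuousOn_P_coeff hc' hQ) (fun y hy => by
      have := hmem y ⟨hy.1.le, hy.2⟩
      exact hasDerivAt_P_sol (hD.equation y (hD.Ioo_subset hx hαD this.2.2) this.2.1).2)
    (fun y hy => (hmem y ⟨hy.1.le, hy.2⟩).1)
    (hD.P_nonneg s' (hsub ⟨(hmem s' ⟨le_rfl, hs2⟩).2.2.1.le, hs2.le⟩))
  simp only [h0] at hpos
  rw [P_top ((disc_nonneg_iff hα.1).2 (hα.2.trans n.xN_lt_xE).le)] at hpos
  exact lt_irrefl _ hpos

theorem IsInner.isClampSol (hD : n.IsInner D g) {s t : ℝ} (hs : s ∈ D) (ht : t ∈ D)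
    (hsP : n.xP < s) : n.IsClampSol n.bot n.top s t g := by
  have hsub := hD.Icc_subset hs ht
  have hQ : ∀ x ∈ Icc s t, 0 < n.Q x (g x) := fun x hx =>
    Q_pos_of_xP_lt (hsP.trans_le hx.1) (hD.P_nonneg x (hsub hx))
  have hc := hD.continuous.mono hsub
  intro x hx
  rw [clampSlope_of_nonneg (hD.P_nonneg x (hsub hx))]
  exact hasDerivWithinAt_Icc_of_continuous (f' := fun x => n.slope x (g x)) hx hc
    (fun y hy _ => (hD.equation y (hD.Ioo_subset hs ht hy) (hsP.trans hy.1).ne').2)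
    (continuousOn_slope continuousOn_id hc (fun u hu => (hQ u hu).ne') x hx)

/-- An inner solution that meets `rightFam α'` at a point right of the singular point does not
extend beyond `exit α'`. -/
theorem IsInner.right_spec (hD : n.IsInner D g) {α' s x : ℝ} (hα' : α' ∈ Ico n.xP n.xN)
    (hs : s ∈ D) (hx : x ∈ D) (hsx : s ≤ x) (hsP : n.xP < s)
    (h0 : g s = n.rightFam α' s) : x ≤ n.exit α' ∧ g x = n.rightFam α' x := by
  have hxE := le_xE (hD.pos hx) (hD.P_nonneg x hx)
  have h1 := (isStrip_right hsP).unique le_rfl hxE (hD.isClampSol hs hx hsP)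
    ((isClampSol_rightFam hα' ⟨hsP, hsx.trans hxE⟩).mono le_rfl hxE) h0 ⟨hsx, le_rfl⟩
  refine ⟨?_, h1⟩
  by_contra hlt
  push Not at hlt
  have h2 := (exit_spec hα').2.2.2.2.2 x ⟨hlt, hxE⟩
  rw [← h1] at h2
  exact h2.not_ge (hD.P_nonneg x hx)

theorem IsInner.eq_left (hD : n.IsInner D g) (hα : α ∈ Ioo 0 n.xN) (hαP : α < n.xP)
    (hαD : α ∈ D) (h0 : g α = n.top α) {x : ℝ} (hx : x ∈ D) (hαx : α ≤ x) (hxP : x ≤ n.xP) :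
    g x = n.fam α x := by
  rcases hαx.eq_or_lt with h | hlt
  · rw [← h, h0, fam_start hα]
  have hIoo : ∀ y ∈ Ioo α x, g y = n.fam α y := by
    intro y hy
    have hyP : y < n.xP := hy.2.trans_le hxP
    have hsub := hD.Icc_subset hαD hx
    refine eq_of_eq_of_Q_ne (n := n) hy.1.le (hD.continuous.mono
      ((Icc_subset_Icc_right hy.2.le).trans hsub)) ?_ (fun z hz => ?_) (fun z hz => ?_)
      (fun z hz => ?_) (fun z hz => ?_) (by rw [h0, fam_start hα])
    · exact (continuousOn_fam hα).mono (Icc_subset_Icc_right (hyP.le.trans (xP_le_finish hα)))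
    · exact (hD.equation z (hD.Ioo_subset hαD hx ⟨hz.1, hz.2.trans hy.2⟩)
        (hz.2.trans hyP).ne).2
    · rw [fam_of_lt hαP]; exact hasDerivAt_leftSol hα.1 ⟨hz.1, hz.2.trans hyP⟩
    · rcases hz.1.eq_or_lt with h | h
      · rw [← h, h0]; exact (Q_top_pos hα hαP.ne).ne'
      · exact (hD.equation z (hD.Ioo_subset hαD hx ⟨h, hz.2.trans_lt hy.2⟩)
          (hz.2.trans_lt hyP).ne).1
    · rw [fam_of_lt hαP]; exact (Q_leftSol_pos hα.1 ⟨hz.1, hz.2.trans_lt hyP⟩).ne'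
  -- The uniqueness argument needs `Q ≠ 0` at its end point. The value at `x`, which may be `xP`,
  -- follows by continuity.
  have h1 : Tendsto g (𝓝[<] x) (𝓝 (g x)) :=
    ((hD.continuous.mono (hD.Icc_subset hαD hx)) x ⟨hlt.le, le_rfl⟩).mono_left
      (nhdsWithin_le_of_mem (mem_of_superset (Ioo_mem_nhdsLT hlt) Ioo_subset_Icc_self))
  have h2 : Tendsto (n.fam α) (𝓝[<] x) (𝓝 (n.fam α x)) :=
    ((continuousOn_fam hα) x ⟨hlt.le, hxP.trans (xP_le_finish hα)⟩).mono_left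
      (nhdsWithin_le_of_mem (mem_of_superset (Ioo_mem_nhdsLT hlt) fun y hy =>
        ⟨hy.1.le, hy.2.le.trans (hxP.trans (xP_le_finish hα))⟩))
  refine tendsto_nhds_unique h1 (h2.congr' ?_)
  filter_upwards [Ioo_mem_nhdsLT hlt] with y hy
  exact (hIoo y hy).symm

theorem continuousWithinAt_rightFam_xP (ha : n.a < n.μ) :
    Tendsto (n.rightFam n.xP) (𝓝[>] n.xP) (𝓝 n.xP) := by
  rw [rightFam_xP]; exact tendsto_singSol ha

/-- Uniqueness at the singular point, to the right. -/
theorem IsInner.eventuallyEq_right (hD : n.IsInner D g) (ha : n.a < n.μ) (hP : n.xP ∈ D)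
    (h0 : g n.xP = n.xP) {x : ℝ} (hx : x ∈ D) (hxP : n.xP < x) :
    ∀ᶠ y in 𝓝[>] n.xP, g y = n.rightFam n.xP y := by
  have hs := isSol_right (xP_mem ha)
  have hex := (exit_spec (xP_mem ha)).1.1
  set s := n.rightFam n.xP
  have hid : Tendsto (fun x : ℝ => x) (𝓝[>] n.xP) (𝓝 n.xP) := nhdsWithin_le_nhds
  have hst : Tendsto s (𝓝[>] n.xP) (𝓝 n.xP) := continuousWithinAt_rightFam_xP ha
  have hgt : Tendsto g (𝓝[>] n.xP) (𝓝 n.xP) := by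
    have := (hD.continuous.mono (hD.Icc_subset hP hx)) n.xP ⟨le_rfl, hxP.le⟩
    rw [ContinuousWithinAt, h0] at this
    exact this.mono_left (nhdsWithin_le_of_mem
      (mem_of_superset (Ioo_mem_nhdsGT hxP) Ioo_subset_Icc_self))
  have hk := hs.tendsto_slope_right hex hst
  -- The limit is `-p xP (2e - a) (1 - m) < 0`. With `Q > 0` the divided difference of the slope is
  -- negative, so two solutions approach each other to the right; leaving from the same point, they
  -- coincide.
  have hnum : ∀ᶠ y in 𝓝[>] n.xP,
      n.p * n.diffP y (g y) (s y) - n.slope y (s y) * n.diffQ y (g y) (s y) < 0 := by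
    have h1 : Tendsto (fun y => n.diffP y (g y) (s y)) (𝓝[>] n.xP)
        (𝓝 (2 + 2 * n.μ * n.xP - 2 * n.e * (n.xP + n.xP))) :=
      (((hid.const_mul _).const_add 2).sub ((hgt.add hst).const_mul _))
    have h2 : Tendsto (fun y => n.diffQ y (g y) (s y)) (𝓝[>] n.xP)
        (𝓝 (-n.xP * (2 * n.e - n.a) - (1 - n.p) * (2 + 2 * n.μ * n.xP - 2 * n.e * (n.xP + n.xP)))) :=
      (hid.neg.mul_const _).sub (h1.const_mul _)
    refine ((h1.const_mul n.p).sub (hk.mul h2)).eventually_lt_const ?_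
    have e := n.xP_mul
    have e1 : 2 + 2 * n.μ * n.xP - 2 * n.e * (n.xP + n.xP) = -(n.xP * (2 * n.e - n.a)) := by
      linear_combination -e
    rw [e1]
    have h3 := mul_pos (mul_pos n.p_pos n.d_pos) (sub_pos.2 n.m_lt_one)
    nlinarith
  obtain ⟨b, hb, hb'⟩ := (mem_nhdsGT_iff_exists_Ioo_subset' hxP).1
    (hnum.and ((eventually_mem_set.2 (Ioo_mem_nhdsGT hxP)).and (Ioo_mem_nhdsGT hex)))
  have hb'' : n.xP < b := hb
  have hd : ∀ y ∈ Ioo n.xP b, HasDerivAt (fun y => (g y - s y) ^ 2)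
      (2 * n.diffSlope y (g y) (s y) * (g y - s y) ^ 2) y := by
    intro y hy
    obtain ⟨-, h2, h3⟩ := hb' hy
    have hgP := hD.P_nonneg y (hD.Icc_subset hP hx (Ioo_subset_Icc_self h2))
    have hgQ := Q_pos_of_xP_lt hy.1 hgP
    have hder := (hD.equation y (hD.Ioo_subset hP hx h2) hy.1.ne').2
    have h4 := slope_sub hgQ.ne' (hs.Q_pos y h3).ne'
    refine ((hder.fun_sub (hs.sol y h3)).fun_pow 2).congr_deriv ?_
    rw [h4]; push_cast; ring
  have hanti : AntitoneOn (fun y => (g y - s y) ^ 2) (Ioo n.xP b) := by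
    refine antitoneOn_of_deriv_nonpos (convex_Ioo _ _)
      (fun y hy => (hd y hy).continuousAt.continuousWithinAt) (fun y hy => ?_) fun y hy => ?_
    · rw [interior_Ioo] at hy; exact (hd y hy).differentiableAt.differentiableWithinAt
    · rw [interior_Ioo] at hy
      rw [(hd y hy).deriv]
      obtain ⟨h1, h2, h3⟩ := hb' hy
      have hgP := hD.P_nonneg y (hD.Icc_subset hP hx (Ioo_subset_Icc_self h2))
      have hgQ := Q_pos_of_xP_lt hy.1 hgP
      have : n.diffSlope y (g y) (s y) ≤ 0 := by
        rw [diffSlope]; exact div_nonpos_of_nonpos_of_nonneg h1.le hgQ.le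
      have := mul_nonneg (neg_nonneg.2 this) (sq_nonneg (g y - s y))
      linarith
  have hlim : Tendsto (fun y => (g y - s y) ^ 2) (𝓝[>] n.xP) (𝓝 0) := by
    have := (hgt.sub hst).pow 2
    simpa using this
  filter_upwards [Ioo_mem_nhdsGT hb''] with y hy
  have h1 : (g y - s y) ^ 2 ≤ 0 := by
    refine ge_of_tendsto hlim ?_
    filter_upwards [Ioo_mem_nhdsGT hy.1] with z hz
    exact hanti ⟨hz.1, hz.2.trans hy.2⟩ hy hz.2.le
  have h2 := pow_eq_zero_iff two_ne_zero |>.1 (le_antisymm h1 (sq_nonneg _))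
  linarith

/-- Every inner solution through the point of the upper branch over `α` is a restriction of
`fam α`. -/
theorem IsInner.subset_and_eqOn (hD : n.IsInner D g) (hα : α ∈ Ioo 0 n.xN) (hne : α ≠ n.xP)
    (hαD : α ∈ D) (h0 : g α = n.top α) : D ⊆ Icc α (n.finish α) ∧ EqOn g (n.fam α) D := by
  suffices h : ∀ x ∈ D, α ≤ x → x ≤ n.finish α ∧ g x = n.fam α x from
    ⟨fun x hx => ⟨hD.le_of_mem hα hne hαD h0 hx, (h x hx (hD.le_of_mem hα hne hαD h0 hx)).1⟩,
      fun x hx => (h x hx (hD.le_of_mem hα hne hαD h0 hx)).2⟩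
  intro x hx hαx
  rcases lt_or_gt_of_ne hne with h | h
  · rcases le_or_gt x n.xP with hxP | hxP
    · exact ⟨hxP.trans (xP_le_finish hα), hD.eq_left hα h hαD h0 hx hαx hxP⟩
    · have hP : n.xP ∈ D := hD.Icc_subset hαD hx ⟨h.le, hxP.le⟩
      have hgP : g n.xP = n.xP := by
        rw [hD.eq_left hα h hαD h0 hP h.le le_rfl, fam_xP h]
      rcases n.a_le.eq_or_lt with ha | ha
      -- Now `xP = xN` is the highest point. A solution past it would be nondecreasing, hence still
      -- at height `wN` at another abscissa.
      · exfalso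
        have hmono : MonotoneOn g (Icc n.xP x) := by
          have hd : ∀ y ∈ Ioo n.xP x, HasDerivAt g (n.slope y (g y)) y := fun y hy =>
            (hD.equation y (hD.Ioo_subset hP hx hy) hy.1.ne').2
          refine monotoneOn_of_deriv_nonneg (convex_Icc _ _)
            (hD.continuous.mono (hD.Icc_subset hP hx)) (fun y hy => ?_) fun y hy => ?_
          · rw [interior_Icc] at hy; exact (hd y hy).differentiableAt.differentiableWithinAt
          · rw [interior_Icc] at hy
            rw [(hd y hy).deriv]
            have h1 := hD.P_nonneg y (hD.Icc_subset hP hx (Ioo_subset_Icc_self hy))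
            exact div_nonneg (mul_nonneg n.p_pos.le h1) (Q_pos_of_xP_lt hy.1 h1).le
        have h1 := hmono ⟨le_rfl, hxP.le⟩ ⟨hxP.le, le_rfl⟩ hxP.le
        have h2 := le_wN (hD.pos hx) (hD.P_nonneg x hx)
        have h3 : n.wN = n.xP := by rw [← top_xN, xN_eq_xP ha, top_xP]
        have h4 : g x = n.wN := le_antisymm h2 (by rw [h3, ← hgP]; exact h1)
        have h5 := eq_xN (n := n) (x := x) (by rw [← h4]; exact hD.P_nonneg x hx)
        rw [xN_eq_xP ha] at h5
        exact hxP.ne' h5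
      · have hev := hD.eventuallyEq_right ha hP hgP hx hxP
        obtain ⟨s, hs1, hs2⟩ := (hev.and (Ioo_mem_nhdsGT hxP)).exists
        have := hD.right_spec (xP_mem ha) (hD.Icc_subset hP hx (Ioo_subset_Icc_self hs2)) hx
          hs2.2.le hs2.1 hs1
        rw [finish_of_lt h ha, fam_eq_singSol h hxP.le]
        exact this
  · rw [finish_of_le h.le, fam_of_le h.le]
    exact hD.right_spec ⟨h.le, hα.2⟩ hαD hx hαx h (by
      rw [h0, rightFam_of_le ⟨h.le, hα.2⟩ le_rfl])

end containment
end Reduced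
end
end ShadowODE

namespace ShadowODE
noncomputable section

theorem continuousWithinAt_Icc_of_tendsto {f : ℝ → ℝ} {a b c : ℝ} (hac : a ≤ c) (hcb : c ≤ b)
    (hl : a < c → Tendsto f (𝓝[<] c) (𝓝 (f c))) (hr : c < b → Tendsto f (𝓝[>] c) (𝓝 (f c))) :
    ContinuousWithinAt f (Icc a b) c := by
  rw [← Icc_union_Icc_eq_Icc hac hcb]
  refine ContinuousWithinAt.union ?_ ?_
  · rcases hac.eq_or_lt with h | h
    · rw [h, Icc_self]; exact continuousWithinAt_singleton
    · exact (continuousWithinAt_Iio_iff_Iic.1 (hl h)).mono Icc_subset_Iic_self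
  · rcases hcb.eq_or_lt with h | h
    · rw [h, Icc_self]; exact continuousWithinAt_singleton
    · exact (continuousWithinAt_Ioi_iff_Ici.1 (hr h)).mono Icc_subset_Ici_self

/-- If `f` is differentiable off `c` and the derivative extends continuously to the closed
interval, the extension is the derivative everywhere. -/
theorem hasDerivWithinAt_Icc_of_ne {f f' : ℝ → ℝ} {a b : ℝ} (c : ℝ)
    (hf : ContinuousOn f (Icc a b)) (hd : ∀ y ∈ Ioo a b, y ≠ c → HasDerivAt f (f' y) y)
    (hf' : ContinuousOn f' (Icc a b)) {x : ℝ} (hx : x ∈ Icc a b) :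
    HasDerivWithinAt f (f' x) (Icc a b) x := by
  refine hasDerivWithinAt_Icc_of_continuous hx hf (fun y hy _ => ?_) (hf' x hx)
  rcases eq_or_ne y c with h | h
  · rw [h] at hy ⊢
    exact (hasDerivWithinAt_Icc_of_continuous (Ioo_subset_Icc_self hy) hf hd
      (hf' c (Ioo_subset_Icc_self hy))).hasDerivAt (Icc_mem_nhds hy.1 hy.2)
  · exact hd y hy h

namespace Reduced
variable {n : Reduced}

/-! ### Regularity of the family -/

/-- The derivative of `fam α`. -/
def famSlope (n : Reduced) (α x : ℝ) : ℝ :=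
  if x = n.xP then n.m else n.slope x (n.fam α x)

/-- The second derivative of `fam α`. -/
def famCurv (n : Reduced) (α x : ℝ) : ℝ :=
  if x = n.xP then n.curv else n.slopeDeriv x (n.fam α x)

theorem famSlope_of_ne {α x : ℝ} (hx : x ≠ n.xP) : n.famSlope α x = n.slope x (n.fam α x) :=
  if_neg hx
theorem famSlope_xP (α : ℝ) : n.famSlope α n.xP = n.m := if_pos rfl
theorem famCurv_xP (α : ℝ) : n.famCurv α n.xP = n.curv := if_pos rfl

theorem fam_ne_and_Q_pos {α x : ℝ} (hα : α ∈ Ioo 0 n.xN) (hx : x ∈ Icc α (n.finish α))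
    (hne : x ≠ n.xP) : n.fam α x ≠ x ∧ 0 < n.Q x (n.fam α x) := by
  have hP := P_fam_nonneg hα hx
  rcases lt_or_gt_of_ne hne with h | h
  · have h' := hx.1.trans_lt h
    rw [fam_of_lt h']
    exact ⟨(lt_leftSol hα.1 ⟨hx.1, h⟩).ne', Q_leftSol_pos hα.1 ⟨hx.1, h⟩⟩
  · exact ⟨(lt_of_xP_lt h hP).ne, Q_pos_of_xP_lt h hP⟩

theorem fam_right {α : ℝ} (hα : α ∈ Ioo 0 n.xN) (hαP : α ≤ n.xP) (hf : n.xP < n.finish α) :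
    n.a < n.μ ∧ n.finish α = n.exit n.xP ∧ ∀ x, n.xP ≤ x → n.fam α x = n.rightFam n.xP x := by
  rcases hαP.eq_or_lt with h | h
  · subst h
    exact ⟨lt_of_mem_Ico ⟨le_rfl, hα.2⟩, finish_of_le le_rfl, fun x _ => by rw [fam_of_le le_rfl]⟩
  · rcases n.a_le.eq_or_lt with ha | ha
    · rw [finish_of_eq h ha] at hf; exact absurd hf (lt_irrefl _)
    · exact ⟨ha, finish_of_lt h ha, fun x hx => fam_eq_singSol h hx⟩

theorem tendsto_slope_fam {α : ℝ} (hα : α ∈ Ioo 0 n.xN) :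
    (α < n.xP → Tendsto (fun x => n.slope x (n.fam α x)) (𝓝[<] n.xP) (𝓝 n.m) ∧
      Tendsto (fun x => n.slopeDeriv x (n.fam α x)) (𝓝[<] n.xP) (𝓝 n.curv)) ∧
    (α ≤ n.xP → n.xP < n.finish α →
      Tendsto (fun x => n.slope x (n.fam α x)) (𝓝[>] n.xP) (𝓝 n.m) ∧
      Tendsto (fun x => n.slopeDeriv x (n.fam α x)) (𝓝[>] n.xP) (𝓝 n.curv)) := by
  constructor
  · intro h
    have hs := isSol_left (n := n) ⟨hα.1, h⟩
    have hJ : ∀ x ∈ Ioo α n.xP, 0 ≤ n.J x (n.leftSol α x) := fun x hx =>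
      (leftSol_spec hα.1 ⟨hx.1.le, hx.2⟩).2
    have ht := tendsto_leftSol (n := n) ⟨hα.1, h⟩
    rw [fam_of_lt h]
    exact ⟨hs.tendsto_slope_left h hJ ht, hs.tendsto_slopeDeriv_left h hJ ht⟩
  · intro h hf
    obtain ⟨ha, -, he⟩ := fam_right hα h hf
    have hs := isSol_right (xP_mem ha)
    have hex := (exit_spec (xP_mem ha)).1.1
    have ht := continuousWithinAt_rightFam_xP ha
    have hev : ∀ᶠ x in 𝓝[>] n.xP, n.rightFam n.xP x = n.fam α x := by
      filter_upwards [self_mem_nhdsWithin] with x hx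
      exact (he x (le_of_lt hx)).symm
    exact ⟨(hs.tendsto_slope_right hex ht).congr' (hev.mono fun x hx => by simp only [hx]),
      (hs.tendsto_slopeDeriv_right hex ht).congr' (hev.mono fun x hx => by simp only [hx])⟩

theorem continuousWithinAt_extend {f : ℝ → ℝ} {v : ℝ} {S : Set ℝ} {x : ℝ} (hx : x ≠ n.xP)
    (hf : ContinuousWithinAt f S x) :
    ContinuousWithinAt (fun y => if y = n.xP then v else f y) S x := by
  refine hf.congr_of_eventuallyEq ?_ (if_neg hx)
  filter_upwards [mem_nhdsWithin_of_mem_nhds (isOpen_ne.mem_nhds hx)] with y hy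
  exact if_neg hy

theorem tendsto_extend {f : ℝ → ℝ} {v : ℝ} {l : Filter ℝ} (hl : l ≤ 𝓝[≠] n.xP)
    (hf : Tendsto f l (𝓝 v)) :
    Tendsto (fun y => if y = n.xP then v else f y) l (𝓝 (if n.xP = n.xP then v else f n.xP)) := by
  rw [if_pos rfl]
  refine hf.congr' ?_
  filter_upwards [hl self_mem_nhdsWithin] with y hy
  exact (if_neg hy).symm

theorem nhdsLT_le_nhdsNE (x : ℝ) : 𝓝[<] x ≤ 𝓝[≠] x := nhdsWithin_mono _ fun _ h => ne_of_lt h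
theorem nhdsGT_le_nhdsNE (x : ℝ) : 𝓝[>] x ≤ 𝓝[≠] x := nhdsWithin_mono _ fun _ h => ne_of_gt h

theorem continuousOn_famSlope {α : ℝ} (hα : α ∈ Ioo 0 n.xN) :
    ContinuousOn (n.famSlope α) (Icc α (n.finish α)) := by
  have hT := tendsto_slope_fam hα
  intro x hx
  rcases eq_or_ne x n.xP with h | h
  · subst h
    exact continuousWithinAt_Icc_of_tendsto hx.1 hx.2
      (fun h => tendsto_extend (nhdsLT_le_nhdsNE _) (hT.1 h).1)
      (fun h => tendsto_extend (nhdsGT_le_nhdsNE _) (hT.2 hx.1 h).1)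
  · refine continuousWithinAt_extend h ?_
    have hc : ContinuousOn (fun y => n.slope y (n.fam α y)) (Icc α (n.finish α) \ {n.xP}) :=
      continuousOn_slope continuousOn_id ((continuousOn_fam hα).mono sdiff_subset)
        fun u hu => (fam_ne_and_Q_pos hα hu.1 hu.2).2.ne'
    refine (hc x ⟨hx, h⟩).mono_of_mem_nhdsWithin ?_
    filter_upwards [self_mem_nhdsWithin,
      mem_nhdsWithin_of_mem_nhds (isOpen_ne.mem_nhds h)] with y hy hy'
    exact ⟨hy, hy'⟩

theorem continuousOn_famCurv {α : ℝ} (hα : α ∈ Ioo 0 n.xN) :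
    ContinuousOn (n.famCurv α) (Icc α (n.finish α)) := by
  have hT := tendsto_slope_fam hα
  intro x hx
  rcases eq_or_ne x n.xP with h | h
  · subst h
    exact continuousWithinAt_Icc_of_tendsto hx.1 hx.2
      (fun h => tendsto_extend (nhdsLT_le_nhdsNE _) (hT.1 h).2)
      (fun h => tendsto_extend (nhdsGT_le_nhdsNE _) (hT.2 hx.1 h).2)
  · refine continuousWithinAt_extend h ?_
    have hf : ContinuousOn (n.fam α) (Icc α (n.finish α) \ {n.xP}) :=
      (continuousOn_fam hα).mono sdiff_subset
    have hpos : ∀ u ∈ Icc α (n.finish α) \ {n.xP}, 0 < u := fun u hu => hα.1.trans_le hu.1.1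
    have hk : ContinuousOn (fun y => n.slope y (n.fam α y)) (Icc α (n.finish α) \ {n.xP}) :=
      continuousOn_slope continuousOn_id hf fun u hu => (fam_ne_and_Q_pos hα hu.1 hu.2).2.ne'
    have hr : ContinuousOn (fun y => n.fam α y / y) (Icc α (n.finish α) \ {n.xP}) :=
      hf.div continuousOn_id fun u hu => (hpos u hu).ne'
    have hc : ContinuousOn (fun y => n.slopeDeriv y (n.fam α y)) (Icc α (n.finish α) \ {n.xP}) := by
      refine ((n.continuous_Psi.comp_continuousOn (hr.prodMk hk)).neg).div ?_ fun u hu => ?_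
      · exact (by unfold rho; fun_prop : Continuous fun u : ℝ × ℝ => n.rho u.1 u.2).comp_continuousOn
          (continuousOn_id.prodMk hr)
      · exact (rho_pos (hpos u hu) (pos_of_P_nonneg (hpos u hu) (P_fam_nonneg hα hu.1))
          (fam_ne_and_Q_pos hα hu.1 hu.2).1).ne'
    refine (hc x ⟨hx, h⟩).mono_of_mem_nhdsWithin ?_
    filter_upwards [self_mem_nhdsWithin,
      mem_nhdsWithin_of_mem_nhds (isOpen_ne.mem_nhds h)] with y hy hy'
    exact ⟨hy, hy'⟩

theorem hasDerivWithinAt_fam {α x : ℝ} (hα : α ∈ Ioo 0 n.xN) (hx : x ∈ Icc α (n.finish α)) :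
    HasDerivWithinAt (n.fam α) (n.famSlope α x) (Icc α (n.finish α)) x := by
  refine hasDerivWithinAt_Icc_of_ne n.xP (continuousOn_fam hα) (fun y hy hne => ?_)
    (continuousOn_famSlope hα) hx
  rw [famSlope_of_ne hne]
  exact (fam_equation hα hy hne).2.2

theorem hasDerivAt_fam {α x : ℝ} (hα : α ∈ Ioo 0 n.xN) (hx : x ∈ Ioo α (n.finish α)) :
    HasDerivAt (n.fam α) (n.famSlope α x) x :=
  (hasDerivWithinAt_fam hα (Ioo_subset_Icc_self hx)).hasDerivAt (Icc_mem_nhds hx.1 hx.2)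

theorem hasDerivWithinAt_famSlope {α x : ℝ} (hα : α ∈ Ioo 0 n.xN)
    (hx : x ∈ Icc α (n.finish α)) :
    HasDerivWithinAt (n.famSlope α) (n.famCurv α x) (Icc α (n.finish α)) x := by
  refine hasDerivWithinAt_Icc_of_ne n.xP (continuousOn_famSlope hα) (fun y hy hne => ?_)
    (continuousOn_famCurv hα) hx
  have h1 := fam_equation hα hy hne
  have hy0 := hα.1.trans hy.1
  have h2 := Reduced.hasDerivAt_slope hy0 (pos_of_P_nonneg hy0 h1.1.le) h1.2.1.ne'
    (fam_ne_and_Q_pos hα (Ioo_subset_Icc_self hy) hne).1 h1.2.2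
  rw [famCurv, if_neg hne]
  refine h2.congr_of_eventuallyEq ?_
  filter_upwards [isOpen_ne.mem_nhds hne] with z hz
  exact famSlope_of_ne hz

theorem contDiffOn_two_fam {α : ℝ} (hα : α ∈ Ioo 0 n.xN) :
    ContDiffOn ℝ 2 (n.fam α) (Icc α (n.finish α)) :=
  contDiffOn_two_of_hasDerivWithinAt (lt_finish hα) (fun _ hx => hasDerivWithinAt_fam hα hx)
    (fun _ hx => hasDerivWithinAt_famSlope hα hx) (continuousOn_famCurv hα)

/-- Bootstrapping: the derivative is `p P / Q` along the solution with `Q > 0` up to both ends, so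
each order of smoothness yields the next. -/
theorem contDiffOn_infty_fam {α : ℝ} (hα : α ∈ Ioo n.xP n.xN) :
    ContDiffOn ℝ (⊤ : ℕ∞) (n.fam α) (Icc α (n.finish α)) := by
  have hα' : α ∈ Ioo 0 n.xN := ⟨n.xP_pos.trans hα.1, hα.2⟩
  have hu := uniqueDiffOn_Icc (lt_finish hα')
  have hne : ∀ x ∈ Icc α (n.finish α), x ≠ n.xP := fun x hx => (hα.1.trans_le hx.1).ne'
  rw [contDiffOn_infty]
  intro k
  induction k with
  | zero => exact contDiffOn_zero.2 (continuousOn_fam hα')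
  | succ k ih =>
    have hd : ∀ x ∈ Icc α (n.finish α), derivWithin (n.fam α) (Icc α (n.finish α)) x
        = n.p * n.P x (n.fam α x) / n.Q x (n.fam α x) := fun x hx => by
      rw [(hasDerivWithinAt_fam hα' hx).derivWithin (hu x hx), famSlope_of_ne (hne x hx), slope]
    push_cast
    rw [contDiffOn_succ_iff_derivWithin hu]
    refine ⟨fun x hx => (hasDerivWithinAt_fam hα' hx).differentiableWithinAt,
      fun h => by simp at h, ContDiffOn.congr ?_ hd⟩
    have hid : ContDiffOn ℝ k (fun x : ℝ => x) (Icc α (n.finish α)) := contDiffOn_id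
    have hP : ContDiffOn ℝ k (fun x => n.P x (n.fam α x)) (Icc α (n.finish α)) := by
      unfold P; fun_prop
    have hQ : ContDiffOn ℝ k (fun x => n.Q x (n.fam α x)) (Icc α (n.finish α)) := by
      unfold Q; fun_prop
    exact (contDiffOn_const.mul hP).div hQ fun x hx =>
      (fam_ne_and_Q_pos hα' hx (hne x hx)).2.ne'

theorem famSlope_pos {α x : ℝ} (hα : α ∈ Ioo 0 n.xN) (hx : x ∈ Ioo α (n.finish α)) :
    0 < n.famSlope α x := by
  rcases eq_or_ne x n.xP with h | h
  · subst h
    rw [famSlope_xP]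
    exact m_pos (fam_right hα hx.1.le hx.2).1
  · have h1 := fam_equation hα hx h
    rw [famSlope_of_ne h, slope]
    exact div_pos (mul_pos n.p_pos h1.1) h1.2.1

theorem fam_xP_of_mem {α : ℝ} (hα : α ∈ Ioo 0 n.xN) (hP : α ≤ n.xP) : n.fam α n.xP = n.xP := by
  rcases hP.eq_or_lt with h | h
  · subst h; rw [fam_of_le le_rfl, rightFam_xP_xP]
  · exact fam_xP h

/-- The level relation and the definiteness condition along `fam α`. -/
theorem fam_level {α x : ℝ} (hα : α ∈ Ioo 0 n.xN) (hx : x ∈ Ioo α (n.finish α)) :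
    n.p * n.P x (n.fam α x) = n.famSlope α x * n.Q x (n.fam α x) ∧
    0 < n.p * n.fam α x - n.famSlope α x * x + (1 - n.p) * n.famSlope α x * n.fam α x := by
  have hp := n.p_pos
  rcases eq_or_ne x n.xP with h | h
  · subst h
    rw [famSlope_xP, fam_xP_of_mem hα hx.1.le, P_xP, Q_xP]
    refine ⟨by ring, ?_⟩
    have := mul_pos (mul_pos hp n.xP_pos) (sub_pos.2 n.m_lt_one)
    linarith
  · obtain ⟨h1, h2, -⟩ := fam_equation hα hx h
    have hne := (fam_ne_and_Q_pos hα (Ioo_subset_Icc_self hx) h).1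
    have hx0 := hα.1.trans hx.1
    rw [famSlope_of_ne h]
    have hk : n.p * n.P x (n.fam α x) = n.slope x (n.fam α x) * n.Q x (n.fam α x) := by
      rw [slope]; field_simp
    refine ⟨hk, ?_⟩
    have hkey := n.key x (n.fam α x)
    set w := n.fam α x
    set k := n.slope x w
    have e : (n.p * w - k * x + (1 - n.p) * k * w) * n.Q x w = n.p * n.a * x * (w - x) ^ 2 := by
      linear_combination n.p * hkey - ((1 - n.p) * w - x) * hk
    have : w - x ≠ 0 := sub_ne_zero.2 hne
    have ha := n.a_pos
    refine pos_of_mul_pos_left ?_ h2.le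
    rw [e]; positivity

theorem famSlope_start {α : ℝ} (hα : α ∈ Ioo 0 n.xN) (hne : α ≠ n.xP) : n.famSlope α α = 0 := by
  rw [famSlope_of_ne hne, fam_start hα]
  exact slope_eq_zero (P_top ((disc_nonneg_iff hα.1).2 (hα.2.trans n.xN_lt_xE).le))

theorem famSlope_finish {α : ℝ} (hα : α ∈ Ioo 0 n.xN) : n.famSlope α (n.finish α) = 0 := by
  rcases lt_or_ge α n.xP with h | h
  · rcases n.a_le.eq_or_lt with ha | ha
    · rw [finish_of_eq h ha, famSlope_xP, m, ha, sub_self, mul_zero, zero_div]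
    · have hs := exit_spec (xP_mem ha)
      rw [finish_of_lt h ha, famSlope_of_ne hs.1.1.ne', fam_eq_singSol h hs.1.1.le]
      exact slope_eq_zero hs.2.2.1
  · have hs := exit_spec (n := n) ⟨h, hα.2⟩
    rw [finish_of_le h, famSlope_of_ne (h.trans_lt hs.1.1).ne', fam_of_le h]
    exact slope_eq_zero hs.2.2.1

end Reduced
end
end ShadowODE

namespace ShadowODE
noncomputable section

/-- Integration by parts. It replaces the derivative by values of the solution, whose dependence on
the start is controlled. -/
theorem integral_deriv_div {h d : ℝ → ℝ} {u v : ℝ} (hu : 0 < u) (huv : u ≤ v)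
    (hc : ContinuousOn h (Icc u v)) (hd : ∀ x ∈ Ioo u v, HasDerivAt h (d x) x)
    (hdc : ContinuousOn d (Icc u v)) :
    ∫ x in u..v, d x / x = h v / v - h u / u + ∫ x in u..v, h x / x ^ 2 := by
  have h0 : ∀ x ∈ Icc u v, x ≠ 0 := fun x hx => (hu.trans_le hx.1).ne'
  have hi1 : IntervalIntegrable (fun x => d x / x) MeasureTheory.volume u v := by
    refine ContinuousOn.intervalIntegrable ?_
    rw [uIcc_of_le huv]; exact hdc.div continuousOn_id h0
  have hi2 : IntervalIntegrable (fun x => h x / x ^ 2) MeasureTheory.volume u v := by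
    refine ContinuousOn.intervalIntegrable ?_
    rw [uIcc_of_le huv]
    exact hc.div (by fun_prop) fun x hx => pow_ne_zero 2 (h0 x hx)
  have := intervalIntegral.integral_eq_sub_of_hasDerivAt_of_le huv
    (f := fun x => h x / x) (f' := fun x => d x / x - h x / x ^ 2) (hc.div continuousOn_id h0)
    (fun x hx => ?_) (hi1.sub hi2)
  · rw [intervalIntegral.integral_sub hi1 hi2] at this
    linarith
  · have hx0 := h0 x (Ioo_subset_Icc_self hx)
    refine ((hd x hx).fun_div (hasDerivAt_id' x) hx0).congr_deriv ?_
    field_simp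

namespace Reduced
variable {n : Reduced}

/-! ### The integral condition -/

/-- The integral whose value is prescribed in the free-boundary problem. -/
def famIntegral (n : Reduced) (α : ℝ) : ℝ :=
  ∫ x in α..n.finish α, n.famSlope α x / x

theorem intervalIntegrable_famSlope {α : ℝ} (hα : α ∈ Ioo 0 n.xN) :
    IntervalIntegrable (fun x => n.famSlope α x / x) MeasureTheory.volume α (n.finish α) := by
  refine ContinuousOn.intervalIntegrable ?_
  rw [uIcc_of_le (lt_finish hα).le]
  exact (continuousOn_famSlope hα).div continuousOn_id fun x hx => (hα.1.trans_le hx.1).ne'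

theorem fam_of_le_start {α x : ℝ} (hα : α ∈ Ioo 0 n.xN) (hx : x ≤ α) :
    n.fam α x = n.top α := by
  rcases lt_or_ge α n.xP with h | h
  · rw [fam_of_lt h, leftSol_of_le hx]
  · rw [fam_of_le h, rightFam_of_le ⟨h, hα.2⟩ hx]

theorem fam_of_finish_le {α x : ℝ} (hα : α ∈ Ioo 0 n.xN) (hx : x ∈ Icc (n.finish α) n.xE) :
    n.fam α x = n.fam α (n.finish α) := by
  rcases lt_or_ge α n.xP with h | h
  · rcases n.a_le.eq_or_lt with ha | ha
    · rw [finish_of_eq h ha] at hx ⊢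
      rw [fam_xP h, fam_of_lt h, leftSol_of_xP_le h hx.1, singSol, if_pos (Or.inr ha.ge)]
    · have hs := exit_spec (xP_mem ha)
      rw [finish_of_lt h ha] at hx ⊢
      rw [fam_eq_singSol h (hs.1.1.le.trans hx.1), fam_eq_singSol h hs.1.1.le]
      exact hs.2.2.2.2.1 x hx
  · have hs := exit_spec (n := n) ⟨h, hα.2⟩
    rw [finish_of_le h] at hx ⊢
    rw [fam_of_le h]
    exact hs.2.2.2.2.1 x hx

theorem fam_mem {α x : ℝ} (hα : α ∈ Ioo 0 n.xN) (hx : x ≤ n.xE) : n.fam α x ∈ Ioc 0 n.wN := by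
  have h0 : ∀ y ∈ Icc α (n.finish α), n.fam α y ∈ Ioc 0 n.wN := fun y hy =>
    ⟨pos_of_P_nonneg (hα.1.trans_le hy.1) (P_fam_nonneg hα hy),
      le_wN (hα.1.trans_le hy.1) (P_fam_nonneg hα hy)⟩
  rcases le_total x α with h | h
  · rw [fam_of_le_start hα h, ← fam_start hα]; exact h0 α ⟨le_rfl, (lt_finish hα).le⟩
  · rcases le_total x (n.finish α) with h' | h'
    · exact h0 x ⟨h, h'⟩
    · rw [fam_of_finish_le hα ⟨h', hx⟩]; exact h0 _ ⟨(lt_finish hα).le, le_rfl⟩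

theorem continuousOn_fam_Icc {α x₀ : ℝ} (hα : α ∈ Ioo 0 n.xN) (hx₀ : x₀ ≤ α) :
    ContinuousOn (n.fam α) (Icc x₀ n.xE) := by
  have h1 : ContinuousOn (n.fam α) (Icc x₀ α) :=
    (continuousOn_const (c := n.top α)).congr fun _ hx => fam_of_le_start hα hx.2
  have h2 : ContinuousOn (n.fam α) (Icc (n.finish α) n.xE) :=
    (continuousOn_const (c := n.fam α (n.finish α))).congr fun _ hx => fam_of_finish_le hα hx
  have h3 := (h1.union_of_isClosed (continuousOn_fam hα) isClosed_Icc isClosed_Icc)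
  rw [Icc_union_Icc_eq_Icc hx₀ (lt_finish hα).le] at h3
  have h4 := h3.union_of_isClosed h2 isClosed_Icc isClosed_Icc
  rwa [Icc_union_Icc_eq_Icc (hx₀.trans (lt_finish hα).le) (finish_le hα)] at h4

/-- Outside `[α, finish α]` the extended solution is constant and contributes nothing to the
integral of `h' / x`, so the integration limits no longer depend on `α`. -/
theorem famIntegral_eq {α x₀ : ℝ} (hα : α ∈ Ioo 0 n.xN) (h0 : 0 < x₀) (hx₀ : x₀ ≤ α) :
    n.famIntegral α = n.fam α n.xE / n.xE - n.top α / x₀ + ∫ x in x₀..n.xE, n.fam α x / x ^ 2 := by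
  have hβ := lt_finish hα
  have hβE := finish_le hα
  have hβ0 : 0 < n.finish α := hα.1.trans hβ
  have hc := continuousOn_fam_Icc hα hx₀
  have hi : ∀ u v, u ∈ Icc x₀ n.xE → v ∈ Icc x₀ n.xE →
      IntervalIntegrable (fun x => n.fam α x / x ^ 2) MeasureTheory.volume u v := by
    intro u v hu hv
    refine ContinuousOn.intervalIntegrable ?_
    have hsub : uIcc u v ⊆ Icc x₀ n.xE := uIcc_subset_Icc hu hv
    exact (hc.mono hsub).div (by fun_prop) fun x hx => pow_ne_zero 2 (h0.trans_le (hsub hx).1).ne'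
  have e1 := integral_deriv_div (d := fun _ => 0) h0 hx₀
    (hc.mono (Icc_subset_Icc_right (hβ.le.trans hβE))) (fun x hx => by
      refine (hasDerivAt_const x (n.top α)).congr_of_eventuallyEq ?_
      filter_upwards [gt_mem_nhds hx.2] with y hy
      exact fam_of_le_start hα hy.le) continuousOn_const
  have e2 := integral_deriv_div hα.1 hβ.le (continuousOn_fam hα)
    (fun x hx => hasDerivAt_fam hα hx) (continuousOn_famSlope hα)
  have e3 := integral_deriv_div (d := fun _ => 0) hβ0 hβE
    (hc.mono (Icc_subset_Icc_left (hx₀.trans hβ.le))) (fun x hx => by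
      refine (hasDerivAt_const x (n.fam α (n.finish α))).congr_of_eventuallyEq ?_
      filter_upwards [Ioo_mem_nhds hx.1 hx.2] with y hy
      exact fam_of_finish_le hα (Ioo_subset_Icc_self hy)) continuousOn_const
  simp only [zero_div, intervalIntegral.integral_zero] at e1 e3
  have m0 : x₀ ∈ Icc x₀ n.xE := ⟨le_rfl, hx₀.trans (hβ.le.trans hβE)⟩
  have m1 : α ∈ Icc x₀ n.xE := ⟨hx₀, hβ.le.trans hβE⟩
  have m2 : n.finish α ∈ Icc x₀ n.xE := ⟨hx₀.trans hβ.le, hβE⟩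
  have m3 : n.xE ∈ Icc x₀ n.xE := ⟨hx₀.trans (hβ.le.trans hβE), le_rfl⟩
  have s1 := intervalIntegral.integral_add_adjacent_intervals (hi _ _ m0 m1) (hi _ _ m1 m2)
  have s2 := intervalIntegral.integral_add_adjacent_intervals (hi _ _ m0 m2) (hi _ _ m2 m3)
  rw [fam_of_le_start hα hx₀] at e1
  rw [famIntegral, e2, ← s2, ← s1]
  linarith

/-- At `α = xP` and `x > xP`, continuity from the left is trivial, since all left solutions coincide
there, and from the right it is the definition of `singSol` as a limit. The omitted abscissa `xP` is
a null set for the integral. -/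
theorem continuousAt_fam {α x : ℝ} (hα : α ∈ Ioo 0 n.xN) (hx : x ∈ Ioc 0 n.xE) (hne : x ≠ n.xP) :
    ContinuousAt (fun α => n.fam α x) α := by
  have htop : x < α → ContinuousAt (fun α => n.fam α x) α := by
    intro h
    refine n.continuous_top.continuousAt.congr ?_
    filter_upwards [Ioo_mem_nhds hα.1 hα.2, lt_mem_nhds h] with α' h1 h2
    exact (fam_of_le_start h1 h2.le).symm
  rcases lt_trichotomy α n.xP with h | h | h
  · rcases lt_or_gt_of_ne hne with hx' | hx'
    · refine (continuousAt_leftSol ⟨hα.1, h⟩ ⟨hx.1, hx'⟩).congr ?_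
      filter_upwards [gt_mem_nhds h] with α' h1
      rw [fam_of_lt h1]
    · refine (continuousAt_const (y := n.rightFam n.xP x)).congr ?_
      filter_upwards [gt_mem_nhds h] with α' h1
      exact (fam_eq_singSol h1 hx'.le).symm
  · rcases lt_or_gt_of_ne hne with hx' | hx'
    · exact htop (by rwa [h])
    · have ha := lt_of_mem_Ico (n := n) ⟨h.ge, hα.2⟩
      have hval : n.fam α x = n.singSol x := by rw [fam_of_le h.ge, h, rightFam_xP]
      rw [continuousAt_iff_continuous_left'_right', ContinuousWithinAt, ContinuousWithinAt, hval, h]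
      constructor
      · refine tendsto_const_nhds.congr' ?_
        filter_upwards [self_mem_nhdsWithin] with α' h1
        rw [fam_eq_singSol h1 hx'.le, rightFam_xP]
      · refine (tendsto_rightSol ha ⟨hx', hx.2⟩).congr' ?_
        filter_upwards [self_mem_nhdsWithin] with α' h1
        rw [fam_of_le (le_of_lt h1), rightFam_of_lt h1]
  · rcases lt_or_gt_of_ne hne with hx' | hx'
    · exact htop (hx'.trans h)
    · refine (continuousAt_rightSol ⟨h, hα.2⟩ ⟨hx', hx.2⟩).congr ?_
      filter_upwards [lt_mem_nhds h] with α' h1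
      rw [fam_of_le h1.le, rightFam_of_lt h1]

/-- Dominated convergence in `famIntegral_eq` with `x₀ = α / 2`, which stays below all nearby starts
and away from zero. -/
theorem continuousOn_famIntegral : ContinuousOn n.famIntegral (Ioo 0 n.xN) := by
  intro α hα
  refine ContinuousAt.continuousWithinAt ?_
  have h0 : 0 < α / 2 := half_pos hα.1
  have h1 : α / 2 < α := half_lt_self hα.1
  have hE := n.xE_pos
  have hαE : α / 2 ≤ n.xE := h1.le.trans ((lt_finish hα).le.trans (finish_le hα))
  have hev : ∀ᶠ α' in 𝓝 α, α' ∈ Ioo 0 n.xN ∧ α / 2 < α' :=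
    (eventually_mem_set.2 (Ioo_mem_nhds hα.1 hα.2)).and (lt_mem_nhds h1)
  have hint : ContinuousAt (fun α' => ∫ x in (α / 2)..n.xE, n.fam α' x / x ^ 2) α := by
    refine intervalIntegral.continuousAt_of_dominated_interval
      (bound := fun _ => n.wN / (α / 2) ^ 2) ?_ ?_ intervalIntegrable_const ?_
    · filter_upwards [hev] with α' h'
      have hc := (continuousOn_fam_Icc h'.1 h'.2.le).div (continuousOn_id.pow 2)
        fun x hx => pow_ne_zero 2 (h0.trans_le hx.1).ne'
      rw [uIoc_of_le hαE]
      exact (hc.mono Ioc_subset_Icc_self).aestronglyMeasurable measurableSet_Ioc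
    · filter_upwards [hev] with α' h'
      refine Eventually.of_forall fun x hx => ?_
      rw [uIoc_of_le hαE] at hx
      have hm := fam_mem h'.1 hx.2
      have hx0 := h0.trans hx.1
      rw [Real.norm_of_nonneg (div_nonneg hm.1.le (sq_nonneg x))]
      have := hx.1.le
      exact div_le_div₀ n.wN_pos.le hm.2 (by positivity) (by gcongr)
    · have hae : ∀ᵐ x : ℝ ∂MeasureTheory.volume, x ≠ n.xP := by
        simp [MeasureTheory.ae_iff]
      filter_upwards [hae] with x hne hx
      rw [uIoc_of_le hαE] at hx
      exact (continuousAt_fam hα ⟨h0.trans hx.1, hx.2⟩ hne).div_const _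
  have hmain : ContinuousAt (fun α' => n.fam α' n.xE / n.xE - n.top α' / (α / 2)
      + ∫ x in (α / 2)..n.xE, n.fam α' x / x ^ 2) α :=
    (((continuousAt_fam hα ⟨hE, le_rfl⟩ n.xP_lt_xE.ne').div_const _).sub
      (n.continuous_top.continuousAt.div_const _)).add hint
  refine hmain.congr ?_
  filter_upwards [hev] with α' h'
  exact (famIntegral_eq h'.1 h0 h'.2.le).symm

theorem integral_famSlope {α : ℝ} (hα : α ∈ Ioo 0 n.xN) :
    ∫ x in α..n.finish α, n.famSlope α x = n.fam α (n.finish α) - n.top α := by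
  rw [← fam_start hα]
  refine intervalIntegral.integral_eq_sub_of_hasDerivAt_of_le (lt_finish hα).le
    (continuousOn_fam hα) (fun x hx => hasDerivAt_fam hα hx) ?_
  refine ContinuousOn.intervalIntegrable ?_
  rw [uIcc_of_le (lt_finish hα).le]
  exact continuousOn_famSlope hα

theorem famSlope_nonneg {α x : ℝ} (hα : α ∈ Ioo 0 n.xN) (hx : x ∈ Icc α (n.finish α)) :
    0 ≤ n.famSlope α x := by
  rcases eq_or_ne x n.xP with h | h
  · subst h; rw [famSlope_xP]; exact n.m_nonneg
  · rw [famSlope_of_ne h, slope]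
    exact div_nonneg (mul_nonneg n.p_pos.le (P_fam_nonneg hα hx)) (fam_ne_and_Q_pos hα hx h).2.le

theorem famIntegral_nonneg {α : ℝ} (hα : α ∈ Ioo 0 n.xN) : 0 ≤ n.famIntegral α :=
  intervalIntegral.integral_nonneg (lt_finish hα).le fun _ hx =>
    div_nonneg (famSlope_nonneg hα hx) (hα.1.le.trans hx.1)

/-- `1 / x ≤ 1 / α`, and the solution rises from `top α` to at most `wN`. -/
theorem famIntegral_le {α : ℝ} (hα : α ∈ Ioo 0 n.xN) :
    n.famIntegral α ≤ (n.wN - n.top α) / α := by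
  have hi : IntervalIntegrable (n.famSlope α) MeasureTheory.volume α (n.finish α) := by
    refine ContinuousOn.intervalIntegrable ?_
    rw [uIcc_of_le (lt_finish hα).le]
    exact continuousOn_famSlope hα
  have h1 : n.famIntegral α ≤ ∫ x in α..n.finish α, n.famSlope α x / α := by
    refine intervalIntegral.integral_mono_on (lt_finish hα).le (intervalIntegrable_famSlope hα)
      (hi.div_const α) fun x hx => ?_
    exact div_le_div_of_nonneg_left (famSlope_nonneg hα hx) hα.1 hx.1
  rw [intervalIntegral.integral_div, integral_famSlope hα] at h1
  refine h1.trans ?_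
  have h2 := (fam_mem hα (finish_le hα)).2
  have := hα.1
  gcongr

theorem tendsto_famIntegral_xN : Tendsto n.famIntegral (𝓝[<] n.xN) (𝓝 0) := by
  have hev : ∀ᶠ α in 𝓝[<] n.xN, α ∈ Ioo 0 n.xN := Ioo_mem_nhdsLT n.xN_pos
  have hlim : Tendsto (fun α => (n.wN - n.top α) / α) (𝓝[<] n.xN) (𝓝 0) := by
    have h1 : Tendsto (fun α => (n.wN - n.top α) / α) (𝓝 n.xN)
        (𝓝 ((n.wN - n.top n.xN) / n.xN)) :=
      ((n.continuous_top.tendsto _).const_sub _).div tendsto_id n.xN_pos.ne'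
    rw [top_xN, sub_self, zero_div] at h1
    exact h1.mono_left nhdsWithin_le_nhds
  exact squeeze_zero' (hev.mono fun α hα => famIntegral_nonneg hα)
    (hev.mono fun α hα => famIntegral_le hα) hlim

theorem exists_gap_rootJ : ∃ c > 0, ∀ x ∈ Icc 0 (n.xP / 2), c ≤ n.rootJ x - x := by
  have h0 : (Icc 0 (n.xP / 2)).Nonempty := ⟨0, le_rfl, (half_pos n.xP_pos).le⟩
  obtain ⟨x, hx, hmin⟩ := isCompact_Icc.exists_isMinOn h0
    ((n.continuous_rootJ.sub continuous_id).continuousOn)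
  refine ⟨n.rootJ x - x, ?_, fun y hy => hmin hy⟩
  have hxP := n.xP_pos
  rcases hx.1.eq_or_lt with h | h
  · rw [← h, rootJ]
    have := n.one_sub_p_pos
    have := n.e_pos
    simp only [mul_zero, zero_pow two_ne_zero, add_zero, zero_sub, sub_zero, mul_one]
    have h3 := Real.sqrt_nonneg ((-(2 * (1 - n.p))) ^ 2)
    positivity
  · exact sub_pos.2 (lt_rootJ h (by linarith [hx.2]))

/-- `P / x` along the solution starts at `0` and is bounded at `xP / 2`. Its derivative is at least
`2 a c / x` minus a multiple of `k / x`: the gap above the diagonal bounds the source below, and `Q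
= O(x)` bounds `P / x²` by `k / x`. Integrated, the logarithm must be absorbed by the integral of `k
/ x`. -/
theorem exists_famIntegral_lower : ∃ c M C : ℝ, 0 < c ∧ 0 < C ∧ ∀ α ∈ Ioo 0 (n.xP / 2),
    c * Real.log (n.xP / 2 / α) - M ≤ C * n.famIntegral α := by
  obtain ⟨c, hc, hgap⟩ := n.exists_gap_rootJ
  have hp := n.p_pos
  have he := n.e_pos
  have ha := n.a_pos
  have hμ := n.μ_pos
  have hw := n.wN_pos
  have hxP := n.xP_pos
  set x₀ := n.xP / 2 with hx₀
  have hx₀' : 0 < x₀ := half_pos hxP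
  set B := 2 + 2 * (n.μ - n.a) * x₀ with hB
  have hB0 : 0 < B := by
    have : 0 ≤ 2 * (n.μ - n.a) * x₀ := mul_nonneg (by linarith [n.a_le]) hx₀'.le
    linarith
  refine ⟨2 * n.a * c, (2 * n.wN + 2 * n.μ * x₀ * n.wN) / x₀, 4 * n.e * n.wN + B / n.p,
    by positivity, by positivity, fun α hα => ?_⟩
  have hαP : α < n.xP := by linarith [hα.2]
  have hα' : α ∈ Ioo 0 n.xN := ⟨hα.1, hαP.trans_le n.xP_le_xN⟩
  have hsubI : Icc α x₀ ⊆ Icc α (n.finish α) :=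
    Icc_subset_Icc_right (le_trans (by linarith) (xP_le_finish hα'))
  have hlt : ∀ x ∈ Icc α x₀, x < n.xP := fun x hx => by linarith [hx.2]
  set h := n.fam α with hh
  set k := fun x => n.slope x (h x) with hk
  have hcont : ContinuousOn h (Icc α x₀) := (continuousOn_fam hα').mono hsubI
  have hP : ∀ x ∈ Icc α x₀, 0 ≤ n.P x (h x) := fun x hx => P_fam_nonneg hα' (hsubI hx)
  have hQ : ∀ x ∈ Icc α x₀, 0 < n.Q x (h x) := fun x hx =>
    (fam_ne_and_Q_pos hα' (hsubI hx) (hlt x hx).ne).2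
  have hwN : ∀ x ∈ Icc α x₀, h x ≤ n.wN := fun x hx => le_wN (hα.1.trans_le hx.1) (hP x hx)
  have hw0 : ∀ x ∈ Icc α x₀, 0 < h x := fun x hx =>
    pos_of_P_nonneg (hα.1.trans_le hx.1) (hP x hx)
  have hkc : ContinuousOn k (Icc α x₀) :=
    continuousOn_slope continuousOn_id hcont fun u hu => (hQ u hu).ne'
  have hk0 : ∀ x ∈ Icc α x₀, 0 ≤ k x := fun x hx =>
    div_nonneg (mul_nonneg hp.le (hP x hx)) (hQ x hx).le
  have hne0 : ∀ x ∈ Icc α x₀, x ≠ 0 := fun x hx => (hα.1.trans_le hx.1).ne'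
  have hki : IntervalIntegrable (fun x => k x / x) MeasureTheory.volume α x₀ := by
    refine ContinuousOn.intervalIntegrable ?_
    rw [uIcc_of_le hα.2.le]; exact hkc.div continuousOn_id hne0
  have hinvi : IntervalIntegrable (fun x : ℝ => 1 / x) MeasureTheory.volume α x₀ := by
    refine ContinuousOn.intervalIntegrable ?_
    rw [uIcc_of_le hα.2.le]; exact continuousOn_const.div continuousOn_id hne0
  -- the derivative of `P / x`
  set f' : ℝ → ℝ := fun x => (n.diffP x (h x) (h x) * k x + 2 * (n.μ * h x - n.a * x)) / x
    - n.P x (h x) / x ^ 2 with hf'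
  have hPc : ContinuousOn (fun x => n.P x (h x)) (Icc α x₀) :=
    n.continuous_P.comp_continuousOn (continuousOn_id.prodMk hcont)
  have hf'i : IntervalIntegrable f' MeasureTheory.volume α x₀ := by
    refine ContinuousOn.intervalIntegrable ?_
    rw [uIcc_of_le hα.2.le]
    refine (ContinuousOn.div ?_ continuousOn_id hne0).sub
      (hPc.div (by fun_prop) fun x hx => pow_ne_zero 2 (hne0 x hx))
    unfold diffP
    fun_prop
  have hFTC := intervalIntegral.integral_eq_sub_of_hasDerivAt_of_le hα.2.le
    (f := fun x => n.P x (h x) / x) (f' := f') (hPc.div continuousOn_id hne0) (fun x hx => by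
      have hx' := Ioo_subset_Icc_self hx
      have hder := hasDerivAt_fam hα' ⟨hx.1, (hlt x hx').trans_le (xP_le_finish hα')⟩
      rw [famSlope_of_ne (hlt x hx').ne] at hder
      refine ((hasDerivAt_P (n := n) hder).fun_div (hasDerivAt_id' x) (hne0 x hx')).congr_deriv ?_
      have := hne0 x hx'
      simp only [hf', hk, hh]
      field_simp) hf'i
  have hlow : ∫ x in α..x₀, (2 * n.a * c * (1 / x) - (4 * n.e * n.wN + B / n.p) * (k x / x))
      ≤ ∫ x in α..x₀, f' x := by
    refine intervalIntegral.integral_mono_on hα.2.le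
      ((hinvi.const_mul _).sub (hki.const_mul _)) hf'i fun x hx => ?_
    have hx0 := hα.1.trans_le hx.1
    have hkx := hk0 x hx
    have e1 : n.a * c ≤ n.μ * h x - n.a * x := by
      have h1 := hgap x ⟨hx0.le, hx.2⟩
      have h2 : n.rootJ x ≤ h x := by
        rw [hh, fam_of_lt hαP]; exact (leftSol_mem hα.1 ⟨hx.1, hlt x hx⟩).1
      have h3 := mul_le_mul_of_nonneg_right n.a_le (hw0 x hx).le
      nlinarith
    have e2 : -(4 * n.e * n.wN) * k x ≤ n.diffP x (h x) (h x) * k x := by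
      refine mul_le_mul_of_nonneg_right ?_ hkx
      rw [diffP]
      have := mul_le_mul_of_nonneg_left (hwN x hx) he.le
      have := mul_pos hμ hx0
      nlinarith
    have e3 : n.P x (h x) ≤ B / n.p * k x * x := by
      have h1 : n.p * n.P x (h x) = k x * n.Q x (h x) := by
        have := (hQ x hx).ne'
        simp only [hk, slope]; field_simp
      have h2 : n.Q x (h x) ≤ B * x := by
        rw [Q, hB]
        have h3 : 0 ≤ (1 - n.p) * n.P x (h x) := mul_nonneg n.one_sub_p_pos.le (hP x hx)
        have h4 : 0 ≤ (2 * n.e - n.a) * h x := mul_nonneg (by linarith [n.a_lt]) (hw0 x hx).le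
        have h5 : 2 * (n.μ - n.a) * x ≤ 2 * (n.μ - n.a) * x₀ :=
          mul_le_mul_of_nonneg_left hx.2 (by linarith [n.a_le])
        have h6 := mul_le_mul_of_nonneg_left
          (show 2 + 2 * (n.μ - n.a) * x - (2 * n.e - n.a) * h x ≤ 2 + 2 * (n.μ - n.a) * x₀ by
            linarith) hx0.le
        linarith
      have h3 := mul_le_mul_of_nonneg_left h2 hkx
      rw [div_mul_eq_mul_div, div_mul_eq_mul_div, le_div_iff₀ hp]
      linarith
    have e4 : n.P x (h x) / x ^ 2 ≤ B / n.p * (k x / x) := by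
      rw [div_le_iff₀ (by positivity)]
      refine e3.trans_eq ?_
      field_simp
    have e5 : (2 * n.a * c - 4 * n.e * n.wN * k x) / x
        ≤ (n.diffP x (h x) (h x) * k x + 2 * (n.μ * h x - n.a * x)) / x := by
      gcongr
      linarith
    have e6 : (2 * n.a * c - 4 * n.e * n.wN * k x) / x
        = 2 * n.a * c * (1 / x) - 4 * n.e * n.wN * (k x / x) := by ring
    simp only [hf']
    linarith
  rw [hFTC, intervalIntegral.integral_sub (hinvi.const_mul _) (hki.const_mul _),
    intervalIntegral.integral_const_mul, intervalIntegral.integral_const_mul,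
    integral_one_div_of_pos hα.1 hx₀'] at hlow
  have hkle : ∫ x in α..x₀, k x / x ≤ n.famIntegral α := by
    have h1 : ∫ x in α..x₀, k x / x = ∫ x in α..x₀, n.famSlope α x / x := by
      refine intervalIntegral.integral_congr fun x hx => ?_
      rw [uIcc_of_le hα.2.le] at hx
      simp only [hk, hh]
      rw [famSlope_of_ne (hlt x hx).ne]
    rw [h1, famIntegral]
    refine intervalIntegral.integral_mono_interval le_rfl hα.2.le
      (le_trans (by linarith) (xP_le_finish hα')) ?_ (intervalIntegrable_famSlope hα')
    filter_upwards [MeasureTheory.ae_restrict_mem measurableSet_Ioc] with x hx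
    exact div_nonneg (famSlope_nonneg hα' (Ioc_subset_Icc_self hx)) (hα.1.trans hx.1).le
  have hPα : n.P α (h α) = 0 := by
    rw [hh, fam_start hα', P_top]
    exact (disc_nonneg_iff hα.1).2 (hα'.2.trans n.xN_lt_xE).le
  have hPx₀ : n.P x₀ (h x₀) ≤ 2 * n.wN + 2 * n.μ * x₀ * n.wN := by
    have h1 := hwN x₀ ⟨hα.2.le, le_rfl⟩
    have h2 : 2 * n.μ * x₀ * h x₀ ≤ 2 * n.μ * x₀ * n.wN :=
      mul_le_mul_of_nonneg_left h1 (by positivity)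
    rw [P]
    have h3 : 0 ≤ 2 * n.e * h x₀ ^ 2 := by positivity
    have h4 : 0 ≤ n.a * x₀ ^ 2 := by positivity
    linarith
  have hPx₀' : n.P x₀ (h x₀) / x₀ ≤ (2 * n.wN + 2 * n.μ * x₀ * n.wN) / x₀ := by gcongr
  simp only [hPα, zero_div, sub_zero] at hlow
  have hfin := mul_le_mul_of_nonneg_left hkle
    (show 0 ≤ 4 * n.e * n.wN + B / n.p by positivity)
  linarith

theorem tendsto_famIntegral_zero : Tendsto n.famIntegral (𝓝[>] 0) atTop := by
  obtain ⟨c, M, C, hc, hC, h⟩ := n.exists_famIntegral_lower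
  have hx : 0 < n.xP / 2 := half_pos n.xP_pos
  have h1 : Tendsto (fun α => n.xP / 2 / α) (𝓝[>] 0) atTop :=
    tendsto_inv_nhdsGT_zero.const_mul_atTop hx
  have h2 : Tendsto (fun α => (c * Real.log (n.xP / 2 / α) - M) / C) (𝓝[>] 0) atTop :=
    (tendsto_atTop_add_const_right _ (-M)
      ((Real.tendsto_log_atTop.comp h1).const_mul_atTop hc)).atTop_div_const hC
  refine tendsto_atTop_mono' _ ?_ h2
  filter_upwards [Ioo_mem_nhdsGT hx] with α hα
  rw [div_le_iff₀ hC]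
  linarith [h α hα]

/-- Every positive value is attained by the integral. -/
theorem exists_famIntegral_eq {l : ℝ} (hl : 0 < l) : ∃ α ∈ Ioo 0 n.xN, n.famIntegral α = l := by
  obtain ⟨α₁, h1, h1'⟩ := ((tendsto_famIntegral_zero (n := n)).eventually_ge_atTop l).and
    (Ioo_mem_nhdsGT n.xN_pos) |>.exists
  obtain ⟨α₂, h2, h2'⟩ := ((tendsto_famIntegral_xN (n := n)).eventually_le_const hl).and
    (Ioo_mem_nhdsLT n.xN_pos) |>.exists
  exact isPreconnected_Ioo.intermediate_value h2' h1' continuousOn_famIntegral ⟨h2, h1⟩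

end Reduced
end
end ShadowODE

/-! ### Back to the original parameters, and the equation with the infimum. -/

namespace ShadowODE
noncomputable section
namespace Params

/-! ### Reduction of the parameters -/

/-- The standing assumptions on the parameters. -/
structure Admissible (c : Params) : Prop where
  μ_pos : 0 < c.μ
  σ_pos : 0 < c.σ
  δ_pos : 0 < c.δ
  p_pos : 0 < c.p
  p_lt : c.p < 1
  μ_lt : c.μ < c.geo
  one_le : 1 ≤ c.merton

variable {c : Params}

theorem Admissible.one_sub_pos (h : c.Admissible) : 0 < 1 - c.p := by linarith [h.p_lt]

theorem Admissible.q_pos (h : c.Admissible) : 0 < c.q := div_pos h.p_pos h.one_sub_pos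

theorem Admissible.a_pos (h : c.Admissible) : 0 < (1 - c.p) * c.σ ^ 2 :=
  mul_pos h.one_sub_pos (pow_pos h.σ_pos 2)

/-- The parameters of the rescaled equation for `w = q z`. -/
def Admissible.reduce (h : c.Admissible) : Reduced where
  μ := c.μ
  a := (1 - c.p) * c.σ ^ 2
  e := c.δ / c.p
  p := c.p
  a_pos := h.a_pos
  a_le := by
    have := h.one_le
    rwa [merton, one_le_div h.a_pos] at this
  disc_lt := by
    have h1 := c.geo_sq h.δ_pos h.p_pos h.p_lt
    have h2 : c.μ ^ 2 < c.geo ^ 2 := pow_lt_pow_left₀ h.μ_lt h.μ_pos.le two_ne_zero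
    rw [h1] at h2
    exact h2.trans_eq (by ring)
  p_pos := h.p_pos
  p_lt := h.p_lt

theorem Admissible.lt_iff (h : c.Admissible) : h.reduce.a < h.reduce.μ ↔ 1 < c.merton := by
  rw [merton, one_lt_div h.a_pos]; rfl

theorem Admissible.eq_iff (h : c.Admissible) : h.reduce.a = h.reduce.μ ↔ c.merton = 1 := by
  rw [merton, div_eq_one_iff_eq h.a_pos.ne', eq_comm]; rfl

theorem Admissible.q_mul (h : c.Admissible) : c.q * (1 - c.p) = c.p :=
  div_mul_cancel₀ _ h.one_sub_pos.ne'

theorem Admissible.polyP_eq (h : c.Admissible) (x z : ℝ) :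
    c.polyP x z = (1 - c.p) * h.reduce.P x (c.q * z) := by
  have h1 := h.one_sub_pos
  have h2 := h.p_pos
  simp only [polyP, Reduced.P, Admissible.reduce, q]
  field_simp
  ring

theorem Admissible.polyQ_eq (h : c.Admissible) (x z : ℝ) :
    c.polyQ x z = h.reduce.Q x (c.q * z) := by
  have h1 := h.one_sub_pos
  have h2 := h.p_pos
  rw [polyQ, h.polyP_eq, Reduced.Q]
  simp only [Admissible.reduce, q]
  field_simp
  ring

theorem Admissible.L_eq (h : c.Admissible) (x z : ℝ) :
    c.q * c.L x z = h.reduce.slope x (c.q * z) := by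
  rw [L, h.polyP_eq, h.polyQ_eq, Reduced.slope, ← mul_div_assoc, ← mul_assoc, h.q_mul]
  rfl

theorem Admissible.xP_eq (h : c.Admissible) : h.reduce.xP = c.xP := by
  simp only [Reduced.xP, xP, ari, Admissible.reduce]
  have : 2 * (c.δ / c.p) + (1 - c.p) * c.σ ^ 2 - 2 * c.μ
    = 2 * (c.δ / c.p + (1 - c.p) * c.σ ^ 2 / 2 - c.μ) := by ring
  rw [this, div_mul_eq_div_div, div_self two_ne_zero]

theorem Admissible.xN_eq (h : c.Admissible) : h.reduce.xN = c.xN := by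
  rw [Reduced.xN, xN, c.geo_sq h.δ_pos h.p_pos h.p_lt]
  simp only [Admissible.reduce]
  congr 2
  ring

theorem Admissible.xE_eq (h : c.Admissible) : h.reduce.xE = c.xE := by
  rw [Reduced.xE, xE, geo]
  simp only [Admissible.reduce]
  congr 3
  ring

theorem Admissible.zP_eq (h : c.Admissible) : c.zP = h.reduce.xP / c.q := by
  rw [zP, h.xP_eq]

theorem Admissible.secondDerivP_eq (h : c.Admissible) :
    c.secondDerivP = h.reduce.curv / c.q := by
  have h1 := h.one_sub_pos
  have h2 := h.p_pos
  have h3 := h.reduce.a_lt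
  have h4 := h.reduce.two_mul_μ_lt
  simp only [Admissible.reduce] at h3 h4
  have h3' : 2 * c.δ - c.p * (1 - c.p) * c.σ ^ 2 ≠ 0 := by
    have : 0 < c.p * (2 * (c.δ / c.p) - (1 - c.p) * c.σ ^ 2) := mul_pos h2 (by linarith)
    have e : c.p * (2 * (c.δ / c.p) - (1 - c.p) * c.σ ^ 2)
      = 2 * c.δ - c.p * (1 - c.p) * c.σ ^ 2 := by field_simp
    rw [← e]; exact this.ne'
  have h4' : 2 * c.δ + c.p * (1 - c.p) * c.σ ^ 2 - 2 * c.p * c.μ ≠ 0 := by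
    have : 0 < c.p * (2 * (c.δ / c.p) + (1 - c.p) * c.σ ^ 2 - 2 * c.μ) := mul_pos h2 (by linarith)
    have e : c.p * (2 * (c.δ / c.p) + (1 - c.p) * c.σ ^ 2 - 2 * c.μ)
      = 2 * c.δ + c.p * (1 - c.p) * c.σ ^ 2 - 2 * c.p * c.μ := by field_simp
    rw [← e]; exact this.ne'
  have e3 : 2 * (c.δ / c.p) - (1 - c.p) * c.σ ^ 2
      = (2 * c.δ - c.p * (1 - c.p) * c.σ ^ 2) / c.p := by field_simp
  have e4 : 2 * (c.δ / c.p) + (1 - c.p) * c.σ ^ 2 - 2 * c.μ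
      = (2 * c.δ + c.p * (1 - c.p) * c.σ ^ 2 - 2 * c.p * c.μ) / c.p := by field_simp
  simp only [secondDerivP, Reduced.curv, Reduced.m, Reduced.xP, Admissible.reduce, q]
  rw [e3, e4]
  -- `u` and `v` are `p (2e - a)` and `p (2e + a - 2μ)`, the denominators in `m` and `xP`; in these
  -- terms `1 - m = v / u`.
  set u := 2 * c.δ - c.p * (1 - c.p) * c.σ ^ 2 with hu
  set v := 2 * c.δ + c.p * (1 - c.p) * c.σ ^ 2 - 2 * c.p * c.μ with hv
  have ev : 2 * c.δ - 2 * c.p * c.μ + c.p * (1 - c.p) * c.σ ^ 2 = v := by rw [hv]; ring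
  rw [ev]
  have e1 : 1 - 2 * (c.μ - (1 - c.p) * c.σ ^ 2) / (u / c.p) = v / u := by
    field_simp; rw [hu, hv]; ring
  rw [e1]
  have e2 : c.δ = (u + c.p * (1 - c.p) * c.σ ^ 2) / 2 := by rw [hu]; ring
  have e5 : c.p * (4 * (c.δ / c.p) * (2 * (c.μ - (1 - c.p) * c.σ ^ 2) / (u / c.p)) - 4 * c.μ
      + 2 * ((1 - c.p) * c.σ ^ 2)) - 2 * ((1 - c.p) * c.σ ^ 2)
        * (2 * (c.μ - (1 - c.p) * c.σ ^ 2) / (u / c.p))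
      = -2 * c.p * (1 - c.p) * c.σ ^ 2
        * (2 * c.δ + 2 * (1 - c.p) * c.μ + (c.p - 2) * (1 - c.p) * c.σ ^ 2) / u := by
    field_simp
    rw [e2]
    ring
  rw [e5]
  field_simp

/-! ### The graphs of the level curve -/

theorem Admissible.setOf_polyP (h : c.Admissible) {x : ℝ} (hx : 0 ≤ h.reduce.disc x) :
    {z | c.polyP x z = 0 * c.polyQ x z} = {h.reduce.bot x / c.q, h.reduce.top x / c.q} := by
  have hq := h.q_pos
  ext z
  simp only [mem_ofPred_eq, zero_mul, mem_insert_iff, mem_singleton_iff]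
  rw [h.polyP_eq, mul_eq_zero, or_iff_right h.one_sub_pos.ne', eq_div_iff hq.ne', eq_div_iff hq.ne',
    mul_comm z]
  constructor
  · intro h0
    have h1 := (Reduced.P_nonneg_iff hx).1 h0.ge
    have h2 : ¬0 < h.reduce.P x (c.q * z) := h0.not_gt
    rw [Reduced.P_pos_iff] at h2
    by_contra hcon
    push Not at hcon
    exact h2 ⟨lt_of_le_of_ne h1.1 hcon.1.symm, lt_of_le_of_ne h1.2 hcon.2⟩
  · rintro (h0 | h0)
    · rw [h0, Reduced.P_bot hx]
    · rw [h0, Reduced.P_top hx]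

theorem Admissible.upperGraph_eq (h : c.Admissible) {x : ℝ} (hx : 0 ≤ h.reduce.disc x) :
    c.upperGraph x 0 = h.reduce.top x / c.q := by
  rw [upperGraph, h.setOf_polyP hx, csSup_pair, sup_eq_right]
  exact div_le_div_of_nonneg_right (h.reduce.bot_le_top x) h.q_pos.le

theorem Admissible.lowerGraph_eq (h : c.Admissible) {x : ℝ} (hx : 0 ≤ h.reduce.disc x) :
    c.lowerGraph x 0 = h.reduce.bot x / c.q := by
  rw [lowerGraph, h.setOf_polyP hx, csInf_pair, inf_eq_left]
  exact div_le_div_of_nonneg_right (h.reduce.bot_le_top x) h.q_pos.le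

theorem Admissible.disc_nonneg (h : c.Admissible) {x : ℝ} (hx : x ∈ c.levelDomain 0) :
    0 ≤ h.reduce.disc x := by
  obtain ⟨-, z, hz⟩ := hx
  rw [zero_mul, h.polyP_eq, mul_eq_zero, or_iff_right h.one_sub_pos.ne'] at hz
  exact Reduced.disc_nonneg_of_P_nonneg hz.ge

theorem Admissible.inside_iff (h : c.Admissible) {x z : ℝ} (hx : 0 < x) :
    (x ∈ c.levelDomain 0 ∧ c.lowerGraph x 0 ≤ z ∧ z ≤ c.upperGraph x 0) ↔
      0 ≤ h.reduce.P x (c.q * z) := by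
  have hq := h.q_pos
  have key : 0 ≤ h.reduce.disc x → ((c.lowerGraph x 0 ≤ z ∧ z ≤ c.upperGraph x 0) ↔
      0 ≤ h.reduce.P x (c.q * z)) := fun hd => by
    rw [h.lowerGraph_eq hd, h.upperGraph_eq hd, Reduced.P_nonneg_iff hd, div_le_iff₀' hq,
      le_div_iff₀' hq]
  constructor
  · rintro ⟨h1, h2⟩
    exact (key (h.disc_nonneg h1)).1 h2
  · intro h1
    have hd := Reduced.disc_nonneg_of_P_nonneg h1
    refine ⟨⟨hx, h.reduce.top x / c.q, ?_⟩, (key hd).2 h1⟩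
    have : h.reduce.top x / c.q ∈ {z | c.polyP x z = 0 * c.polyQ x z} := by
      rw [h.setOf_polyP hd]; exact Or.inr rfl
    exact this

theorem Admissible.isInner_iff (h : c.Admissible) {D : Set ℝ} {g : ℝ → ℝ} :
    c.IsInnerSolution D g ↔ h.reduce.IsInner D (fun x => c.q * g x) := by
  have hq := h.q_pos
  constructor
  · intro hD
    refine ⟨hD.interval, hD.pos, hD.continuous.const_mul _ , fun x hx =>
      (h.inside_iff (hD.pos hx)).1 (hD.inside x hx), fun x hx hne => ?_⟩
    rw [h.xP_eq] at hne
    obtain ⟨h1, h2⟩ := hD.equation x hx hne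
    rw [h.polyQ_eq] at h1
    refine ⟨h1, ?_⟩
    rw [← h.L_eq]
    exact h2.const_mul c.q
  · intro hD
    have hg : g = fun x => (c.q * g x) / c.q := by
      funext x; field_simp
    refine ⟨⟨hD.interval, hD.pos, ?_, fun x hx hne => ?_⟩, fun x hx =>
      (h.inside_iff (hD.pos hx)).2 (hD.P_nonneg x hx)⟩
    · rw [hg]; exact hD.continuous.div_const _
    · rw [← h.xP_eq] at hne
      obtain ⟨h1, h2⟩ := hD.equation x hx hne
      rw [h.polyQ_eq]
      refine ⟨h1, ?_⟩
      rw [← h.L_eq] at h2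
      have h3 := h2.div_const c.q
      rw [mul_div_cancel_left₀ _ hq.ne'] at h3
      rwa [← hg] at h3

/-! ### The equation with the infimum -/

/-- The expression is quadratic in `(Σ, θ)` with leading coefficients `A / 2`, `-B`, `C / 2`. `hdet`
is positive definiteness `A C > B²`, and `hP` says that the minimum `c₀ - σ² x² (A + C - 2B) / (2 (A
C - B²))` is zero. -/
theorem hjbAt_of_level (h : c.Admissible) {g : ℝ → ℝ} {x d : ℝ} (hx : 0 < x) (hd : 0 < d)
    (hg : deriv g x = d) (hP : c.polyP x (g x) = d * c.polyQ x (g x))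
    (hdet : (1 + c.q) * x * d < c.q * g x * (1 + d)) : c.HJBAt g x := by
  have hq := h.q_pos
  have h1 := h.one_sub_pos
  have hp := h.p_pos
  set z := g x
  set A := x * (1 / d + 1) with hA
  set B := (1 + c.q) * x with hB
  set C := (1 + c.q) * (c.q * z) with hC
  have hA0 : 0 < A := by positivity
  have hΔ : 0 < A * C - B ^ 2 := by
    have e : A * C - B ^ 2 = (1 + c.q) * x / d * (c.q * z * (1 + d) - (1 + c.q) * x * d) := by
      rw [hA, hB, hC]; field_simp
    rw [e]
    have : 0 < c.q * z * (1 + d) - (1 + c.q) * x * d := by linarith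
    positivity
  set c₀ := c.μ * x + 1 - (1 + c.q) * c.δ * z with hc₀
  have hrel : 2 * (A * C - B ^ 2) * c₀ = c.σ ^ 2 * x ^ 2 * (A + C - 2 * B) := by
    have hPQ : c.polyP x z - d * c.polyQ x z = 0 := by linarith
    have e : (2 * (A * C - B ^ 2) * c₀ - c.σ ^ 2 * x ^ 2 * (A + C - 2 * B)) * (d * (1 - c.p) ^ 3)
        = x * (1 - c.p) * (c.polyP x z - d * c.polyQ x z) := by
      simp only [hA, hB, hC, hc₀, polyQ, polyP, q]
      field_simp
      ring
    rw [hPQ, mul_zero] at e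
    have := (mul_eq_zero.1 e).resolve_right (by positivity)
    linarith
  -- completing the square
  have hform : ∀ S θ : ℝ, S ^ 2 / 2 * (x / d) - c.alphaQ S θ * x - c.betaFn θ * z + 1
      = A / 2 * S ^ 2 - B * S * θ + C / 2 * θ ^ 2 + c.σ * x * S - c.σ * x * θ + c₀ := by
    intro S θ
    simp only [hA, hB, hC, hc₀, alphaQ, betaFn]
    ring
  have hsq : ∀ S θ : ℝ, 2 * A * (A * C - B ^ 2) *
      (S ^ 2 / 2 * (x / d) - c.alphaQ S θ * x - c.betaFn θ * z + 1)
      = (A * C - B ^ 2) * (A * S - B * θ + c.σ * x) ^ 2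
        + ((A * C - B ^ 2) * θ - c.σ * x * (A - B)) ^ 2 := by
    intro S θ
    rw [hform]
    linear_combination A * hrel
  rw [HJBAt, hg]
  -- The infimum is attained at the critical point of the quadratic polynomial, where both squares
  -- of `hsq` vanish.
  refine IsLeast.isGLB ⟨⟨(c.σ * x * (B - C) / (A * C - B ^ 2), c.σ * x * (A - B) / (A * C - B ^ 2)),
    ?_⟩, ?_⟩
  · have h2 := hsq (c.σ * x * (B - C) / (A * C - B ^ 2)) (c.σ * x * (A - B) / (A * C - B ^ 2))
    have e1 : A * (c.σ * x * (B - C) / (A * C - B ^ 2)) - B * (c.σ * x * (A - B) / (A * C - B ^ 2))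
        + c.σ * x = 0 := by field_simp; ring
    have e2 : (A * C - B ^ 2) * (c.σ * x * (A - B) / (A * C - B ^ 2)) - c.σ * x * (A - B) = 0 := by
      field_simp; ring
    rw [e1, e2] at h2
    simp only [ne_eq, OfNat.ofNat_ne_zero, not_false_eq_true, zero_pow, mul_zero, add_zero] at h2
    exact (mul_eq_zero.1 h2).resolve_left (by positivity)
  · rintro _ ⟨⟨S, θ⟩, rfl⟩
    have h2 := hsq S θ
    have h3 : 0 < 2 * A * (A * C - B ^ 2) := by positivity
    refine le_of_mul_le_mul_left ?_ h3
    rw [mul_zero]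
    refine le_of_le_of_eq ?_ h2.symm
    positivity

end Params
end
end ShadowODE

namespace ShadowODE
noncomputable section
namespace Params
variable {c : Params}

/-! ### The family in the original variables -/

/-- The maximal inner solution from the point of the upper graph over `α`. -/
def Admissible.famZ (h : c.Admissible) (α x : ℝ) : ℝ := h.reduce.fam α x / c.q

theorem Admissible.mem_Ioo (h : c.Admissible) {α : ℝ} (hα : α ∈ Ioo 0 c.xN) :
    α ∈ Ioo 0 h.reduce.xN := by rwa [h.xN_eq]

theorem Admissible.q_mul_famZ (h : c.Admissible) (α x : ℝ) :
    c.q * h.famZ α x = h.reduce.fam α x := mul_div_cancel₀ _ h.q_pos.ne'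

theorem Admissible.famZ_xP (h : c.Admissible) {α : ℝ} (hα : α ∈ Ioo 0 c.xN) (hP : α ≤ c.xP) :
    h.famZ α c.xP = h.reduce.xP / c.q := by
  rw [famZ, ← h.xP_eq, Reduced.fam_xP_of_mem (h.mem_Ioo hα) (by rwa [h.xP_eq])]

theorem Admissible.isInnerSolution_famZ (h : c.Admissible) {α : ℝ} (hα : α ∈ Ioo 0 c.xN) :
    c.IsInnerSolution (Icc α (h.reduce.finish α)) (h.famZ α) := by
  rw [h.isInner_iff]
  simp only [h.q_mul_famZ]
  exact Reduced.isInner_fam (h.mem_Ioo hα)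

theorem Admissible.upperGraph_eq' (h : c.Admissible) {α : ℝ} (hα : α ∈ Ioo 0 c.xN) :
    c.upperGraph α 0 = h.reduce.top α / c.q := by
  have hα' := h.mem_Ioo hα
  exact h.upperGraph_eq ((Reduced.disc_nonneg_iff hα.1).2 (hα'.2.trans h.reduce.xN_lt_xE).le)

theorem Admissible.subset_and_eqOn (h : c.Admissible) {α : ℝ} {D : Set ℝ} {g : ℝ → ℝ}
    (hD : c.IsInnerSolution D g) (hα : α ∈ Ioo 0 c.xN) (hne : α ≠ c.xP) (hmem : α ∈ D)
    (h0 : g α = c.upperGraph α 0) : D ⊆ Icc α (h.reduce.finish α) ∧ EqOn g (h.famZ α) D := by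
  have hq := h.q_pos
  obtain ⟨h1, h2⟩ := (h.isInner_iff.1 hD).subset_and_eqOn (h.mem_Ioo hα)
    (by rwa [h.xP_eq]) hmem (by rw [h0, h.upperGraph_eq' hα]; field_simp)
  refine ⟨h1, fun x hx => ?_⟩
  rw [famZ, ← h2 hx]
  field_simp

theorem Admissible.isMaximalInnerSolutionFrom_famZ (h : c.Admissible) {α : ℝ}
    (hα : α ∈ Ioo 0 c.xN) (hne : α ≠ c.xP) :
    c.IsMaximalInnerSolutionFrom α (Icc α (h.reduce.finish α)) (h.famZ α) := by
  have hα' := h.mem_Ioo hα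
  have hmem : α ∈ Icc α (h.reduce.finish α) := ⟨le_rfl, (Reduced.lt_finish hα').le⟩
  have h0 : h.famZ α α = c.upperGraph α 0 := by
    rw [h.upperGraph_eq' hα, famZ, Reduced.fam_start hα']
  refine ⟨⟨h.isInnerSolution_famZ hα, fun D' g' hD' hsub heq => ?_⟩, hmem, h0⟩
  exact ((h.subset_and_eqOn hD' hα hne (hsub hmem) (by rw [heq hmem, h0])).1).antisymm hsub

/-- The given solution is a restriction of `famZ`, which is itself inner; maximality of the given
one leaves no room for a proper extension. -/
theorem Admissible.domain_eq (h : c.Admissible) {α : ℝ} {D : Set ℝ} {g : ℝ → ℝ}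
    (hD : c.IsMaximalInnerSolutionFrom α D g) (hα : α ∈ Ioo 0 c.xN) (hne : α ≠ c.xP) :
    D = Icc α (h.reduce.finish α) ∧ EqOn g (h.famZ α) (Icc α (h.reduce.finish α)) := by
  obtain ⟨h1, h2⟩ := h.subset_and_eqOn hD.toIsInnerSolution hα hne hD.mem hD.initial
  have := hD.maximal _ _ (h.isInnerSolution_famZ hα) h1 fun x hx => (h2 hx).symm
  exact ⟨this.symm, by rw [this]; exact h2⟩

section eqOn
variable {α : ℝ} {g : ℝ → ℝ}

theorem Admissible.hasDerivAt_of_eqOn (h : c.Admissible) {x : ℝ} (hα : α ∈ Ioo 0 c.xN)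
    (hg : EqOn g (h.famZ α) (Icc α (h.reduce.finish α))) (hx : x ∈ Ioo α (h.reduce.finish α)) :
    HasDerivAt g (h.reduce.famSlope α x / c.q) x := by
  refine ((Reduced.hasDerivAt_fam (h.mem_Ioo hα) hx).div_const c.q).congr_of_eventuallyEq ?_
  filter_upwards [Icc_mem_nhds hx.1 hx.2] with y hy
  exact hg hy

theorem Admissible.derivWithin_of_eqOn (h : c.Admissible) {x : ℝ} (hα : α ∈ Ioo 0 c.xN)
    (hg : EqOn g (h.famZ α) (Icc α (h.reduce.finish α))) (hx : x ∈ Icc α (h.reduce.finish α)) :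
    derivWithin g (Icc α (h.reduce.finish α)) x = h.reduce.famSlope α x / c.q :=
  (((Reduced.hasDerivWithinAt_fam (h.mem_Ioo hα) hx).div_const c.q).congr hg (hg hx)).derivWithin
    (uniqueDiffOn_Icc (Reduced.lt_finish (h.mem_Ioo hα)) x hx)

theorem Admissible.contDiffOn_two_of_eqOn (h : c.Admissible) (hα : α ∈ Ioo 0 c.xN)
    (hg : EqOn g (h.famZ α) (Icc α (h.reduce.finish α))) :
    ContDiffOn ℝ 2 g (Icc α (h.reduce.finish α)) :=
  ((Reduced.contDiffOn_two_fam (h.mem_Ioo hα)).div_const c.q).congr hg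

/-- At the end points `deriv g` depends on values of `g` outside the interval, which are arbitrary;
only the open interval is compared. -/
theorem Admissible.integral_eq (h : c.Admissible) (hα : α ∈ Ioo 0 c.xN)
    (hg : EqOn g (h.famZ α) (Icc α (h.reduce.finish α))) :
    IntervalIntegrable (fun x => deriv g x / x) MeasureTheory.volume α (h.reduce.finish α) ∧
    ∫ x in α..h.reduce.finish α, deriv g x / x = h.reduce.famIntegral α / c.q := by
  have hα' := h.mem_Ioo hα
  have hle := (Reduced.lt_finish hα').le
  have hd : ∀ x ∈ Ioo α (h.reduce.finish α),
      h.reduce.famSlope α x / x / c.q = deriv g x / x := fun x hx => by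
    rw [(h.hasDerivAt_of_eqOn hα hg hx).deriv]; ring
  constructor
  · refine ((Reduced.intervalIntegrable_famSlope hα').div_const c.q).congr_ae ?_
    rw [uIoc_of_le hle, ← MeasureTheory.restrict_Ioo_eq_restrict_Ioc]
    filter_upwards [MeasureTheory.ae_restrict_mem measurableSet_Ioo] with x hx
    exact hd x hx
  · rw [Reduced.famIntegral, ← intervalIntegral.integral_div,
      intervalIntegral.integral_of_le hle, intervalIntegral.integral_of_le hle,
      ← MeasureTheory.restrict_Ioo_eq_restrict_Ioc]
    exact MeasureTheory.setIntegral_congr_fun measurableSet_Ioo fun x hx => (hd x hx).symm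

theorem Admissible.hjbAt (h : c.Admissible) {x : ℝ} (hα : α ∈ Ioo 0 c.xN)
    (hg : EqOn g (h.famZ α) (Icc α (h.reduce.finish α))) (hx : x ∈ Ioo α (h.reduce.finish α)) :
    c.HJBAt g x := by
  have hq := h.q_pos
  have hα' := h.mem_Ioo hα
  have hp := h.p_pos
  have h1 := h.one_sub_pos
  have hk := Reduced.famSlope_pos hα' hx
  obtain ⟨h2, h3⟩ := Reduced.fam_level hα' hx
  have hw : h.reduce.fam α x = c.q * g x := by
    rw [hg (Ioo_subset_Icc_self hx), h.q_mul_famZ]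
  rw [hw] at h2 h3
  have h2' : c.p * h.reduce.P x (c.q * g x)
      = h.reduce.famSlope α x * h.reduce.Q x (c.q * g x) := h2
  have h3' : 0 < c.p * (c.q * g x) - h.reduce.famSlope α x * x
      + (1 - c.p) * h.reduce.famSlope α x * (c.q * g x) := h3
  set k := h.reduce.famSlope α x
  refine hjbAt_of_level h (hα.1.trans hx.1) (div_pos hk hq) (h.hasDerivAt_of_eqOn hα hg hx).deriv
    ?_ ?_
  · rw [h.polyP_eq, h.polyQ_eq, div_mul_eq_mul_div, ← h2', eq_div_iff hq.ne']
    linear_combination h.reduce.P x (c.q * g x) * h.q_mul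
  · rw [← sub_pos]
    have e : (c.q * g x * (1 + k / c.q) - (1 + c.q) * x * (k / c.q)) * (c.q * (1 - c.p))
        = c.p * (c.q * g x) - k * x + (1 - c.p) * k * (c.q * g x) := by
      simp only [q]
      field_simp
      ring
    rw [← e] at h3'
    exact pos_of_mul_pos_left h3' (by positivity)

theorem Admissible.solvesFreeBoundary (h : c.Admissible) (hα : α ∈ Ioo 0 c.xN)
    (hg : EqOn g (h.famZ α) (Icc α (h.reduce.finish α))) :
    c.SolvesFreeBoundary α (h.reduce.finish α) g (h.reduce.famIntegral α / c.q) := by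
  have hq := h.q_pos
  have hα' := h.mem_Ioo hα
  have hlt := Reduced.lt_finish hα'
  have hd := fun x hx => (h.hasDerivAt_of_eqOn (x := x) hα hg hx).deriv
  have hc := (Reduced.continuousOn_famSlope hα').div_const c.q
  refine ⟨hα.1, hlt, h.contDiffOn_two_of_eqOn hα hg, fun x hx => ?_,
    fun x hx => h.hjbAt hα hg hx, ?_, ?_, (h.integral_eq hα hg).1, (h.integral_eq hα hg).2⟩
  · rw [hd x hx]; exact div_pos (Reduced.famSlope_pos hα' hx) hq
  · rcases eq_or_ne α c.xP with hP | hP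
    · left
      rw [hg ⟨le_rfl, hlt.le⟩, h.zP_eq, ← h.famZ_xP hα hP.le, ← hP]
    · right
      have h1 := hc α ⟨le_rfl, hlt.le⟩
      rw [ContinuousWithinAt, Reduced.famSlope_start hα' (by rwa [h.xP_eq]), zero_div] at h1
      refine (h1.mono_left (nhdsWithin_le_of_mem
        (mem_of_superset (Ioo_mem_nhdsGT hlt) Ioo_subset_Icc_self))).congr' ?_
      filter_upwards [Ioo_mem_nhdsGT hlt] with x hx
      exact (hd x hx).symm
  · have h1 := hc _ ⟨hlt.le, le_rfl⟩
    rw [ContinuousWithinAt, Reduced.famSlope_finish hα', zero_div] at h1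
    refine (h1.mono_left (nhdsWithin_le_of_mem
      (mem_of_superset (Ioo_mem_nhdsLT hlt) Ioo_subset_Icc_self))).congr' ?_
    filter_upwards [Ioo_mem_nhdsLT hlt] with x hx
    exact (hd x hx).symm

end eqOn

theorem Admissible.hasDerivAt_upperGraph (h : c.Admissible) :
    HasDerivAt (fun x => c.upperGraph x 0) (h.reduce.m / c.q) c.xP := by
  have h1 := (Reduced.hasDerivAt_top_xP (n := h.reduce)).div_const c.q
  rw [h.xP_eq] at h1
  refine h1.congr_of_eventuallyEq ?_
  have h2 : c.xP ∈ Ioo 0 h.reduce.xE := by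
    rw [← h.xP_eq]; exact ⟨h.reduce.xP_pos, h.reduce.xP_lt_xE⟩
  filter_upwards [Ioo_mem_nhds h2.1 h2.2] with x hx
  exact h.upperGraph_eq ((Reduced.disc_nonneg_iff hx.1).2 hx.2.le)

/-- The limit of the family as the starting point decreases to the singular point. -/
theorem Admissible.right_limit (h : c.Admissible) (hm : 1 < c.merton) {D : ℝ → Set ℝ}
    {g : ℝ → ℝ → ℝ}
    (hkey : ∀ α ∈ Ioo 0 c.xN, α ≠ c.xP → D α = Icc α (h.reduce.finish α) ∧
      EqOn (g α) (h.famZ α) (Icc α (h.reduce.finish α))) :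
    c.xP < h.reduce.finish c.xP ∧ h.reduce.finish c.xP ≤ c.xE ∧
      Tendsto h.reduce.finish (𝓝[>] c.xP) (𝓝 (h.reduce.finish c.xP)) ∧
      (∀ x ∈ Ioo c.xP (h.reduce.finish c.xP),
        Tendsto (fun α => g α x) (𝓝[>] c.xP) (𝓝 (h.famZ c.xP x))) ∧
      Tendsto (fun α => g α (h.reduce.finish α)) (𝓝[>] c.xP)
        (𝓝 (h.famZ c.xP (h.reduce.finish c.xP))) ∧
      h.famZ c.xP c.xP = c.zP ∧
      c.IsContinuousSolution (Icc c.xP (h.reduce.finish c.xP)) (h.famZ c.xP) ∧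
      ∀ x ∈ Ioo c.xP (h.reduce.finish c.xP), c.HJBAt (h.famZ c.xP) x := by
  have hm' := h.lt_iff.2 hm
  have hPN : h.reduce.xP ∈ Ioo 0 h.reduce.xN := ⟨h.reduce.xP_pos, Reduced.xP_lt_xN hm'⟩
  have hxPN : c.xP ∈ Ioo 0 c.xN := by rwa [← h.xP_eq, ← h.xN_eq]
  have hev : ∀ᶠ α in 𝓝[>] c.xP, α ∈ Ioo c.xP c.xN := Ioo_mem_nhdsGT hxPN.2
  have hev' : ∀ᶠ α in 𝓝[>] c.xP, α ∈ Ioo c.xP c.xN ∧ α ∈ Ioo 0 h.reduce.xN ∧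
      EqOn (g α) (h.famZ α) (Icc α (h.reduce.finish α)) := by
    filter_upwards [hev] with α hα
    have hα' : α ∈ Ioo 0 c.xN := ⟨hxPN.1.trans hα.1, hα.2⟩
    exact ⟨hα, h.mem_Ioo hα', (hkey α hα' hα.1.ne').2⟩
  have hfin : Tendsto h.reduce.finish (𝓝[>] c.xP) (𝓝 (h.reduce.finish c.xP)) := by
    have h1 := Reduced.tendsto_exit hm'
    rw [h.xP_eq] at h1
    rw [Reduced.finish_of_le h.xP_eq.le]
    refine h1.congr' ?_
    filter_upwards [hev] with α hα
    rw [Reduced.finish_of_le (by rw [h.xP_eq]; exact hα.1.le)]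
  have hlim : ∀ x ∈ Ioc c.xP h.reduce.xE,
      Tendsto (fun α => h.famZ α x) (𝓝[>] c.xP) (𝓝 (h.famZ c.xP x)) := by
    intro x hx
    have h1 := Reduced.continuousAt_fam (h.mem_Ioo hxPN)
      (x := x) ⟨hxPN.1.trans hx.1, hx.2⟩ (by rw [h.xP_eq]; exact hx.1.ne')
    exact (h1.tendsto.div_const c.q).mono_left nhdsWithin_le_nhds
  have hE := h.reduce.xP_lt_xE
  rw [h.xP_eq] at hE
  refine ⟨Reduced.lt_finish (h.mem_Ioo hxPN), h.xE_eq ▸ Reduced.finish_le (h.mem_Ioo hxPN), hfin,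
    fun x hx => ?_, ?_, ?_, (h.isInnerSolution_famZ hxPN).toIsContinuousSolution,
    fun x hx => h.hjbAt hxPN (eqOn_refl _ _) hx⟩
  · refine (hlim x ⟨hx.1, hx.2.le.trans (Reduced.finish_le (h.mem_Ioo hxPN))⟩).congr' ?_
    filter_upwards [hev', Ioo_mem_nhdsGT hx.1, hfin.eventually_const_lt hx.2] with α h1 h2 h3
    exact (h1.2.2 ⟨h2.2.le, h3.le⟩).symm
  · have hval : ∀ α ∈ Ioo 0 h.reduce.xN, h.famZ α h.reduce.xE = h.famZ α (h.reduce.finish α) :=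
      fun α hα => by
        rw [famZ, famZ, Reduced.fam_of_finish_le hα ⟨Reduced.finish_le hα, le_rfl⟩]
    rw [← hval _ (h.mem_Ioo hxPN)]
    refine (hlim _ ⟨hE, le_rfl⟩).congr' ?_
    filter_upwards [hev'] with α h1
    rw [hval α h1.2.1]
    exact (h1.2.2 ⟨(Reduced.lt_finish h1.2.1).le, le_rfl⟩).symm
  · rw [h.zP_eq, h.famZ_xP hxPN le_rfl]

end Params
end
end ShadowODE

/-! ### Assembly of the theorem. -/

theorem proposition6p7 (c : ShadowODE.Params) (hμ : 0 < c.μ) (hσ : 0 < c.σ) (hδ : 0 < c.δ)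
    (hp0 : 0 < c.p) (hp1 : c.p < 1) (hG : c.μ < c.geo) (hπ : 1 ≤ c.merton) :
    -- maximal inner solutions exist
    (∀ α ∈ Ioo 0 c.xN, α ≠ c.xP → ∃ (D : Set ℝ) (g : ℝ → ℝ),
      c.IsMaximalInnerSolutionFrom α D g) ∧
    -- and, for every choice `g α` of them,
    ∀ (D : ℝ → Set ℝ) (g : ℝ → ℝ → ℝ),
      (∀ α ∈ Ioo 0 c.xN, α ≠ c.xP → c.IsMaximalInnerSolutionFrom α (D α) (g α)) →
      -- with suitable right end-points `β` and a suitable function `gP` in the role of `g x_P`,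
      ∃ (β : ℝ → ℝ) (gP : ℝ → ℝ),
        (∀ α ∈ Ioo 0 c.xN, α ≠ c.xP → α < β α ∧ β α ≤ c.xE ∧ D α = Icc α (β α)) ∧
        (1 < c.merton →
          c.xP ∈ Ioo 0 c.xN ∧
          (∀ α ∈ Ioo c.xP c.xN,
            ContDiffOn ℝ (⊤ : ℕ∞) (g α) (Icc α (β α)) ∧
            ∀ x ∈ Icc α (β α), (x, g α x) ≠ (c.xP, c.zP)) ∧
          (c.xP < β c.xP ∧ β c.xP ≤ c.xE ∧
            Tendsto β (𝓝[>] c.xP) (𝓝 (β c.xP)) ∧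
            (∀ x ∈ Ioo c.xP (β c.xP),
              Tendsto (fun α => g α x) (𝓝[>] c.xP) (𝓝 (gP x))) ∧
            Tendsto (fun α => g α (β α)) (𝓝[>] c.xP) (𝓝 (gP (β c.xP))) ∧
            gP c.xP = c.zP ∧
            c.IsContinuousSolution (Icc c.xP (β c.xP)) gP ∧
            ∀ x ∈ Ioo c.xP (β c.xP), c.HJBAt gP x) ∧
          (∀ α ∈ Ioo 0 c.xP,
            ContDiffOn ℝ 2 (g α) (Icc α (β α)) ∧
            c.xP ∈ Ioo α (β α) ∧ g α c.xP = c.zP ∧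
            DifferentiableAt ℝ (fun x => c.upperGraph x 0) c.xP ∧
            HasDerivAt (g α) (deriv (fun x => c.upperGraph x 0) c.xP) c.xP ∧
            HasDerivAt (deriv (g α)) c.secondDerivP c.xP)) ∧
        (c.merton = 1 →
          c.xN = c.xP ∧
          ∀ α ∈ Ioo 0 c.xN,
            (β α, g α (β α)) = (c.xP, c.zP) ∧
            ContDiffOn ℝ 2 (g α) (Icc α (β α)) ∧
            HasDerivWithinAt (derivWithin (g α) (Icc α (β α))) c.secondDerivP
              (Icc α (β α)) c.xP) ∧
        (∀ α ∈ Ioo 0 c.xN, IntervalIntegrable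
          (fun x => deriv (Function.update g c.xP gP α) x / x) MeasureTheory.volume α (β α)) ∧
        ContinuousOn
          (fun α => ∫ x in α..β α, deriv (Function.update g c.xP gP α) x / x) (Ioo 0 c.xN) ∧
        Tendsto (fun α => ∫ x in α..β α, deriv (Function.update g c.xP gP α) x / x)
          (𝓝[>] 0) atTop ∧
        Tendsto (fun α => ∫ x in α..β α, deriv (Function.update g c.xP gP α) x / x)
          (𝓝[<] c.xN) (𝓝 0) ∧
        ∀ lam Lam : ℝ, lam ∈ Ioo 0 1 → 0 < Lam →
          ∃ α ∈ Ioo 0 c.xN,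
            c.SolvesFreeBoundary α (β α) (Function.update g c.xP gP α)
              (Real.log ((1 + Lam) / (1 - lam))) := by
  have h : c.Admissible := ⟨hμ, hσ, hδ, hp0, hp1, hG, hπ⟩
  have hq := h.q_pos
  have key : ∀ (D : ℝ → Set ℝ) (g : ℝ → ℝ → ℝ),
      (∀ α ∈ Ioo 0 c.xN, α ≠ c.xP → c.IsMaximalInnerSolutionFrom α (D α) (g α)) →
      ∀ α ∈ Ioo 0 c.xN, α ≠ c.xP → D α = Icc α (h.reduce.finish α) ∧
        EqOn (g α) (h.famZ α) (Icc α (h.reduce.finish α)) := fun D g hDg α hα hne =>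
    h.domain_eq (hDg α hα hne) hα hne
  refine ⟨fun α hα hne => ⟨_, _, h.isMaximalInnerSolutionFrom_famZ hα hne⟩, fun D g hDg => ?_⟩
  have hkey := key D g hDg
  -- Nothing is assumed about `g c.xP`, so it is replaced by the limit solution; then every `α` is
  -- covered by `famZ`.
  have hupd : ∀ α ∈ Ioo 0 c.xN, EqOn (Function.update g c.xP (h.famZ c.xP) α) (h.famZ α)
      (Icc α (h.reduce.finish α)) := by
    intro α hα
    rcases eq_or_ne α c.xP with rfl | hne
    · rw [Function.update_self]; exact eqOn_refl _ _
    · rw [Function.update_of_ne hne]; exact (hkey α hα hne).2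
  have hint : ∀ α ∈ Ioo 0 c.xN,
      ∫ x in α..h.reduce.finish α, deriv (Function.update g c.xP (h.famZ c.xP) α) x / x
        = h.reduce.famIntegral α / c.q := fun α hα => (h.integral_eq hα (hupd α hα)).2
  refine ⟨h.reduce.finish, h.famZ c.xP, fun α hα hne => ?_, fun hm => ?_, fun hm => ?_,
    fun α hα => (h.integral_eq hα (hupd α hα)).1, ?_, ?_, ?_, fun lam Lam hl hL => ?_⟩
  · have hα' := h.mem_Ioo hα
    exact ⟨ShadowODE.Reduced.lt_finish hα', h.xE_eq ▸ ShadowODE.Reduced.finish_le hα', (hkey α hα hne).1⟩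
  · have hm' := h.lt_iff.2 hm
    have hxPN : c.xP ∈ Ioo 0 c.xN := by
      rw [← h.xP_eq, ← h.xN_eq]; exact ⟨h.reduce.xP_pos, ShadowODE.Reduced.xP_lt_xN hm'⟩
    refine ⟨hxPN, fun α hα => ?_, ?_, fun α hα => ?_⟩
    · have hα' : α ∈ Ioo 0 c.xN := ⟨hxPN.1.trans hα.1, hα.2⟩
      refine ⟨?_, fun x hx he => ?_⟩
      · refine ContDiffOn.congr ?_ (hkey α hα' hα.1.ne').2
        exact (ShadowODE.Reduced.contDiffOn_infty_fam (by rw [h.xP_eq, h.xN_eq]; exact hα)).div_const _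
      · rw [Prod.mk.injEq] at he
        exact (hα.1.trans_le hx.1).ne' he.1
    · exact h.right_limit hm hkey
    · have hα' : α ∈ Ioo 0 c.xN := ⟨hα.1, hα.2.trans hxPN.2⟩
      have hR := h.mem_Ioo hα'
      have hαP : α < h.reduce.xP := by rw [h.xP_eq]; exact hα.2
      have heq := (hkey α hα' hα.2.ne).2
      have hPβ : c.xP ∈ Ioo α (h.reduce.finish α) := by
        refine ⟨hα.2, ?_⟩
        rw [ShadowODE.Reduced.finish_of_lt hαP hm', ← h.xP_eq]
        exact (ShadowODE.Reduced.exit_spec (ShadowODE.Reduced.xP_mem hm')).1.1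
      have hderiv := fun x hx => h.hasDerivAt_of_eqOn (x := x) hα' heq hx
      have hup := h.hasDerivAt_upperGraph
      refine ⟨h.contDiffOn_two_of_eqOn hα' heq, hPβ, ?_, hup.differentiableAt, ?_, ?_⟩
      · rw [heq (Ioo_subset_Icc_self hPβ), h.zP_eq, h.famZ_xP hα' hα.2.le]
      · rw [hup.deriv, ← h.reduce.famSlope_xP α, h.xP_eq]
        exact hderiv _ hPβ
      · have h1 := (ShadowODE.Reduced.hasDerivWithinAt_famSlope hR (Ioo_subset_Icc_self hPβ)).hasDerivAt
          (Icc_mem_nhds hPβ.1 hPβ.2)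
        rw [h.secondDerivP_eq, ← h.reduce.famCurv_xP α, h.xP_eq]
        refine (h1.div_const c.q).congr_of_eventuallyEq ?_
        filter_upwards [Ioo_mem_nhds hPβ.1 hPβ.2] with y hy
        exact (hderiv y hy).deriv
  · have hm' := h.eq_iff.2 hm
    have hNP : c.xN = c.xP := by rw [← h.xP_eq, ← h.xN_eq]; exact ShadowODE.Reduced.xN_eq_xP hm'
    refine ⟨hNP, fun α hα => ?_⟩
    have hR := h.mem_Ioo hα
    have hαP : α < c.xP := hNP ▸ hα.2
    have heq := (hkey α hα hαP.ne).2
    have hβ : h.reduce.finish α = c.xP := by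
      rw [ShadowODE.Reduced.finish_of_eq (by rw [h.xP_eq]; exact hαP) hm', h.xP_eq]
    have hlt := ShadowODE.Reduced.lt_finish hR
    have hmem : c.xP ∈ Icc α (h.reduce.finish α) := by rw [hβ]; exact ⟨hαP.le, le_rfl⟩
    refine ⟨?_, h.contDiffOn_two_of_eqOn hα heq, ?_⟩
    · rw [hβ, heq hmem, h.zP_eq, h.famZ_xP hα hαP.le]
    · have h1 := ShadowODE.Reduced.hasDerivWithinAt_famSlope hR hmem
      rw [h.secondDerivP_eq, ← h.reduce.famCurv_xP α, h.xP_eq]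
      refine (h1.div_const c.q).congr (fun y hy => ?_) ?_
      · exact h.derivWithin_of_eqOn hα heq hy
      · exact h.derivWithin_of_eqOn hα heq hmem
  · refine ContinuousOn.congr ?_ hint
    rw [← h.xN_eq]
    exact ShadowODE.Reduced.continuousOn_famIntegral.div_const _
  · refine ((ShadowODE.Reduced.tendsto_famIntegral_zero (n := h.reduce)).atTop_div_const hq).congr' ?_
    filter_upwards [Ioo_mem_nhdsGT (h.xN_eq ▸ h.reduce.xN_pos)] with α hα
    exact (hint α hα).symm
  · have h1 := (ShadowODE.Reduced.tendsto_famIntegral_xN (n := h.reduce)).div_const c.q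
    rw [zero_div, h.xN_eq] at h1
    refine h1.congr' ?_
    filter_upwards [Ioo_mem_nhdsLT (h.xN_eq ▸ h.reduce.xN_pos)] with α hα
    exact (hint α hα).symm
  · have hlog : 0 < Real.log ((1 + Lam) / (1 - lam)) := by
      refine Real.log_pos ?_
      rw [one_lt_div (by linarith [hl.2])]
      linarith [hl.1]
    -- The factor `q` accounts for `w = q z`.
    obtain ⟨α, hα, hval⟩ := ShadowODE.Reduced.exists_famIntegral_eq (n := h.reduce) (mul_pos hq hlog)
    have hα' : α ∈ Ioo 0 c.xN := h.xN_eq ▸ hα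
    refine ⟨α, hα', ?_⟩
    have := h.solvesFreeBoundary hα' (hupd α hα')
    rwa [hval, mul_div_cancel_left₀ _ hq.ne'] at this
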